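/- **Setting.** Let $P:[0,1]\to\mathbb R^d$ be a polygonal curve of complexity $n\ge 2$, i.e. $P$ linearly interpolates its vertices $p_1,\dots,p_n\in\mathbb R^d$, attained at parameters $0=s_1\le\dots\le s_n=1$, and let $0=t_1<\dots<t_m=1$ be the parameters of $m\ge 3$ breakpoints. Write $P[a,b]$ for the subcurve of $P$ from $P(a)$ to $P(b)$. Let $\mathbb X^d_2=(\mathbb R^d)^2$ be the set of directed line segments in $\mathbb R^d$, each parametrized linearly over $[0,1]$. The Fréchet distance of two curves $f,g:[0,1]\to\mathbb R^d$ is $d_F(f,g)=\inf_\gamma\sup_{t\in[0,1]}\|f(\gamma(t))-g(t)\|$, where $\gamma$ ranges over the increasing bijections of $[0,1]$. For a finite set $C\subset\mathbb X^d_2$ the clustering cost is $$\phi(P,C)=\min_I\max_{(i,j)\in I}\min_{q\in C}d_F(P[t_i,t_j],q),$$ where $I$ ranges over the sets of pairs $(i,j)$ with $1\le i<j\le m$ and $\bigcup_{(i,j)\in I}[t_i,t_j]=[0,1]$. **Theorem.** For every fixed dimension $d$ there is a randomized algorithm (a program for the real RAM with unit-cost $+,-,\cdot,/,\sqrt{\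 }$ and comparisons on reals, with integers of $O(\log(n+m))$ bits, and with uniform random integers) such that the following holds. Let $P$ and $t_1,\dots,t_m$ be as above, let $\Delta\ge 0$, let $1\le k<m$, and assume that there is a set $C^*\subset\mathbb X^d_2$ of size $k$ with $\phi(P,C^*)\le\Delta$. Given $(p_i)_i$, $(s_i)_i$, $(t_j)_j$ and $\Delta$, the algorithm computes, whenever it halts, a set $C\subset\mathbb X^d_2$ with $$\phi(P,C)\le 6\Delta\qquad\text{and}\qquad |C|=O\bigl(k\log m\,\log(k\log m)\bigr);$$ its expected running time is $$O\Bigl(mk\log\tfrac mk\,\bigl(k\log m\,\log(k\log m)+m\bigr)+m^2n\Bigr),$$ and it uses $O(n+m^2)$ space in every run. The constant in the bound on $|C|$ is absolute, and the other constants depend only on $d$. -/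

import Mathlib

open scoped ENNReal NNReal

noncomputable section

/-! ## Curves, the Fréchet distance and the clustering cost -/

namespace Subtraj

/-- Points of `ℝ^d` with the Euclidean norm. -/
abbrev Pt (d : ℕ) : Type := EuclideanSpace ℝ (Fin d)

/-- A polygonal curve `[0,1] → ℝ^d` of complexity `n`: it linearly interpolates its vertices
`vertex 0, …, vertex (n-1)`, which it attains at the parameters
`0 = param 0 ≤ … ≤ param (n-1) = 1`. Consecutive vertices may coincide. The values of `toFun`
outside `[0,1]` are irrelevant. -/
structure PolygonalCurve (d n : ℕ) where
  toFun : ℝ → Pt d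
  vertex : Fin n → Pt d
  param : Fin n → ℝ
  two_le : 2 ≤ n
  param_mono : Monotone param
  param_first : param ⟨0, by omega⟩ = 0
  param_last : param ⟨n - 1, by omega⟩ = 1
  apply_param : ∀ i, toFun (param i) = vertex i
  apply_between : ∀ (i : ℕ) (hi : i + 1 < n) (t : ℝ),
    param ⟨i, by omega⟩ ≤ t → t ≤ param ⟨i + 1, hi⟩ →
    toFun t = AffineMap.lineMap (vertex ⟨i, by omega⟩) (vertex ⟨i + 1, hi⟩)
      ((t - param ⟨i, by omega⟩) / (param ⟨i + 1, hi⟩ - param ⟨i, by omega⟩))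

/-- The parameters `0 = t_1 < … < t_m = 1` of the breakpoints (indexed from `0` here). -/
structure Breakpoints (m : ℕ) where
  time : Fin m → ℝ
  two_le : 2 ≤ m
  time_strictMono : StrictMono time
  time_first : time ⟨0, by omega⟩ = 0
  time_last : time ⟨m - 1, by omega⟩ = 1

/-- The Fréchet distance of two parametrized curves: the infimum over all increasing bijections
`γ` of `[0,1]` of `sup_t ‖f (γ t) - g t‖`. -/
def frechetDist {d : ℕ} (f g : unitInterval → Pt d) : ℝ≥0∞ :=
  ⨅ γ : unitInterval ≃o unitInterval, ⨆ t : unitInterval, edist (f (γ t)) (g t)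

/-- The subcurve `P[a,b]`, parametrized over `[0,1]`. -/
def subcurve {d : ℕ} (P : ℝ → Pt d) (a b : ℝ) : unitInterval → Pt d :=
  fun u => P (a + (u : ℝ) * (b - a))

/-- Sequences of `ℓ` points of `ℝ^d`: the polygonal curves with `ℓ` vertices. -/
abbrev Center (d ℓ : ℕ) : Type := Fin ℓ → Pt d

/-- The curve given by a center with two vertices: the directed line segment. -/
def segmentCurve {d : ℕ} (q : Center d 2) : unitInterval → Pt d :=
  fun u => AffineMap.lineMap (q 0) (q 1) (u : ℝ)

/-- `I` is a set of pairs `i < j` of breakpoint indices whose parameter intervals cover `[0,1]`. -/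
def Covers {m : ℕ} (T : Breakpoints m) (I : Finset (Fin m × Fin m)) : Prop :=
  (∀ p ∈ I, p.1 < p.2) ∧
    (⋃ p ∈ I, Set.Icc (T.time p.1) (T.time p.2)) = Set.Icc (0 : ℝ) 1

/-- The clustering cost `φ(P, C) = min_I max_{(i,j) ∈ I} min_{q ∈ C} d_F(P[t_i,t_j], q)`, where `I`
ranges over the sets of pairs that cover `[0,1]`; it is `∞` if `C` is empty. -/
def clusterCost {d n m : ℕ} (P : PolygonalCurve d n) (T : Breakpoints m)
    (C : Finset (Center d 2)) : ℝ≥0∞ :=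
  ⨅ (I : Finset (Fin m × Fin m)) (_ : Covers T I), ⨆ p ∈ I, ⨅ q ∈ C,
    frechetDist (subcurve P.toFun (T.time p.1) (T.time p.2)) (segmentCurve q)

end Subtraj

/-! ## A randomized real RAM

A program works on finitely many (its text names them) integer arrays and real arrays. Reals can be
added, subtracted, multiplied, divided, compared, and their square roots taken at unit cost; there
is no rounding of reals to integers, and the only real constants are integers. Integers are used
for counting and addressing. Each executed command costs one step; the expressions in it have a
size that is fixed by the program. -/

namespace RealRAM

/-- The memory: `ints a i` and `reals a i` are the `i`-th cells of the `a`-th integer array and of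
the `a`-th real array. Cells that were never written hold `0`. The set `used` records the occupied
storage: `(false, a, i)` stands for an integer cell and `(true, a, i)` for a real cell. -/
structure Mem where
  ints : ℕ → ℕ → ℕ
  reals : ℕ → ℕ → ℝ
  used : Finset (Bool × ℕ × ℕ)

/-- Integer expressions (`sub` is truncated, `div` is the integer quotient). -/
inductive NExp where
  | lit (c : ℕ)
  | get (a : ℕ) (i : NExp)
  | add (x y : NExp)
  | sub (x y : NExp)
  | mul (x y : NExp)
  | div (x y : NExp)

/-- Real expressions. -/
inductive RExp where
  | ofNat (x : NExp)
  | get (a : ℕ) (i : NExp)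
  | add (x y : RExp)
  | sub (x y : RExp)
  | mul (x y : RExp)
  | div (x y : RExp)
  | sqrt (x : RExp)

/-- Tests. -/
inductive BExp where
  | natLE (x y : NExp)
  | realLE (x y : RExp)
  | not (b : BExp)
  | and (b c : BExp)

/-- Programs. `setInt a i x` and `setReal a i x` store the value of `x` in cell `i` of array `a`;
`rand a i x` stores there an integer drawn uniformly from `{0, …, value of x}`, independently of
all earlier draws. -/
inductive Prog where
  | skip
  | setInt (a : ℕ) (i x : NExp)
  | setReal (a : ℕ) (i : NExp) (x : RExp)
  | rand (a : ℕ) (i x : NExp)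
  | seq (c₁ c₂ : Prog)
  | ite (b : BExp) (c₁ c₂ : Prog)
  | while (b : BExp) (c : Prog)

def NExp.eval (σ : Mem) : NExp → ℕ
  | .lit c => c
  | .get a i => σ.ints a (i.eval σ)
  | .add x y => x.eval σ + y.eval σ
  | .sub x y => x.eval σ - y.eval σ
  | .mul x y => x.eval σ * y.eval σ
  | .div x y => x.eval σ / y.eval σ

def RExp.eval (σ : Mem) : RExp → ℝ
  | .ofNat x => (x.eval σ : ℝ)
  | .get a i => σ.reals a (i.eval σ)
  | .add x y => x.eval σ + y.eval σ
  | .sub x y => x.eval σ - y.eval σ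
  | .mul x y => x.eval σ * y.eval σ
  | .div x y => x.eval σ / y.eval σ
  | .sqrt x => Real.sqrt (x.eval σ)

def BExp.eval (σ : Mem) : BExp → Prop
  | .natLE x y => x.eval σ ≤ y.eval σ
  | .realLE x y => x.eval σ ≤ y.eval σ
  | .not b => ¬ b.eval σ
  | .and b c => b.eval σ ∧ c.eval σ

/-- The cells `0, …, len - 1` of an integer array (`s = false`) or of a real array (`s = true`). -/
def cells (s : Bool) (a len : ℕ) : Finset (Bool × ℕ × ℕ) :=
  (Finset.range len).image fun j => (s, a, j)

/-- Writing to cell `i` of an array makes the array occupy all its cells `0, …, i`. -/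
def Mem.setInt (σ : Mem) (a i v : ℕ) : Mem where
  ints := Function.update σ.ints a (Function.update (σ.ints a) i v)
  reals := σ.reals
  used := σ.used ∪ cells false a (i + 1)

def Mem.setReal (σ : Mem) (a i : ℕ) (v : ℝ) : Mem where
  ints := σ.ints
  reals := Function.update σ.reals a (Function.update (σ.reals a) i v)
  used := σ.used ∪ cells true a (i + 1)

/-- A configuration: the commands that remain to be executed, in this order, and the memory. -/
abbrev Config : Type := List Prog × Mem

open Classical in
/-- The distribution of the configuration after one step. A configuration with no remaining
command has halted. -/
def step : Config → PMF Config
  | ([], σ) => PMF.pure ([], σ)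
  | (.skip :: K, σ) => PMF.pure (K, σ)
  | (.setInt a i x :: K, σ) => PMF.pure (K, σ.setInt a (i.eval σ) (x.eval σ))
  | (.setReal a i x :: K, σ) => PMF.pure (K, σ.setReal a (i.eval σ) (x.eval σ))
  | (.rand a i x :: K, σ) =>
      (PMF.uniformOfFintype (Fin (x.eval σ + 1))).map fun v => (K, σ.setInt a (i.eval σ) v)
  | (.seq c₁ c₂ :: K, σ) => PMF.pure (c₁ :: c₂ :: K, σ)
  | (.ite b c₁ c₂ :: K, σ) => PMF.pure (if b.eval σ then (c₁ :: K, σ) else (c₂ :: K, σ))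
  | (.while b c :: K, σ) =>
      PMF.pure (if b.eval σ then (c :: .while b c :: K, σ) else (K, σ))

/-- The distribution of the configuration after `t` steps of the program on the given memory. -/
def run (prog : Prog) (σ : Mem) : ℕ → PMF Config
  | 0 => PMF.pure ([prog], σ)
  | t + 1 => (run prog σ t).bind step

/-- The configurations that occur with positive probability in some run. -/
def Reachable (prog : Prog) (σ : Mem) (c : Config) : Prop :=
  ∃ t, c ∈ (run prog σ t).support

/-- The expected number of steps until the program halts, as `∑_t Pr(not halted after t steps)`. -/
def expectedTime (prog : Prog) (σ : Mem) : ℝ≥0∞ :=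
  ∑' t, (run prog σ t).toOuterMeasure {c | c.1 ≠ []}

end RealRAM

/-! ## Input, output and resource bounds -/

namespace Subtraj

/-- The memory at the start. Integer array `0` holds `n, m`; real array `0` holds `Δ`; real
array `1` the parameters of the vertices; real array `2` the parameters of the breakpoints; real
array `3` the coordinates of the vertices, one vertex after the other. -/
def inputMem {d n m : ℕ} (P : PolygonalCurve d n) (T : Breakpoints m) (Δ : ℝ) :
    RealRAM.Mem where
  ints a i :=
    match a, i with
    | 0, 0 => n
    | 0, 1 => m
    | _, _ => 0
  reals a i :=
    match a with
    | 0 => if i = 0 then Δ else 0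
    | 1 => if h : i < n then P.param ⟨i, h⟩ else 0
    | 2 => if h : i < m then T.time ⟨i, h⟩ else 0
    | 3 => if h : i / d < n ∧ 0 < d then P.vertex ⟨i / d, h.1⟩ ⟨i % d, Nat.mod_lt i h.2⟩ else 0
    | _ => 0
  used := RealRAM.cells false 0 2 ∪ RealRAM.cells true 0 1 ∪ RealRAM.cells true 1 n ∪
    RealRAM.cells true 2 m ∪ RealRAM.cells true 3 (n * d)

open Classical in
/-- The output: cell `0` of integer array `1` holds a number `N`, and the cells `2dr, …, 2dr+2d-1`
of real array `4` hold the coordinates of the two vertices of the `r`-th center, for `r < N`. -/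
def outputCenters (d : ℕ) (σ : RealRAM.Mem) : Finset (Center d 2) :=
  (Finset.range (σ.ints 1 0)).image fun r =>
    fun e => WithLp.toLp 2 fun c : Fin d => σ.reals 4 ((2 * r + (e : ℕ)) * d + (c : ℕ))

/-- `k log m log (k log m)`. -/
def sizeBound (m k : ℕ) : ℝ :=
  k * Real.log m * Real.log (k * Real.log m)

/-- `m k log (m/k) (k log m log (k log m) + m) + m² n`. -/
def timeBound (n m k : ℕ) : ℝ :=
  m * k * Real.log (m / k) * (k * Real.log m * Real.log (k * Real.log m) + m) + m ^ 2 * n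

end Subtraj

end

/-! Geometry. Call the gap between breakpoints `z` and `z + 1` element `z`. A subcurve between two
breakpoints is tested against its own chord: the vertices are projected to the chord, the parameters
are clipped at 1, and their running maximum must stay within `4Δ` of the vertices. The running
maximum is monotone, so a passed test gives a Fréchet matching with the chord
(`PolygonalCurve.Pass.matched`). Conversely, a subcurve contained in one at Fréchet distance `Δ`
from some segment always passes (`LineGood.pass`). A passed pair `(x, y)` whose ends are `2Δ`-near
to breakpoints `i` and `j` is within `4Δ + 2Δ` of the segment from `i` to `j`. This defines the
relation `Covered z i j`, and it suffices to find few pairs `(i, j)` that cover all elements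
(`clusterCost_le`). Two tables with `O(m²)` entries decide the relation in constant time.

Few candidates. Only pairs with `i < j ≤ i + L` are considered, `m * L` in number. By
`exists_hitting_set`, `k + 2 * (m / L + 1)` of them cover everything: one for each optimal center
that serves a short interval, and two for each block of `L` consecutive elements, which take care of
the long intervals. The bound `L` is a power of two, initially at least `m`, and is halved until `k
≤ m / L + 1`. Then `K = 3 * (m / L + 1)` bounds the optimum, while `K * L = O(m)`.

Reweighting. All candidates start with weight 1. While the current sample leaves an element
uncovered, and the candidates covering this element have at most a `1 / (4K)` fraction of the total
weight, their weights are doubled. After `4 * ell * K` doublings with `L = 2 ^ ell` the total weight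
is at most `m * L * 4 ^ ell`. But every hitting set received one of its own doublings each time, so
one of size at most `K` would weigh at least `2 ^ (4 * ell) * K` by convexity. This is impossible
for a correct guess (`doublings_contradiction`), so an exhausted guess proves `m / L + 1 < k`.

Sampling. The sample is not redrawn after each doubling: the weight that a doubling adds is sampled
on top of the old sample, at the same rate `s / W`, where `W` is the weight at the start of the
epoch. An epoch has at most `K` doublings, so the weight stays below `2W`. The potential `samplePot`
adds a term for the size of the sample and, for every uncovered element, an exponential of the mass
that has missed it. It is a supermartingale (`samplePot_step`), starts at most at `1/2`
(`samplePot_start`), and is at least `1` when an uncovered element is heavy (`one_le_samplePot`).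
Hence a fresh sample fails with probability at most `1/2`, and in terms of costs the potential,
scaled by `epochCost`, pays for the next fresh sample.

Cost calculus. `ert` is a weakest-precondition transformer for expected steps plus expected final
cost, with value `⊤` as soon as the memory limits may be left. A loop gets its least pre-fixed
point, so that any potential function satisfying the one-step inequality bounds its cost. A finite
bound for all final costs that vanish on a postcondition yields expected time, space, word length
and correctness of every halting run at once (`run_bounds`).

Total. A guess costs `O(m² log m)` whatever `L` is, there are `O(1 + log k)` guesses, and the tables
cost `O(m² n)`. `sq_mul_log_le` compares `m² log m (1 + log k)` with the stated bound. -/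

noncomputable section

namespace RealRAM

/-! ## Expected running times of programs -/

/-- `writesI p a`: the program `p` has a command that writes to the integer array `a`. -/
def writesI : Prog → ℕ → Prop
  | .skip, _ => False
  | .setInt a _ _, x => x = a
  | .setReal _ _ _, _ => False
  | .rand a _ _, x => x = a
  | .seq p q, x => writesI p x ∨ writesI q x
  | .ite _ p q, x => writesI p x ∨ writesI q x
  | .while _ p, x => writesI p x

/-- `writesR p a`: the program `p` has a command that writes to the real array `a`. -/
def writesR : Prog → ℕ → Prop
  | .skip, _ => False
  | .setInt _ _ _, _ => False
  | .setReal a _ _, x => x = a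
  | .rand _ _ _, _ => False
  | .seq p q, x => writesR p x ∨ writesR q x
  | .ite _ p q, x => writesR p x ∨ writesR q x
  | .while _ p, x => writesR p x

/-- The arrays that `p` does not write to agree. -/
structure Frame (p : Prog) (σ τ : Mem) : Prop where
  ints : ∀ a, ¬ writesI p a → τ.ints a = σ.ints a
  reals : ∀ a, ¬ writesR p a → τ.reals a = σ.reals a

theorem Frame.rfl {p : Prog} {σ : Mem} : Frame p σ σ := ⟨fun _ _ => Eq.refl _, fun _ _ => Eq.refl _⟩

theorem Frame.trans {p : Prog} {σ τ ρ : Mem} (h : Frame p σ τ) (h' : Frame p τ ρ) :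
    Frame p σ ρ :=
  ⟨fun a ha => (h'.ints a ha).trans (h.ints a ha), fun a ha => (h'.reals a ha).trans (h.reals a ha)⟩

theorem Frame.mono {p q : Prog} {σ τ : Mem} (h : Frame p σ τ)
    (hI : ∀ a, writesI p a → writesI q a) (hR : ∀ a, writesR p a → writesR q a) :
    Frame q σ τ :=
  ⟨fun a ha => h.ints a fun h' => ha (hI a h'), fun a ha => h.reals a fun h' => ha (hR a h')⟩

/-- Bounds on the number of arrays, on their lengths, and on the integers in them. -/
structure Limits where
  arrays : ℕ
  len : ℕ
  word : ℕ

/-- The memory respects the limits. -/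
structure Limits.Safe (S : Limits) (σ : Mem) : Prop where
  used : ∀ p ∈ σ.used, p.2.1 < S.arrays ∧ p.2.2 < S.len
  word : ∀ a i, σ.ints a i ≤ S.word

theorem mem_cells {s : Bool} {a len : ℕ} {p : Bool × ℕ × ℕ} :
    p ∈ cells s a len ↔ p.1 = s ∧ p.2.1 = a ∧ p.2.2 < len := by
  obtain ⟨x, y, z⟩ := p
  simp only [cells, Finset.mem_image, Finset.mem_range, Prod.mk.injEq]
  constructor
  · rintro ⟨j, hj, rfl, rfl, rfl⟩; exact ⟨rfl, rfl, hj⟩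
  · rintro ⟨rfl, rfl, h⟩; exact ⟨z, h, rfl, rfl, rfl⟩

@[simp] theorem setInt_ints_self (σ : Mem) (a i v : ℕ) :
    (σ.setInt a i v).ints a = Function.update (σ.ints a) i v := by
  simp [Mem.setInt]

theorem setInt_ints_ne (σ : Mem) {a b : ℕ} (i v : ℕ) (h : b ≠ a) :
    (σ.setInt a i v).ints b = σ.ints b := by
  simp [Mem.setInt, h]

@[simp] theorem setInt_reals (σ : Mem) (a i v : ℕ) : (σ.setInt a i v).reals = σ.reals := rfl

@[simp] theorem setReal_ints (σ : Mem) (a i : ℕ) (v : ℝ) : (σ.setReal a i v).ints = σ.ints := rfl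

@[simp] theorem setReal_reals_self (σ : Mem) (a i : ℕ) (v : ℝ) :
    (σ.setReal a i v).reals a = Function.update (σ.reals a) i v := by
  simp [Mem.setReal]

theorem setReal_reals_ne (σ : Mem) {a b : ℕ} (i : ℕ) (v : ℝ) (h : b ≠ a) :
    (σ.setReal a i v).reals b = σ.reals b := by
  simp [Mem.setReal, h]

theorem Limits.Safe.setInt {S : Limits} {σ : Mem} (h : S.Safe σ) {a i v : ℕ}
    (ha : a < S.arrays) (hi : i < S.len) (hv : v ≤ S.word) : S.Safe (σ.setInt a i v) := by
  refine ⟨fun p hp => ?_, fun a' i' => ?_⟩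
  · rcases Finset.mem_union.1 hp with hp | hp
    · exact h.used p hp
    · obtain ⟨-, h1, h2⟩ := mem_cells.1 hp
      exact ⟨h1 ▸ ha, by omega⟩
  · have := h.word a' i'
    by_cases h1 : a' = a
    · subst h1
      by_cases h2 : i' = i
      · simpa [h2] using hv
      · simpa [h2] using this
    · rwa [setInt_ints_ne _ _ _ h1]

theorem Limits.Safe.setReal {S : Limits} {σ : Mem} (h : S.Safe σ) {a i : ℕ} {v : ℝ}
    (ha : a < S.arrays) (hi : i < S.len) : S.Safe (σ.setReal a i v) := by
  refine ⟨fun p hp => ?_, h.word⟩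
  rcases Finset.mem_union.1 hp with hp | hp
  · exact h.used p hp
  · obtain ⟨-, h1, h2⟩ := mem_cells.1 hp
    exact ⟨h1 ▸ ha, by omega⟩

theorem Limits.Safe.card_used_le {S : Limits} {σ : Mem} (h : S.Safe σ) :
    σ.used.card ≤ 2 * (S.arrays * S.len) := by
  have : σ.used ⊆ (Finset.univ : Finset Bool) ×ˢ
      (Finset.range S.arrays ×ˢ Finset.range S.len) := by
    intro p hp
    have := h.used p hp
    simp [this]
  simpa using Finset.card_le_card this

theorem Frame.setInt_of {p : Prog} {σ : Mem} {a i v : ℕ} (h : writesI p a) :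
    Frame p σ (σ.setInt a i v) :=
  ⟨fun _ hb => setInt_ints_ne _ _ _ fun hh => hb (hh ▸ h), fun _ _ => Eq.refl _⟩

theorem Frame.setReal_of {p : Prog} {σ : Mem} {a i : ℕ} {v : ℝ} (h : writesR p a) :
    Frame p σ (σ.setReal a i v) :=
  ⟨fun _ _ => Eq.refl _, fun _ hb => setReal_reals_ne _ _ _ fun hh => hb (hh ▸ h)⟩

open Classical in
/-- The expected number of steps of `p` plus the expected value of `Φ` at the end of `p`; it is `∞`
if `p` may leave the limits `S`. -/
def ert (S : Limits) : Prog → (Mem → ℝ≥0∞) → Mem → ℝ≥0∞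
  | .skip, Φ, σ => 1 + Φ σ
  | .setInt a i x, Φ, σ =>
      if S.Safe (σ.setInt a (i.eval σ) (x.eval σ)) then
        1 + Φ (σ.setInt a (i.eval σ) (x.eval σ)) else ⊤
  | .setReal a i x, Φ, σ =>
      if S.Safe (σ.setReal a (i.eval σ) (x.eval σ)) then
        1 + Φ (σ.setReal a (i.eval σ) (x.eval σ)) else ⊤
  | .rand a i x, Φ, σ =>
      if ∀ v ≤ x.eval σ, S.Safe (σ.setInt a (i.eval σ) v) then
        1 + ∑ v : Fin (x.eval σ + 1),
          ((x.eval σ + 1 : ℕ) : ℝ≥0∞)⁻¹ * Φ (σ.setInt a (i.eval σ) v) else ⊤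
  | .seq p q, Φ, σ => 1 + ert S p (ert S q Φ) σ
  | .ite b p q, Φ, σ => 1 + if b.eval σ then ert S p Φ σ else ert S q Φ σ
  -- The least pre-fixed point of the unfolding: every `f` that satisfies the one-step inequality is
  -- an upper bound, which is how potential functions enter.
  | .while b p, Φ, σ =>
      ⨅ (f : Mem → ℝ≥0∞) (_ : ∀ τ, 1 + (if b.eval τ then ert S p f τ else Φ τ) ≤ f τ), f σ

/-- Final costs need to be compared only at memories that can actually occur after `p`: safe ones
that agree with `σ` on all arrays `p` does not write. -/
theorem ert_mono_frame (S : Limits) (p : Prog) : ∀ {Φ Ψ : Mem → ℝ≥0∞} {σ : Mem}, S.Safe σ →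
    (∀ τ, S.Safe τ → Frame p σ τ → Φ τ ≤ Ψ τ) → ert S p Φ σ ≤ ert S p Ψ σ := by
  classical
  induction p with
  | skip => intro Φ Ψ σ hσ h; exact add_le_add le_rfl (h σ hσ .rfl)
  | setInt a i x =>
    intro Φ Ψ σ hσ h
    simp only [ert]
    split_ifs with h1
    · exact add_le_add le_rfl (h _ h1 (.setInt_of rfl))
    · exact le_rfl
  | setReal a i x =>
    intro Φ Ψ σ hσ h
    simp only [ert]
    split_ifs with h1
    · exact add_le_add le_rfl (h _ h1 (.setReal_of rfl))
    · exact le_rfl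
  | rand a i x =>
    intro Φ Ψ σ hσ h
    simp only [ert]
    split_ifs with h1
    · refine add_le_add le_rfl (Finset.sum_le_sum fun v _ => ?_)
      gcongr
      exact h _ (h1 _ (by omega)) (.setInt_of rfl)
    · exact le_rfl
  | seq p q ihp ihq =>
    intro Φ Ψ σ hσ h
    simp only [ert]
    refine add_le_add le_rfl (ihp hσ fun τ hτ hf => ihq hτ fun ρ hρ hf' => h ρ hρ ?_)
    exact (hf.mono (fun _ => Or.inl) fun _ => Or.inl).trans
      (hf'.mono (fun _ => Or.inr) fun _ => Or.inr)
  | ite b p q ihp ihq =>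
    intro Φ Ψ σ hσ h
    simp only [ert]
    refine add_le_add le_rfl ?_
    split_ifs
    · exact ihp hσ fun τ hτ hf => h τ hτ (hf.mono (fun _ => Or.inl) fun _ => Or.inl)
    · exact ihq hσ fun τ hτ hf => h τ hτ (hf.mono (fun _ => Or.inr) fun _ => Or.inr)
  | _ =>
    rename_i b p ih
    intro Φ Ψ σ hσ h
    simp only [ert]
    refine le_iInf₂ fun f hf => ?_
    -- A pre-fixed point raised to `⊤` outside the safe memories in the frame is still a pre-fixed
    -- point, because the body never leads out of this set at finite cost.
    refine (iInf₂_le (fun τ => if S.Safe τ ∧ Frame (.while b p) σ τ then f τ else ⊤) ?_).trans ?_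
    · intro τ
      beta_reduce
      by_cases hτ : S.Safe τ ∧ Frame (.while b p) σ τ
      · rw [if_pos hτ]
        refine le_trans (add_le_add le_rfl ?_) (hf τ)
        split_ifs
        · refine ih hτ.1 fun ρ hρ hfr => ?_
          rw [if_pos ⟨hρ, hτ.2.trans (hfr.mono (fun _ => id) fun _ => id)⟩]
        · exact h τ hτ.1 hτ.2
      · rw [if_neg hτ]; exact le_top
    · beta_reduce
      rw [if_pos ⟨hσ, .rfl⟩]

theorem ert_mono (S : Limits) (p : Prog) : ∀ {Φ Ψ : Mem → ℝ≥0∞} {σ : Mem},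
    (∀ τ, Φ τ ≤ Ψ τ) → ert S p Φ σ ≤ ert S p Ψ σ := by
  classical
  induction p with
  | skip => intro Φ Ψ σ h; exact add_le_add le_rfl (h σ)
  | setInt a i x =>
    intro Φ Ψ σ h
    simp only [ert]
    split_ifs
    · exact add_le_add le_rfl (h _)
    · exact le_rfl
  | setReal a i x =>
    intro Φ Ψ σ h
    simp only [ert]
    split_ifs
    · exact add_le_add le_rfl (h _)
    · exact le_rfl
  | rand a i x =>
    intro Φ Ψ σ h
    simp only [ert]
    split_ifs
    · refine add_le_add le_rfl (Finset.sum_le_sum fun v _ => ?_)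
      gcongr
      exact h _
    · exact le_rfl
  | seq p q ihp ihq =>
    intro Φ Ψ σ h
    exact add_le_add le_rfl (ihp fun τ => ihq h)
  | ite b p q ihp ihq =>
    intro Φ Ψ σ h
    simp only [ert]
    refine add_le_add le_rfl ?_
    split_ifs
    · exact ihp h
    · exact ihq h
  | _ =>
    rename_i b p ih
    intro Φ Ψ σ h
    simp only [ert]
    refine le_iInf₂ fun f hf => iInf₂_le f fun τ => le_trans (add_le_add le_rfl ?_) (hf τ)
    split_ifs
    · exact le_rfl
    · exact h τ

open Classical in
-- Knaster–Tarski: by monotonicity, the least pre-fixed point is a fixed point.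
theorem ert_while (S : Limits) (b : BExp) (p : Prog) (Φ : Mem → ℝ≥0∞) (σ : Mem) :
    ert S (.while b p) Φ σ =
      1 + (if b.eval σ then ert S p (ert S (.while b p) Φ) σ else Φ σ) := by
  have hle : ∀ τ, 1 + (if b.eval τ then ert S p (ert S (.while b p) Φ) τ else Φ τ) ≤
      ert S (.while b p) Φ τ := by
    intro τ
    conv_rhs => rw [ert]
    refine le_iInf₂ fun f hf => le_trans (add_le_add le_rfl ?_) (hf τ)
    split_ifs
    · refine ert_mono S p fun ρ => ?_
      rw [ert]
      exact iInf₂_le f hf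
    · exact le_rfl
  refine le_antisymm ?_ (hle σ)
  conv_lhs => rw [ert]
  refine iInf₂_le (fun τ => 1 + (if b.eval τ then ert S p (ert S (.while b p) Φ) τ else Φ τ))
    fun τ => add_le_add le_rfl ?_
  split_ifs
  · exact ert_mono S p hle
  · exact le_rfl

/-- A unit of final cost contributes at most one, as the outcomes have total probability at most
one. It lets a counted loop charge the increment of its counter outside the body. -/
theorem ert_one_add (S : Limits) (p : Prog) : ∀ (σ : Mem) (Φ : Mem → ℝ≥0∞),
    ert S p (fun τ => 1 + Φ τ) σ ≤ 1 + ert S p Φ σ := by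
  induction p with
  | skip => intro σ Ψ; simp [ert]
  | setInt a i x => intro σ Ψ; simp only [ert]; split_ifs <;> simp
  | setReal a i x => intro σ Ψ; simp only [ert]; split_ifs <;> simp
  | rand a i x =>
    intro σ Ψ; simp only [ert]; split_ifs
    · simp only [mul_add, Finset.sum_add_distrib, mul_one, Finset.sum_const,
        Finset.card_univ, Fintype.card_fin, nsmul_eq_mul]
      rw [ENNReal.mul_inv_cancel (by simp) (ENNReal.natCast_ne_top _)]
    · simp
  | seq p q ihp ihq =>
    intro σ Ψ; simp only [ert]
    exact add_le_add le_rfl ((ert_mono S p fun τ => ihq τ Ψ).trans (ihp _ _))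
  | ite b p q ihp ihq =>
    intro σ Ψ; simp only [ert]
    refine add_le_add le_rfl ?_
    split_ifs
    · exact ihp _ _
    · exact ihq _ _
  | _ =>
    rename_i b p ih
    intro σ Ψ; simp only [ert]
    rw [ENNReal.add_iInf]
    refine le_iInf fun f => ?_
    by_cases hf : ∀ τ, 1 + (if b.eval τ then ert S p f τ else Ψ τ) ≤ f τ
    · rw [iInf_pos hf]
      refine iInf₂_le (fun τ => 1 + f τ) fun τ => add_le_add le_rfl
        (le_trans ?_ (hf τ))
      split_ifs
      · exact ih _ _
      · exact le_rfl
    · simp [iInf_neg hf]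

/-! ## Soundness of `ert` -/

open Classical in
/-- The expected number of steps among the first `N`; it is `∞` if the limits may be left, or the
program may halt without `Post`, within them. -/
def truncTime (S : Limits) (Post : Mem → Prop) : ℕ → Config → ℝ≥0∞
  | 0, _ => 0
  | N + 1, c => (if S.Safe c.2 ∧ (c.1 = [] → Post c.2) then 0 else ⊤) +
      (if c.1 = [] then 0 else 1) + ∑' c', step c c' * truncTime S Post N c'

open Classical in
/-- `ert` for the remaining commands of a configuration. -/
def ertList (S : Limits) (Post : Mem → Prop) : List Prog → Mem → ℝ≥0∞
  | [], σ => if Post σ then 0 else ⊤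
  | p :: K, σ => ert S p (ertList S Post K) σ

theorem tsum_pure_mul {α : Type*} (a : α) (f : α → ℝ≥0∞) :
    ∑' c, (PMF.pure a) c * f c = f a := by
  classical
  rw [tsum_eq_single a]
  · simp
  · intro b hb; simp [PMF.pure_apply, hb]

theorem tsum_bind_mul {α β : Type*} (μ : PMF α) (κ : α → PMF β) (f : β → ℝ≥0∞) :
    ∑' b, (μ.bind κ) b * f b = ∑' a, μ a * ∑' b, κ a b * f b := by
  simp_rw [PMF.bind_apply, ← ENNReal.tsum_mul_right, ← ENNReal.tsum_mul_left]
  rw [ENNReal.tsum_comm]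
  simp_rw [mul_assoc]

/-- One machine step is matched with one unfolding of `ert`. The induction is on the number of steps
taken into account, so termination of the program plays no role. -/
theorem truncTime_le_ertList (S : Limits) (Post : Mem → Prop) : ∀ (N : ℕ) (K : List Prog)
    (σ : Mem), S.Safe σ → truncTime S Post N (K, σ) ≤ ertList S Post K σ := by
  classical
  intro N
  induction N with
  | zero => intro K σ _; exact bot_le
  | succ N ih =>
    intro K σ hσ
    cases K with
    | nil =>
      by_cases hP : Post σ
      · have := ih [] σ hσ
        simp only [ertList, hP, if_true] at this ⊢
        simp [truncTime, hσ, hP, step, nonpos_iff_eq_zero.1 this]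
      · simp [ertList, hP]
    | cons p K =>
      have hzero : (if S.Safe σ ∧ (p :: K = [] → Post σ) then (0 : ℝ≥0∞) else ⊤) +
          (if p :: K = [] then 0 else 1) = 1 := by simp [hσ]
      simp only [truncTime]
      rw [hzero]
      cases p with
      | skip =>
        simp only [step, tsum_pure_mul, ertList, ert]
        exact add_le_add le_rfl (ih _ _ hσ)
      | setInt a i x =>
        simp only [step, tsum_pure_mul, ertList, ert]
        split_ifs with h
        · exact add_le_add le_rfl (ih _ _ h)
        · exact le_top
      | setReal a i x =>
        simp only [step, tsum_pure_mul, ertList, ert]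
        split_ifs with h
        · exact add_le_add le_rfl (ih _ _ h)
        · exact le_top
      | rand a i x =>
        simp only [step, ertList, ert]
        split_ifs with h
        · refine add_le_add le_rfl ?_
          -- The random command hides two binds with `PMF.pure`: the coercion of the draw to `ℕ`,
          -- and the map to configurations.
          change ∑' c', ((((PMF.uniformOfFintype (Fin (x.eval σ + 1))).bind
            fun v => PMF.pure (v : ℕ)).bind
            fun v => PMF.pure (K, σ.setInt a (i.eval σ) v)) c' * _ : ℝ≥0∞) ≤ _
          simp_rw [tsum_bind_mul, tsum_pure_mul]
          rw [tsum_fintype]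
          refine Finset.sum_le_sum fun v _ => ?_
          rw [PMF.uniformOfFintype_apply, Fintype.card_fin]
          gcongr
          exact ih _ _ (h _ (by omega))
        · exact le_top
      | seq p q =>
        simp only [step, tsum_pure_mul, ertList, ert]
        exact add_le_add le_rfl (ih (p :: q :: K) _ hσ)
      | ite b p q =>
        simp only [step, tsum_pure_mul, ertList, ert]
        refine add_le_add le_rfl ?_
        split_ifs
        · exact ih (p :: K) _ hσ
        · exact ih (q :: K) _ hσ
      | _ =>
        rename_i b p
        refine le_trans ?_ (ert_while S b p (ertList S Post K) σ).ge
        simp only [step, tsum_pure_mul]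
        refine add_le_add le_rfl ?_
        split_ifs
        · exact ih (p :: .while b p :: K) _ hσ
        · exact ih K _ hσ

/-- Moving one step from the truncated time into the sum on the left is an induction on `t`. The
case `N = 0` bounds the expected time, and `N = 1` detects a bad configuration that is reached at
time `t`. -/
theorem truncTime_run (S : Limits) (Post : Mem → Prop) (prog : Prog) (σ : Mem) (N : ℕ) :
    ∀ t, (∑ s ∈ Finset.range t, (run prog σ s).toOuterMeasure {c | c.1 ≠ []}) +
      ∑' c, run prog σ t c * truncTime S Post N c ≤ truncTime S Post (t + N) ([prog], σ) := by
  classical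
  intro t
  induction t generalizing N with
  | zero => simp [run]
  | succ t ih =>
    have h := ih (N + 1)
    refine le_trans ?_ (h.trans (by rw [show t + 1 + N = t + (N + 1) by ring]))
    rw [Finset.sum_range_succ, add_assoc]
    refine add_le_add le_rfl ?_
    rw [run, tsum_bind_mul, PMF.toOuterMeasure_apply, ← ENNReal.tsum_add]
    refine ENNReal.tsum_le_tsum fun c => ?_
    rw [truncTime, mul_add, mul_add]
    refine add_le_add (le_trans ?_ le_add_self) le_rfl
    by_cases hc : c.1 = []
    · simp [Set.indicator, hc]
    · simp [Set.indicator, hc]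

/-- The bound is required for every `Φ` that vanishes on `Post`, so `Φ` may be `⊤` elsewhere. A
reachable configuration that is unsafe or has halted without `Post` has positive probability, and
would make the finite bound `v` infinite. -/
theorem run_bounds {S : Limits} {Post : Mem → Prop} {prog : Prog} {σ : Mem} {v : ℝ≥0∞}
    (hσ : S.Safe σ) (hv : v ≠ ⊤) (h : ∀ Φ : Mem → ℝ≥0∞, (∀ τ, S.Safe τ → Post τ → Φ τ = 0) →
      ert S prog Φ σ ≤ v) :
    (∀ c, Reachable prog σ c → S.Safe c.2 ∧ (c.1 = [] → Post c.2)) ∧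
      expectedTime prog σ ≤ v := by
  classical
  have hN : ∀ N, truncTime S Post N ([prog], σ) ≤ v := fun N =>
    (truncTime_le_ertList S Post N [prog] σ hσ).trans (h _ fun τ _ hτ => by simp [ertList, hτ])
  constructor
  · rintro c ⟨t, hc⟩
    by_contra hbad
    apply hv
    have h1 := (truncTime_run S Post prog σ 1 t).trans (hN _)
    have h2 : run prog σ t c * truncTime S Post 1 c ≤ v :=
      le_trans (le_trans (ENNReal.le_tsum c) le_add_self) h1
    rw [truncTime, if_neg hbad, top_add, top_add, ENNReal.mul_top] at h2
    · exact top_le_iff.1 h2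
    · exact (PMF.mem_support_iff _ _).1 hc
  · refine ENNReal.tsum_le_of_sum_range_le fun t => ?_
    exact le_trans le_self_add ((truncTime_run S Post prog σ 0 t).trans (hN _))

/-! ## Deterministic blocks -/

/-- From `σ`, within `T` steps, `p` ends in a memory with `Q`. -/
def Runs (S : Limits) (p : Prog) (σ : Mem) (T : ℕ) (Q : Mem → Prop) : Prop :=
  ∀ (Φ : Mem → ℝ≥0∞) (v : ℝ≥0∞), (∀ τ, S.Safe τ → Frame p σ τ → Q τ → Φ τ ≤ v) →
    ert S p Φ σ ≤ T + v

variable {S : Limits} {p q : Prog} {σ : Mem} {T T' : ℕ} {Q Q' R : Mem → Prop}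

theorem Runs.mono (h : Runs S p σ T Q) (hT : T ≤ T')
    (hQ : ∀ τ, S.Safe τ → Frame p σ τ → Q τ → Q' τ) : Runs S p σ T' Q' := fun Φ v hv =>
  (h Φ v fun τ h1 h2 h3 => hv τ h1 h2 (hQ τ h1 h2 h3)).trans
    (add_le_add (by exact_mod_cast hT) le_rfl)

theorem Runs.le (h : Runs S p σ T Q) (hT : T ≤ T') : Runs S p σ T' Q :=
  h.mono hT fun _ _ _ => id

theorem Runs.skip (hσ : S.Safe σ) (h : Q σ) : Runs S .skip σ 1 Q := fun Φ v hv => by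
  simpa [ert] using hv σ hσ .rfl h

theorem Runs.setInt {a : ℕ} {i x : NExp} (hs : S.Safe (σ.setInt a (i.eval σ) (x.eval σ)))
    (h : Q (σ.setInt a (i.eval σ) (x.eval σ))) :
    Runs S (.setInt a i x) σ 1 Q := fun Φ v hv => by
  simpa [ert, hs] using hv _ hs (.setInt_of rfl) h

theorem Runs.setReal {a : ℕ} {i : NExp} {x : RExp}
    (hs : S.Safe (σ.setReal a (i.eval σ) (x.eval σ)))
    (h : Q (σ.setReal a (i.eval σ) (x.eval σ))) :
    Runs S (.setReal a i x) σ 1 Q := fun Φ v hv => by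
  simpa [ert, hs] using hv _ hs (.setReal_of rfl) h

theorem Runs.seq (hp : Runs S p σ T R)
    (hq : ∀ τ, S.Safe τ → Frame p σ τ → R τ → Runs S q τ T' Q) :
    Runs S (.seq p q) σ (1 + T + T') Q := fun Φ v hv => by
  rw [ert]
  have := hp (ert S q Φ) (T' + v) fun τ h1 h2 h3 => hq τ h1 h2 h3 Φ v fun ρ h4 h5 h6 =>
    hv ρ h4 ((h2.mono (fun _ => Or.inl) fun _ => Or.inl).trans
      (h5.mono (fun _ => Or.inr) fun _ => Or.inr)) h6
  calc 1 + ert S p (ert S q Φ) σ ≤ 1 + (T + (T' + v)) := add_le_add le_rfl this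
    _ = _ := by push_cast; ring

theorem Runs.ite {b : BExp} (hp : b.eval σ → Runs S p σ T Q) (hq : ¬ b.eval σ → Runs S q σ T' Q) :
    Runs S (.ite b p q) σ (1 + max T T') Q := fun Φ v hv => by
  rw [ert, Nat.cast_add, Nat.cast_one, add_assoc]
  refine add_le_add le_rfl ?_
  split_ifs with hb
  · exact (hp hb Φ v fun τ h1 h2 h3 =>
      hv τ h1 (h2.mono (fun _ => Or.inl) fun _ => Or.inl) h3).trans
        (add_le_add (Nat.cast_le.2 (le_max_left _ _)) le_rfl)
  · exact (hq hb Φ v fun τ h1 h2 h3 =>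
      hv τ h1 (h2.mono (fun _ => Or.inr) fun _ => Or.inr) h3).trans
        (add_le_add (Nat.cast_le.2 (le_max_right _ _)) le_rfl)

/-- Cell `0` of an integer array. -/
abbrev var (a : ℕ) : NExp := .get a (.lit 0)

/-- Runs `p` with cell `0` of the integer array `a` equal to `0, …, N - 1`. -/
def forP (a : ℕ) (N : NExp) (p : Prog) : Prog :=
  .seq (.setInt a (.lit 0) (.lit 0)) (.while (.not (.natLE N (var a)))
    (.seq p (.setInt a (.lit 0) (.add (var a) (.lit 1)))))

theorem writesI_forP {a : ℕ} {N : NExp} {p : Prog} {b : ℕ} :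
    writesI (forP a N p) b ↔ b = a ∨ writesI p b := by
  simp only [forP, writesI]; tauto

theorem writesR_forP {a : ℕ} {N : NExp} {p : Prog} {b : ℕ} :
    writesR (forP a N p) b ↔ writesR p b := by
  simp [forP, writesR]

open Classical in
/-- A loop with the invariant `I` and the potential `g`. -/
theorem ert_forP_le {a : ℕ} {N : NExp} {Φ : Mem → ℝ≥0∞} (Nv : ℕ)
    (I : ℕ → Mem → Prop) (g : ℕ → Mem → ℝ≥0∞) (hσ : S.Safe σ)
    (ha : a < S.arrays) (hlen : 0 < S.len) (hw : Nv ≤ S.word)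
    (hN : ∀ τ, Frame (forP a N p) σ τ → N.eval τ = Nv) (hpa : ¬ writesI p a)
    (h0 : I 0 (σ.setInt a 0 0))
    -- The `3` pays for the loop test, the sequencing and the increment of the counter.
    (hstep : ∀ j < Nv, ∀ τ, S.Safe τ → Frame (forP a N p) σ τ → τ.ints a 0 = j → I j τ →
      3 + ert S p (fun ρ => if I (j + 1) (ρ.setInt a 0 (j + 1)) then
        g (j + 1) (ρ.setInt a 0 (j + 1)) else ⊤) τ ≤ g j τ)
    (hend : ∀ τ, S.Safe τ → Frame (forP a N p) σ τ → τ.ints a 0 = Nv → I Nv τ →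
      1 + Φ τ ≤ g Nv τ) :
    ert S (forP a N p) Φ σ ≤ 2 + g 0 (σ.setInt a 0 0) := by
  have hs0 : S.Safe (σ.setInt a 0 0) := hσ.setInt ha hlen (Nat.zero_le _)
  have hwr : writesI (forP a N p) a := writesI_forP.2 (Or.inl rfl)
  have key : ∀ r j τ, j + r = Nv → S.Safe τ → Frame (forP a N p) σ τ → τ.ints a 0 = j → I j τ →
      ert S (.while (.not (.natLE N (var a)))
        (.seq p (.setInt a (.lit 0) (.add (var a) (.lit 1))))) Φ τ ≤ g j τ := by
    intro r
    induction r with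
    | zero =>
      intro j τ hj hs hf hv hI
      obtain rfl : j = Nv := by omega
      rw [ert_while]
      simp only [BExp.eval, NExp.eval, hN _ hf, hv, not_le, lt_irrefl, if_false]
      exact hend _ hs hf hv hI
    | succ r ih =>
      intro j τ hj hs hf hv hI
      have hjN : j < Nv := by omega
      set w := Prog.while (.not (.natLE N (var a)))
        (.seq p (.setInt a (.lit 0) (.add (var a) (.lit 1)))) with hw'
      refine le_trans ?_ (hstep j hjN τ hs hf hv hI)
      rw [hw', ert_while, ← hw']
      simp only [BExp.eval, NExp.eval, hN _ hf, hv, not_le, hjN, if_true]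
      rw [ert]
      have : ert S p (ert S (.setInt a (.lit 0) (.add (var a) (.lit 1))) (ert S w Φ)) τ ≤
          1 + ert S p (fun ρ => if I (j + 1) (ρ.setInt a 0 (j + 1)) then
            g (j + 1) (ρ.setInt a 0 (j + 1)) else ⊤) τ := by
        refine le_trans (ert_mono_frame S p hs fun ρ hρ hfr => ?_) (ert_one_add S p τ _)
        rw [ert]
        have hρv : ρ.ints a 0 = j := by rw [hfr.ints a hpa, hv]
        have hsρ : S.Safe (ρ.setInt a 0 (j + 1)) := hρ.setInt ha hlen (by omega)
        simp only [NExp.eval, hρv]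
        rw [if_pos hsρ]
        refine add_le_add le_rfl ?_
        split_ifs with hI'
        · refine ih (j + 1) _ (by omega) hsρ ?_ (by simp) hI'
          exact (hf.trans (hfr.mono (fun b hb => writesI_forP.2 (Or.inr hb))
            fun b hb => writesR_forP.2 hb)).trans (.setInt_of hwr)
        · exact le_top
      calc _ ≤ 1 + (1 + (1 + _)) := add_le_add le_rfl (add_le_add le_rfl this)
        _ = _ := by ring
  rw [forP, ert, ert]
  simp only [NExp.eval, hs0, if_true]
  calc _ ≤ 1 + (1 + g 0 (σ.setInt a 0 0)) := by
        gcongr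
        exact key Nv 0 _ (by omega) hs0 (.setInt_of hwr) (by simp) h0
    _ = _ := by ring

theorem Runs.forP {a : ℕ} {N : NExp} (Nv : ℕ) (I : ℕ → Mem → Prop) (hσ : S.Safe σ)
    (ha : a < S.arrays) (hlen : 0 < S.len) (hw : Nv ≤ S.word)
    (hN : ∀ τ, Frame (forP a N p) σ τ → N.eval τ = Nv) (hpa : ¬ writesI p a)
    (h0 : I 0 (σ.setInt a 0 0))
    (hstep : ∀ j < Nv, ∀ τ, S.Safe τ → Frame (RealRAM.forP a N p) σ τ → τ.ints a 0 = j → I j τ →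
      Runs S p τ T fun ρ => I (j + 1) (ρ.setInt a 0 (j + 1))) :
    Runs S (RealRAM.forP a N p) σ ((T + 3) * Nv + 3) (I Nv) := by
  classical
  intro Φ v hv
  refine (ert_forP_le Nv I (fun j _ => (((T + 3) * (Nv - j) + 1 : ℕ) : ℝ≥0∞) + v)
    hσ ha hlen hw hN hpa h0 ?_ ?_).trans (le_of_eq ?_)
  · intro j hj τ h1 h2 h3 h4
    have := hstep j hj τ h1 h2 h3 h4 (fun ρ => if I (j + 1) (ρ.setInt a 0 (j + 1)) then
        (((T + 3) * (Nv - (j + 1)) + 1 : ℕ) : ℝ≥0∞) + v else ⊤)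
        ((((T + 3) * (Nv - (j + 1)) + 1 : ℕ) : ℝ≥0∞) + v) fun ρ _ _ hI => by rw [if_pos hI]
    refine (add_le_add le_rfl this).trans (le_of_eq ?_)
    obtain ⟨r, rfl⟩ : ∃ r, Nv = j + 1 + r := ⟨Nv - (j + 1), by omega⟩
    rw [show j + 1 + r - (j + 1) = r by omega, show j + 1 + r - j = r + 1 by omega]
    push_cast; ring
  · intro τ h1 h2 h3 h4
    rw [Nat.sub_self]
    simpa using hv τ h1 h2 h4
  · rw [Nat.sub_zero]; push_cast; ring

end RealRAM

namespace Subtraj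

open Set AffineMap

/-! ## Matchings of subcurves and segments -/

variable {d n m : ℕ}

/-- The subcurve on `[a,b]` is matched monotonically to the part `[α,β]` of the segment `q₀q₁`, at
distance at most `r`. -/
def Matched (P : ℝ → Pt d) (q₀ q₁ : Pt d) (r a b α β : ℝ) : Prop :=
  ∃ φ : ℝ → ℝ, MonotoneOn φ (Icc a b) ∧ ContinuousOn φ (Icc a b) ∧ φ a = α ∧ φ b = β ∧
    ∀ u ∈ Icc a b, ‖P u - lineMap q₀ q₁ (φ u)‖ ≤ r

variable {P : ℝ → Pt d} {q₀ q₁ : Pt d} {r a b c α β γ : ℝ}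

theorem Matched.refl (h : ‖P a - lineMap q₀ q₁ α‖ ≤ r) : Matched P q₀ q₁ r a a α α :=
  ⟨fun _ => α, monotoneOn_const, continuousOn_const, rfl, rfl, fun u hu => by
    rw [Icc_self, mem_singleton_iff] at hu; rwa [hu]⟩

theorem Matched.trans (hab : a ≤ b) (hbc : b ≤ c) (h₁ : Matched P q₀ q₁ r a b α β)
    (h₂ : Matched P q₀ q₁ r b c β γ) : Matched P q₀ q₁ r a c α γ := by
  obtain ⟨φ, m1, c1, s1, e1, d1⟩ := h₁
  obtain ⟨ψ, m2, c2, s2, e2, d2⟩ := h₂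
  have hR : EqOn (fun u => if u ≤ b then φ u else ψ u) ψ (Icc b c) := by
    intro u hu
    by_cases h : u ≤ b
    · have : u = b := le_antisymm h hu.1
      simp [this, e1, s2]
    · simp [h]
  have hL : EqOn (fun u => if u ≤ b then φ u else ψ u) φ (Icc a b) := fun u hu => by
    simp [hu.2]
  have hU : Icc a c = Icc a b ∪ Icc b c := (Icc_union_Icc_eq_Icc hab hbc).symm
  refine ⟨fun u => if u ≤ b then φ u else ψ u, ?_, ?_, ?_, ?_, ?_⟩
  · rw [hU]
    exact MonotoneOn.union_right (m1.congr hL.symm) (m2.congr hR.symm)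
      (isGreatest_Icc hab) (isLeast_Icc hbc)
  · rw [hU]
    exact ContinuousOn.union_of_isClosed (c1.congr hL) (c2.congr hR) isClosed_Icc isClosed_Icc
  · simpa [hab] using s1
  · simpa using (hR ⟨hbc, le_rfl⟩).trans e2
  · intro u hu
    rw [hU] at hu
    rcases hu with hu | hu
    · rw [hL hu]; exact d1 u hu
    · rw [hR hu]; exact d2 u hu

/-- Both sides are interpolated linearly, so their difference is a convex combination of the
differences at the two ends. -/
theorem Matched.piece (hab : a < b) (hαβ : α ≤ β)
    (hP : ∀ u ∈ Icc a b, P u = lineMap (P a) (P b) ((u - a) / (b - a)))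
    (ha : ‖P a - lineMap q₀ q₁ α‖ ≤ r) (hb : ‖P b - lineMap q₀ q₁ β‖ ≤ r) :
    Matched P q₀ q₁ r a b α β := by
  have hba : 0 < b - a := by linarith
  refine ⟨fun u => lineMap α β ((u - a) / (b - a)), ?_, ?_, ?_, ?_, ?_⟩
  · intro u _ v _ huv
    simp only [lineMap_apply_ring']
    have : (u - a) / (b - a) ≤ (v - a) / (b - a) := by gcongr
    nlinarith
  · simp only [lineMap_apply_ring']
    fun_prop
  · simp
  · simp [div_self hba.ne']
  · intro u hu
    set τ := (u - a) / (b - a) with hτ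
    have h0 : 0 ≤ τ := div_nonneg (by linarith [hu.1]) hba.le
    have h1 : τ ≤ 1 := by rw [hτ, div_le_one hba]; linarith [hu.2]
    have key : P u - lineMap q₀ q₁ (lineMap α β τ) =
        (1 - τ) • (P a - lineMap q₀ q₁ α) + τ • (P b - lineMap q₀ q₁ β) := by
      rw [hP u hu]
      simp only [lineMap_apply_module, smul_eq_mul]
      module
    rw [key]
    refine (norm_add_le _ _).trans ?_
    rw [norm_smul, norm_smul, Real.norm_of_nonneg h0, Real.norm_of_nonneg (by linarith : 0 ≤ 1 - τ)]
    nlinarith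

/-- Monotonicity keeps `φ` in `[0,1]`, where moving the ends of the segment by `ρ` moves each of its
points by at most `ρ`. -/
theorem Matched.perturb {p₀ p₁ : Pt d} {ρ : ℝ} (hab : a ≤ b)
    (h : Matched P q₀ q₁ r a b 0 1) (h₀ : ‖q₀ - p₀‖ ≤ ρ) (h₁ : ‖q₁ - p₁‖ ≤ ρ) :
    Matched P p₀ p₁ (r + ρ) a b 0 1 := by
  obtain ⟨φ, m1, c1, s1, e1, d1⟩ := h
  refine ⟨φ, m1, c1, s1, e1, fun u hu => ?_⟩
  have h0 : 0 ≤ φ u := s1 ▸ m1 ⟨le_rfl, hab⟩ hu hu.1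
  have h1 : φ u ≤ 1 := e1 ▸ m1 hu ⟨hab, le_rfl⟩ hu.2
  have key : P u - lineMap p₀ p₁ (φ u) = (P u - lineMap q₀ q₁ (φ u)) +
      ((1 - φ u) • (q₀ - p₀) + φ u • (q₁ - p₁)) := by
    simp only [lineMap_apply_module]
    module
  rw [key]
  refine (norm_add_le _ _).trans (add_le_add (d1 u hu) ((norm_add_le _ _).trans ?_))
  rw [norm_smul, norm_smul, Real.norm_of_nonneg h0, Real.norm_of_nonneg (by linarith : 0 ≤ 1 - φ u)]
  nlinarith

/-- A matching may be constant on intervals, while the Fréchet distance asks for bijections.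
Blending `φ` with the identity at rate `ε` makes it strictly increasing at an extra cost of `ε * ‖q
1 - q 0‖`, and `ε` tends to 0. -/
theorem frechetDist_le_of_matched {q : Center d 2} (hab : a < b)
    (h : Matched P (q 0) (q 1) r a b 0 1) :
    frechetDist (subcurve P a b) (segmentCurve q) ≤ ENNReal.ofReal r := by
  obtain ⟨φ, m1, c1, s1, e1, d1⟩ := h
  have hba : 0 < b - a := by linarith
  have hmem : ∀ u : unitInterval, a + (u : ℝ) * (b - a) ∈ Icc a b := fun u =>
    ⟨by nlinarith [u.2.1], by nlinarith [u.2.2]⟩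
  have hφ0 : ∀ u ∈ Icc a b, 0 ≤ φ u := fun u hu => s1 ▸ m1 ⟨le_rfl, hab.le⟩ hu hu.1
  have hφ1 : ∀ u ∈ Icc a b, φ u ≤ 1 := fun u hu => e1 ▸ m1 hu ⟨hab.le, le_rfl⟩ hu.2
  have hr : 0 ≤ r := (norm_nonneg _).trans (d1 a ⟨le_rfl, hab.le⟩)
  have key : ∀ ε : ℝ, 0 < ε → ε < 1 → frechetDist (subcurve P a b) (segmentCurve q) ≤
      ENNReal.ofReal (r + ε * ‖q 1 - q 0‖) := by
    intro ε h0 h1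
    let f : unitInterval → ℝ := fun u => (1 - ε) * φ (a + u * (b - a)) + ε * u
    have hf : ∀ u, f u ∈ unitInterval := fun u => by
      have h2 := hφ0 _ (hmem u)
      have h3 := hφ1 _ (hmem u)
      have h4 := u.2.1
      have h5 := u.2.2
      constructor <;> simp only [f] <;> nlinarith
    have hmono : StrictMono fun u : unitInterval => (⟨f u, hf u⟩ : unitInterval) := by
      intro u v huv
      have huv' : (u : ℝ) < v := huv
      have h2 := m1 (hmem u) (hmem v) (by nlinarith)
      change f u < f v
      simp only [f]
      nlinarith
    have hcont : Continuous f := by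
      have : Continuous fun u : unitInterval => φ (a + u * (b - a)) :=
        c1.comp_continuous (by fun_prop) hmem
      exact (continuous_const.mul this).add (by fun_prop)
    have hsurj : Function.Surjective fun u : unitInterval => (⟨f u, hf u⟩ : unitInterval) := by
      intro y
      have hy := intermediate_value_univ (0 : unitInterval) 1 hcont
      have : (y : ℝ) ∈ Icc (f 0) (f 1) := by
        have e0 : f 0 = 0 := by simp [f, s1]
        have e1' : f 1 = 1 := by simp [f, e1]
        rw [e0, e1']; exact y.2
      obtain ⟨u, hu⟩ := hy this
      exact ⟨u, Subtype.ext hu⟩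
    let e := hmono.orderIsoOfSurjective _ hsurj
    refine (iInf_le _ e.symm).trans (iSup_le fun t => ?_)
    obtain ⟨u, rfl⟩ := e.surjective t
    rw [OrderIso.symm_apply_apply, edist_dist, dist_eq_norm]
    refine ENNReal.ofReal_le_ofReal ?_
    have he : ((e u : unitInterval) : ℝ) = f u := rfl
    simp only [subcurve, segmentCurve, he]
    set w := φ (a + u * (b - a)) with hw
    have hsplit : P (a + u * (b - a)) - lineMap (q 0) (q 1) (f u) =
        (P (a + u * (b - a)) - lineMap (q 0) (q 1) w) + (ε * (w - u)) • (q 1 - q 0) := by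
      simp only [f, ← hw, lineMap_apply_module]
      module
    rw [hsplit]
    refine (norm_add_le _ _).trans (add_le_add (d1 _ (hmem u)) ?_)
    rw [norm_smul]
    refine mul_le_mul_of_nonneg_right ?_ (norm_nonneg _)
    have h2 := hφ0 _ (hmem u)
    have h3 := hφ1 _ (hmem u)
    have h4 := u.2.1
    have h5 := u.2.2
    rw [← hw] at h2 h3
    rw [Real.norm_eq_abs, abs_le]
    constructor <;> nlinarith
  have hlim : Filter.Tendsto (fun ε : ℝ => ENNReal.ofReal (r + ε * ‖q 1 - q 0‖))
      (nhdsWithin 0 (Ioi 0)) (nhds (ENNReal.ofReal r)) := by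
    have : Continuous fun ε : ℝ => ENNReal.ofReal (r + ε * ‖q 1 - q 0‖) :=
      ENNReal.continuous_ofReal.comp (by fun_prop)
    have h := (this.tendsto 0).mono_left (nhdsWithin_le_nhds (s := Ioi 0))
    simpa using h
  refine ge_of_tendsto hlim ?_
  filter_upwards [Ioo_mem_nhdsGT (zero_lt_one' ℝ)] with ε hε
  exact key ε hε.1 hε.2

/-- Up to every positive error, the subcurve on `[a,b]` follows some line monotonically at
distance `Δ`. -/
def LineGood (P : ℝ → Pt d) (Δ a b : ℝ) : Prop :=
  ∀ ε > 0, ∃ (q₀ q₁ : Pt d) (l : ℝ → ℝ), MonotoneOn l (Icc a b) ∧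
    ∀ u ∈ Icc a b, ‖P u - lineMap q₀ q₁ (l u)‖ ≤ Δ + ε

/-- Closeness to a line is visibly inherited by subintervals. This is why it, rather than the test
itself, is the hypothesis under which all shorter pairs pass. -/
theorem LineGood.subset {Δ a' b' : ℝ} (h : LineGood P Δ a b) (ha : a ≤ a') (hb : b' ≤ b) :
    LineGood P Δ a' b' := fun ε hε => by
  obtain ⟨q₀, q₁, l, h1, h2⟩ := h ε hε
  exact ⟨q₀, q₁, l, h1.mono (Icc_subset_Icc ha hb), fun u hu => h2 u (Icc_subset_Icc ha hb hu)⟩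

/-! ### Consequences of a small Fréchet distance -/

theorem exists_reparam_of_frechetDist_le {f g : unitInterval → Pt d} {Δ ε : ℝ} (hΔ : 0 ≤ Δ)
    (h : frechetDist f g ≤ ENNReal.ofReal Δ) (hε : 0 < ε) :
    ∃ γ : unitInterval ≃o unitInterval, ∀ t, ‖f (γ t) - g t‖ ≤ Δ + ε := by
  have : frechetDist f g < ENNReal.ofReal (Δ + ε) :=
    h.trans_lt ((ENNReal.ofReal_lt_ofReal_iff (by linarith)).2 (by linarith))
  obtain ⟨γ, hγ⟩ := iInf_lt_iff.1 this
  refine ⟨γ, fun t => ?_⟩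
  have h1 := (le_iSup (fun t => edist (f (γ t)) (g t)) t).trans hγ.le
  rw [edist_dist, ENNReal.ofReal_le_ofReal_iff (by linarith), dist_eq_norm] at h1
  exact h1

/-- The inverse of a nearly optimal reparametrization follows the segment. The infimum need not be
attained, which is why `LineGood` allows every positive error. -/
theorem LineGood.of_frechetDist_le {q : Center d 2} {Δ : ℝ} (hΔ : 0 ≤ Δ) (hab : a < b)
    (h : frechetDist (subcurve P a b) (segmentCurve q) ≤ ENNReal.ofReal Δ) :
    LineGood P Δ a b := by
  intro ε hε
  obtain ⟨γ, hγ⟩ := exists_reparam_of_frechetDist_le hΔ h hε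
  have hba : 0 < b - a := by linarith
  let pr : ℝ → unitInterval := fun u => projIcc 0 1 zero_le_one ((u - a) / (b - a))
  refine ⟨q 0, q 1, fun u => (γ.symm (pr u) : ℝ), ?_, fun u hu => ?_⟩
  · intro u _ v _ huv
    refine γ.symm.monotone (monotone_projIcc _ ?_)
    gcongr
  · have := hγ (γ.symm (pr u))
    rw [OrderIso.apply_symm_apply] at this
    have hpr : ((pr u : unitInterval) : ℝ) = (u - a) / (b - a) := by
      have : (u - a) / (b - a) ∈ Icc (0 : ℝ) 1 :=
        ⟨div_nonneg (by linarith [hu.1]) hba.le, by rw [div_le_one hba]; linarith [hu.2]⟩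
      simp only [pr, projIcc_of_mem _ this]
    simp only [subcurve, segmentCurve, hpr] at this
    rwa [show a + (u - a) / (b - a) * (b - a) = u by field_simp; ring] at this

theorem endpoints_of_frechetDist_le {q : Center d 2} {Δ : ℝ} (hΔ : 0 ≤ Δ)
    (h : frechetDist (subcurve P a b) (segmentCurve q) ≤ ENNReal.ofReal Δ) :
    ‖P a - q 0‖ ≤ Δ ∧ ‖P b - q 1‖ ≤ Δ := by
  constructor <;> refine le_of_forall_pos_le_add fun ε hε => ?_ <;>
    obtain ⟨γ, hγ⟩ := exists_reparam_of_frechetDist_le hΔ h hε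
  · have h1 := hγ 0
    have : γ 0 = 0 := γ.map_bot
    simpa [this, subcurve, segmentCurve] using h1
  · have h1 := hγ 1
    have : γ 1 = 1 := γ.map_top
    simpa [this, subcurve, segmentCurve] using h1

/-! ## The test of a subcurve -/

/-- The parameter of the projection of `p` to the line through `a` and `b`. -/
def projParam (a b p : Pt d) : ℝ := inner ℝ (p - a) (b - a) / inner ℝ (b - a) (b - a)

namespace PolygonalCurve

variable (P : PolygonalCurve d n)

/-- The parameter of vertex `v`. -/
def sv (v : ℕ) : ℝ := if h : v < n then P.param ⟨v, h⟩ else 0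

/-- Vertex `v`. -/
def vt (v : ℕ) : Pt d := if h : v < n then P.vertex ⟨v, h⟩ else 0

theorem sv_zero : P.sv 0 = 0 := by
  have := P.two_le
  rw [sv, dif_pos (by omega)]; exact P.param_first

theorem sv_last : P.sv (n - 1) = 1 := by
  have := P.two_le
  rw [sv, dif_pos (by omega)]; exact P.param_last

theorem sv_mono {v w : ℕ} (h : v ≤ w) (hw : w < n) : P.sv v ≤ P.sv w := by
  rw [sv, sv, dif_pos hw, dif_pos (by omega)]
  exact P.param_mono h

theorem toFun_sv {v : ℕ} (h : v < n) : P.toFun (P.sv v) = P.vt v := by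
  rw [sv, vt, dif_pos h, dif_pos h, P.apply_param]

theorem toFun_between {v : ℕ} (h : v + 1 < n) {t : ℝ} (h₁ : P.sv v ≤ t) (h₂ : t ≤ P.sv (v + 1)) :
    P.toFun t = lineMap (P.vt v) (P.vt (v + 1)) ((t - P.sv v) / (P.sv (v + 1) - P.sv v)) := by
  have hv : v < n := by omega
  rw [sv, sv, dif_pos h, dif_pos hv] at *
  rw [vt, vt, dif_pos h, dif_pos hv]
  exact P.apply_between v h t h₁ h₂

theorem toFun_sub {v : ℕ} (h : v + 1 < n) {c c' t : ℝ} (hc : P.sv v ≤ c) (hct : c ≤ t)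
    (htc : t ≤ c') (hcc : c < c') (hc' : c' ≤ P.sv (v + 1)) :
    P.toFun t = lineMap (P.toFun c) (P.toFun c') ((t - c) / (c' - c)) := by
  rw [P.toFun_between h (hc.trans hct) (htc.trans hc'), P.toFun_between h hc (by linarith),
    P.toFun_between h (by linarith) hc']
  have h1 : P.sv (v + 1) - P.sv v ≠ 0 := by
    have : P.sv v < P.sv (v + 1) := by linarith
    linarith
  have h2 : c' - c ≠ 0 := by linarith
  simp only [lineMap_apply_module]
  match_scalars <;> field_simp <;> ring

/-- The running maximum of the projections of the vertices strictly between the parameters `α` and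
`β` to the chord. -/
def sweep (α β : ℝ) : ℕ → ℝ
  | 0 => 0
  | v + 1 =>
      open Classical in
      if α < P.sv v ∧ P.sv v < β then
        max (sweep α β v) (min 1 (projParam (P.toFun α) (P.toFun β) (P.vt v)))
      else sweep α β v

/-- The running maximum follows the subcurve at distance `4Δ`. -/
def Pass (Δ α β : ℝ) : Prop :=
  ∀ v < n, α < P.sv v → P.sv v < β →
    ‖lineMap (P.toFun α) (P.toFun β) (P.sweep α β (v + 1)) - P.vt v‖ ≤ 4 * Δ

theorem sweep_le_one (α β : ℝ) (v : ℕ) : P.sweep α β v ≤ 1 := by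
  induction v with
  | zero => exact zero_le_one
  | succ v ih =>
    rw [sweep]; split_ifs
    · exact max_le ih (min_le_left _ _)
    · exact ih

/-- Sending `α` to 0, each inner vertex to the running maximum and `β` to 1 is monotone. Between
consecutive vertices the curve is linear, so the bounds checked at the vertices are enough. -/
theorem Pass.matched {Δ α β : ℝ} {P : PolygonalCurve d n} (hΔ : 0 ≤ Δ) (h : P.Pass Δ α β)
    (hα : 0 ≤ α) (hβ : β ≤ 1) (hαβ : α < β) :
    Matched P.toFun (P.toFun α) (P.toFun β) (4 * Δ) α β 0 1 := by
  classical
  have hn := P.two_le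
  have hex : ∃ v, v < n ∧ β ≤ P.sv v := ⟨n - 1, by omega, by rw [P.sv_last]; exact hβ⟩
  set v₀ := Nat.find hex with hv₀
  obtain ⟨hv₀n, hv₀β⟩ := Nat.find_spec hex
  have hlt : ∀ v < v₀, P.sv v < β := fun v hv => by
    by_contra hcon
    exact Nat.find_min hex hv ⟨by omega, not_lt.1 hcon⟩
  have hpos : 0 < v₀ := by
    rcases Nat.eq_zero_or_pos v₀ with h0 | h0
    · have := hv₀β
      rw [← hv₀, h0, P.sv_zero] at this
      linarith
    · exact h0
  have hstart : ‖P.toFun α - lineMap (P.toFun α) (P.toFun β) (0 : ℝ)‖ ≤ 4 * Δ := by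
    simpa using hΔ
  -- Vertices at or before `α` are represented by `α` itself through the maximum. The vertices below
  -- `v₀` are exactly those before the first one at or after `β`.
  have main : ∀ v < v₀, Matched P.toFun (P.toFun α) (P.toFun β) (4 * Δ) α (max α (P.sv v)) 0
      (P.sweep α β (v + 1)) ∧ ‖P.toFun (max α (P.sv v)) -
        lineMap (P.toFun α) (P.toFun β) (P.sweep α β (v + 1))‖ ≤ 4 * Δ := by
    intro v
    induction v with
    | zero =>
      intro _
      have h0 : max α (P.sv 0) = α := by rw [P.sv_zero]; exact max_eq_left hα
      have h1 : P.sweep α β 1 = 0 := by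
        rw [sweep, if_neg]
        · rfl
        · rw [P.sv_zero]; intro hh; linarith [hh.1]
      rw [h0, h1]
      exact ⟨.refl hstart, hstart⟩
    | succ v ih =>
      intro hv
      obtain ⟨ih1, ih2⟩ := ih (by omega)
      have hvn : v + 1 < n := by omega
      have hsm := P.sv_mono (Nat.le_succ v) hvn
      by_cases hin : α < P.sv (v + 1)
      · have hval : P.sweep α β (v + 2) = max (P.sweep α β (v + 1))
            (min 1 (projParam (P.toFun α) (P.toFun β) (P.vt (v + 1)))) := by
          rw [sweep, if_pos ⟨hin, hlt _ hv⟩]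
        have hend := h (v + 1) hvn hin (hlt _ hv)
        rw [norm_sub_rev, ← P.toFun_sv hvn] at hend
        rw [max_eq_right hin.le]
        refine ⟨ih1.trans (le_max_left _ _) (max_le hin.le hsm) ?_, hend⟩
        rcases (max_le hin.le hsm).lt_or_eq with hlt' | heq
        · refine .piece hlt' (by rw [hval]; exact le_max_left _ _) ?_ ih2 hend
          intro u hu
          exact P.toFun_sub hvn (le_max_right _ _) hu.1 hu.2 hlt' le_rfl
        -- Equal parameters force equal vertices, hence equal projections: the running maximum does
        -- not move, and the piece is degenerate.
        · have hsv : P.sv v = P.sv (v + 1) := by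
            rcases max_choice α (P.sv v) with hc | hc <;> rw [hc] at heq
            · linarith
            · exact heq
          have hvt : P.vt v = P.vt (v + 1) := by
            rw [← P.toFun_sv hvn, ← P.toFun_sv (by omega : v < n), hsv]
          have hsw : P.sweep α β (v + 2) = P.sweep α β (v + 1) := by
            rw [hval]
            refine max_eq_left ?_
            rw [sweep, if_pos ⟨by rw [hsv]; exact hin, hlt _ (by omega)⟩, hvt]
            exact le_max_right _ _
          rw [heq, hsw]
          rw [hsw] at hend
          exact .refl hend
      · have h1 : P.sweep α β (v + 2) = P.sweep α β (v + 1) := by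
          rw [sweep, if_neg fun hh => hin hh.1]
        rw [max_eq_left (not_lt.1 hin), h1]
        rw [max_eq_left (hsm.trans (not_lt.1 hin))] at ih1 ih2
        exact ⟨ih1, ih2⟩
  obtain ⟨w, hw⟩ : ∃ w, v₀ = w + 1 := ⟨v₀ - 1, by omega⟩
  obtain ⟨h1, h2⟩ := main w (by omega)
  have hmax : max α (P.sv w) < β := max_lt hαβ (hlt w (by omega))
  rw [← hv₀, hw] at hv₀β hv₀n
  refine h1.trans (le_max_left _ _) hmax.le (.piece hmax (P.sweep_le_one _ _ _) ?_ h2 ?_)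
  · intro u hu
    exact P.toFun_sub hv₀n (le_max_right _ _) hu.1 hu.2 hmax hv₀β
  · simpa using hΔ

end PolygonalCurve

/-! ### Completeness of the test -/

/-- Cauchy–Schwarz against the direction `b - a`: a point at distance `R` from the point with
parameter `l` projects at most `R / ‖b - a‖` beyond it. -/
theorem min_one_projParam_le {a b p : Pt d} {l R : ℝ} (h : ‖p - lineMap a b l‖ ≤ R)
    (hab : a ≠ b) : projParam a b p ≤ l + R / ‖b - a‖ := by
  have hpos : 0 < ‖b - a‖ := norm_pos_iff.2 (sub_ne_zero.2 hab.symm)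
  rw [projParam, real_inner_self_eq_norm_sq, div_le_iff₀ (by positivity)]
  have hcs := real_inner_le_norm (p - lineMap a b l) (b - a)
  have : p - lineMap a b l = (p - a) - l • (b - a) := by
    simp only [lineMap_apply_module']; abel
  rw [this, inner_sub_left, inner_smul_left, real_inner_self_eq_norm_sq] at hcs
  rw [this] at h
  have h2 : (l + R / ‖b - a‖) * ‖b - a‖ ^ 2 = l * ‖b - a‖ ^ 2 + R * ‖b - a‖ := by
    field_simp
  rw [h2]
  simp only [conj_trivial] at hcs
  nlinarith

/-- The squared distance is a quadratic in the parameter, increasing beyond the projection. -/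
theorem norm_sub_lineMap_le_of_between {a b p : Pt d} {l κ : ℝ} (hab : a ≠ b)
    (h₁ : projParam a b p ≤ κ) (h₂ : κ ≤ l) :
    ‖p - lineMap a b κ‖ ≤ ‖p - lineMap a b l‖ := by
  have hpos : 0 < ‖b - a‖ := norm_pos_iff.2 (sub_ne_zero.2 hab.symm)
  rw [projParam, real_inner_self_eq_norm_sq, div_le_iff₀ (by positivity)] at h₁
  have hexp : ∀ t : ℝ, ‖p - lineMap a b t‖ ^ 2 =
      ‖p - a‖ ^ 2 - 2 * t * inner ℝ (p - a) (b - a) + t ^ 2 * ‖b - a‖ ^ 2 := by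
    intro t
    have : p - lineMap a b t = (p - a) - t • (b - a) := by
      simp only [lineMap_apply_module']; abel
    rw [this, norm_sub_sq_real, inner_smul_right, norm_smul, mul_pow, Real.norm_eq_abs, sq_abs]
    ring
  refine le_of_sq_le_sq ?_ (norm_nonneg _)
  rw [hexp, hexp]
  nlinarith [mul_nonneg (sub_nonneg.2 h₂) (sub_nonneg.2 h₁),
    mul_nonneg (mul_self_nonneg (l - κ)) (sq_nonneg ‖b - a‖)]

/-- Rescale `l` so that the ends go to 0 and 1. The ends of the chord are within `Δ + ε` of the
points that the line assigns to them, so passing from the line to the chord costs another `Δ + ε`.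
-/
theorem LineGood.exists_chord {P : ℝ → Pt d} {Δ α β ε : ℝ} (h : LineGood P Δ α β) (hαβ : α < β)
    (hε : 0 < ε) : ∃ l : ℝ → ℝ, MonotoneOn l (Icc α β) ∧ (∀ u ∈ Icc α β, 0 ≤ l u ∧ l u ≤ 1) ∧
      ∀ u ∈ Icc α β, ‖P u - lineMap (P α) (P β) (l u)‖ ≤ 2 * (Δ + ε) := by
  obtain ⟨q₀, q₁, l, h1, h2⟩ := h ε hε
  have hα : α ∈ Icc α β := ⟨le_rfl, hαβ.le⟩
  have hβ : β ∈ Icc α β := ⟨hαβ.le, le_rfl⟩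
  have hmono := h1 hα hβ hαβ.le
  have hR : 0 ≤ Δ + ε := (norm_nonneg _).trans (h2 α hα)
  have hl : ∀ u ∈ Icc α β, 0 ≤ (l u - l α) / (l β - l α) ∧ (l u - l α) / (l β - l α) ≤ 1 := by
    intro u hu
    have h3 := h1 hα hu hu.1
    have h4 := h1 hu hβ hu.2
    exact ⟨div_nonneg (by linarith) (by linarith), div_le_one_of_le₀ (by linarith) (by linarith)⟩
  refine ⟨fun u => (l u - l α) / (l β - l α), ?_, hl, ?_⟩
  · intro u hu v hv huv
    have := h1 hu hv huv
    have : 0 ≤ l β - l α := by linarith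
    simp only
    gcongr
  · intro u hu
    obtain ⟨h3, h4⟩ := hl u hu
    have hq : lineMap q₀ q₁ (l u) = lineMap (lineMap q₀ q₁ (l α)) (lineMap q₀ q₁ (l β))
        ((l u - l α) / (l β - l α)) := by
      -- If `l` takes equal values at the ends it is constant, and the quotient with denominator 0
      -- has the value 0, which is then correct.
      rcases hmono.lt_or_eq with hlt | heq
      · have : l β - l α ≠ 0 := by linarith
        simp only [lineMap_apply_module]
        match_scalars <;> field_simp <;> ring
      · have h5 := h1 hα hu hu.1
        have h6 := h1 hu hβ hu.2
        rw [show l u = l α by linarith, ← heq]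
        simp
    set τ := (l u - l α) / (l β - l α)
    have hsplit : P u - lineMap (P α) (P β) τ = (P u - lineMap q₀ q₁ (l u)) -
        ((1 - τ) • (P α - lineMap q₀ q₁ (l α)) + τ • (P β - lineMap q₀ q₁ (l β))) := by
      rw [hq]
      generalize (lineMap q₀ q₁ (l α) : Pt d) = x
      generalize (lineMap q₀ q₁ (l β) : Pt d) = y
      simp only [lineMap_apply_module]
      module
    rw [hsplit]
    refine (norm_sub_le _ _).trans ?_
    have h7 : ‖(1 - τ) • (P α - lineMap q₀ q₁ (l α)) + τ • (P β - lineMap q₀ q₁ (l β))‖ ≤ Δ + ε := by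
      refine (norm_add_le _ _).trans ?_
      rw [norm_smul, norm_smul, Real.norm_of_nonneg h3, Real.norm_of_nonneg (by linarith : 0 ≤ 1 - τ)]
      nlinarith [h2 α hα, h2 β hβ]
    linarith [h2 u hu]

/-- Let `l` follow the chord at distance `R`, about `2Δ`. If the running maximum is at most `l` at
the current vertex, then it lies between the clipped projection and `l`, and the distance is at most
`R`. If it is larger, it came from an earlier vertex, whose projection exceeds the earlier value of
`l`, hence the current one, by at most `R / ‖b - a‖`; this shifts the point by at most `R`, and
gives `2R` in total. -/
theorem LineGood.pass {P : PolygonalCurve d n} {Δ α β : ℝ} (h : LineGood P.toFun Δ α β)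
    (hαβ : α < β) : P.Pass Δ α β := by
  classical
  intro v hv hv1 hv2
  refine le_of_forall_pos_le_add fun ε' hε' => ?_
  obtain ⟨l, h1, h2, h3⟩ := h.exists_chord hαβ (ε := ε' / 4) (by linarith)
  set a := P.toFun α
  set b := P.toFun β
  set R := 2 * (Δ + ε' / 4) with hR
  have hR0 : 0 ≤ R := (norm_nonneg _).trans (h3 α ⟨le_rfl, hαβ.le⟩)
  have hmem : P.sv v ∈ Icc α β := ⟨hv1.le, hv2.le⟩
  have hvert : ∀ w < n, α < P.sv w → P.sv w < β → ‖P.vt w - lineMap a b (l (P.sv w))‖ ≤ R := by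
    intro w hw hw1 hw2
    rw [← P.toFun_sv hw]
    exact h3 _ ⟨hw1.le, hw2.le⟩
  have hgoal : 4 * Δ + ε' = R + R := by rw [hR]; ring
  rw [hgoal, norm_sub_rev]
  -- On a degenerate chord all parameters give the same point.
  by_cases hab : a = b
  · have := hvert v hv hv1 hv2
    rw [hab, lineMap_same_apply] at this ⊢
    linarith
  have hpos : 0 < ‖b - a‖ := norm_pos_iff.2 (sub_ne_zero.2 (Ne.symm hab))
  -- The bound is stated for every later time `τ`, so that monotonicity of `l` carries the
  -- contributions of the earlier vertices forward.
  have hinv : ∀ w ≤ n, ∀ τ ∈ Icc α β, (∀ w' < w, P.sv w' < β → P.sv w' ≤ τ) →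
      P.sweep α β w ≤ l τ + R / ‖b - a‖ := by
    intro w
    induction w with
    | zero =>
      intro _ τ hτ _
      have := (h2 τ hτ).1
      exact le_add_of_le_of_nonneg this (by positivity)
    | succ w ih =>
      intro hw τ hτ hall
      have hrec := ih (by omega) τ hτ fun w' hw' => hall w' (by omega)
      rw [PolygonalCurve.sweep]
      split_ifs with hin
      · refine max_le hrec ((min_le_right _ _).trans ?_)
        refine (min_one_projParam_le (hvert w (by omega) hin.1 hin.2) hab).trans ?_
        gcongr
        exact h1 ⟨hin.1.le, hin.2.le⟩ hτ (hall w (by omega) hin.2)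
      · exact hrec
  have hM := hinv (v + 1) (by omega) (P.sv v) hmem fun w hw _ => P.sv_mono (by omega) hv
  set M := P.sweep α β (v + 1) with hMdef
  have hMge : min 1 (projParam a b (P.vt v)) ≤ M := by
    rw [hMdef, PolygonalCurve.sweep, if_pos ⟨hv1, hv2⟩]
    exact le_max_right _ _
  have hvl := hvert v hv hv1 hv2
  rcases le_total M (l (P.sv v)) with hle | hle
  · rcases min_le_iff.1 hMge with h5 | h5
    -- Here the projection was clipped at 1, and `1 ≤ M ≤ l ≤ 1` leaves no choice.
    · have : M = l (P.sv v) := le_antisymm hle ((h2 _ hmem).2.trans h5)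
      rw [this]; linarith
    · exact (norm_sub_lineMap_le_of_between hab h5 hle).trans (by linarith)
  · have hsplit : P.vt v - lineMap a b M = (P.vt v - lineMap a b (l (P.sv v))) -
        (M - l (P.sv v)) • (b - a) := by
      simp only [lineMap_apply_module]
      module
    rw [hsplit]
    refine (norm_sub_le _ _).trans (add_le_add hvl ?_)
    rw [norm_smul, Real.norm_of_nonneg (by linarith)]
    calc _ ≤ (R / ‖b - a‖) * ‖b - a‖ := by
          refine mul_le_mul_of_nonneg_right ?_ hpos.le
          linarith
      _ = R := by field_simp

end Subtraj

namespace Subtraj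

/-! ## Tables for the covering relation -/

section Tables

variable (m : ℕ) (pass near : ℕ → ℕ → Prop)

open Classical in
/-- The last `y' < y` that is reached from `x` through pairs that pass. -/
def reachAux (x : ℕ) : ℕ → ℕ
  | 0 => x
  | y + 1 => if reachAux x y + 1 = y ∧ pass x y then y else reachAux x y

/-- The last index below `m` that is reached from `x` through pairs that pass. -/
def reach (x : ℕ) : ℕ := reachAux pass x m

/-- The scan moves from `y - 1` to `y` only if it has just arrived at `y - 1`, so the first failing
pair stops it for good, even if later pairs pass. -/
theorem reachAux_spec (x y : ℕ) : x ≤ reachAux pass x y ∧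
    (reachAux pass x y = x ∨ reachAux pass x y < y) ∧
    (∀ y', x < y' → y' ≤ reachAux pass x y → pass x y') ∧
    (y ≤ reachAux pass x y + 1 ∨ ¬ pass x (reachAux pass x y + 1)) := by
  induction y with
  | zero => exact ⟨le_rfl, Or.inl rfl, fun y' h h' => absurd h' (by simp [reachAux]; omega),
      Or.inl (by omega)⟩
  | succ y ih =>
    obtain ⟨h1, h2, h3, h4⟩ := ih
    rw [reachAux]
    split_ifs with h
    · refine ⟨by omega, Or.inr (by omega), fun y' hy hy' => ?_, Or.inl (by omega)⟩
      rcases Nat.lt_or_ge (reachAux pass x y) y' with h5 | h5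
      · obtain rfl : y' = y := by omega
        exact h.2
      · exact h3 y' hy h5
    · refine ⟨h1, by omega, h3, ?_⟩
      by_cases h5 : reachAux pass x y + 1 = y
      · exact Or.inr fun hp => h ⟨h5, by rwa [h5] at hp⟩
      · rcases h4 with h4 | h4
        · left; omega
        · exact Or.inr h4

variable {m pass near}

theorem le_reach (x : ℕ) : x ≤ reach m pass x := (reachAux_spec pass x m).1

theorem reach_lt {x : ℕ} (hx : x < m) : reach m pass x < m := by
  rcases (reachAux_spec pass x m).2.1 with h | h
  · rw [reach, h]; exact hx
  · exact h

theorem pass_of_le_reach {x y : ℕ} (h : x < y) (h' : y ≤ reach m pass x) : pass x y :=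
  (reachAux_spec pass x m).2.2.1 y h h'

theorem le_reach_of_pass {x y : ℕ} (hx : x < m) (hy : y < m)
    (h : ∀ y', x < y' → y' ≤ y → pass x y') : y ≤ reach m pass x := by
  by_contra hcon
  have h1 := le_reach (m := m) (pass := pass) x
  have h2 := reach_lt (pass := pass) hx
  rcases (reachAux_spec pass x m).2.2.2 with h3 | h3
  · change m ≤ reach m pass x + 1 at h3; omega
  · refine h3 (h _ ?_ ?_)
    · change x < reach m pass x + 1; omega
    · change reach m pass x + 1 ≤ y; omega

variable (m near) in
open Classical in
/-- The last index that is reached from an index before `z` that is near `i`. -/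
def startTab (D : ℕ → ℕ) : ℕ → ℕ → ℕ
  | 0, _ => 0
  | z + 1, i => if near z i then max (startTab D z i) (D z) else startTab D z i

variable (m near) in
open Classical in
/-- `m` minus the first index after `m - 1 - q` that is near `j`. -/
def endTab : ℕ → ℕ → ℕ
  | 0, _ => 0
  | q + 1, j => if near (m - 1 - q) j then q + 1 else endTab q j

/-- The value 0 also stands for the absence of near indices, hence the restriction to positive `y`.
-/
theorem le_startTab {D : ℕ → ℕ} {z i y : ℕ} (hy : 0 < y) :
    y ≤ startTab near D z i ↔ ∃ x < z, near x i ∧ y ≤ D x := by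
  induction z with
  | zero => simp [startTab]; omega
  | succ z ih =>
    have hex : (∃ x < z + 1, near x i ∧ y ≤ D x) ↔
        (∃ x < z, near x i ∧ y ≤ D x) ∨ (near z i ∧ y ≤ D z) := by
      constructor
      · rintro ⟨x, hx, h⟩
        rcases Nat.lt_succ_iff_lt_or_eq.1 hx with h' | rfl
        · exact Or.inl ⟨x, h', h⟩
        · exact Or.inr h
      · rintro (⟨x, hx, h⟩ | h)
        · exact ⟨x, by omega, h⟩
        · exact ⟨z, by omega, h⟩
    rw [hex, startTab]
    split_ifs with h
    · rw [le_max_iff, ih]; simp [h]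
    · rw [ih]; simp [h]

/-- Later entries overwrite earlier ones and are larger, so the stored entry decides every
comparison. Again 0 means that there is none. -/
theorem le_endTab {q j c : ℕ} (hc : 0 < c) :
    c ≤ endTab m near q j ↔ ∃ q' < q, near (m - 1 - q') j ∧ c ≤ q' + 1 := by
  induction q with
  | zero => simp [endTab]; omega
  | succ q ih =>
    rw [endTab]
    split_ifs with h
    · constructor
      · intro h'; exact ⟨q, by omega, h, h'⟩
      · rintro ⟨q', h1, -, h2⟩; omega
    · rw [ih]
      constructor
      · rintro ⟨q', h1, h2⟩; exact ⟨q', by omega, h2⟩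
      · rintro ⟨q', h1, h2, h3⟩
        refine ⟨q', ?_, h2, h3⟩
        rcases Nat.lt_succ_iff_lt_or_eq.1 h1 with h4 | rfl
        · exact h4
        · exact absurd h2 h

variable (m pass near) in
/-- Element `z` is covered by the center from the `i`-th to the `j`-th breakpoint. -/
def Cov (z i j : ℕ) : Prop :=
  m ≤ startTab near (reach m pass) (z + 1) i + endTab m near (m - 1 - z) j

/-- The start table holds the furthest reach from an `x ≤ z` near `i`; `m` minus the end entry is
the first `y > z` near `j`. A suitable pair exists exactly if that `y` is within that reach. Without
such a `y` the end entry is 0, and the inequality fails because reaches stay below `m`. -/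
theorem cov_iff {z i j : ℕ} (hz : z < m) : Cov m pass near z i j ↔
    ∃ x ≤ z, ∃ y, z < y ∧ y ≤ reach m pass x ∧ near x i ∧ near y j := by
  rw [Cov]
  constructor
  · intro h
    have hS : startTab near (reach m pass) (z + 1) i < m := by
      by_contra hcon
      obtain ⟨x, hx, -, h1⟩ := (le_startTab (by omega)).1 (not_lt.1 hcon)
      have := reach_lt (pass := pass) (show x < m by omega)
      omega
    obtain ⟨q, hq, h1, h2⟩ := (le_endTab (m := m) (near := near) (q := m - 1 - z) (j := j)
      (c := endTab m near (m - 1 - z) j) (by omega)).1 le_rfl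
    obtain ⟨x, hx, h3, h4⟩ := (le_startTab (near := near) (D := reach m pass) (z := z + 1) (i := i)
      (y := m - 1 - q) (by omega)).1 (by omega)
    exact ⟨x, by omega, m - 1 - q, by omega, h4, h3, h1⟩
  · rintro ⟨x, hx, y, hy, hyr, h1, h2⟩
    have := reach_lt (pass := pass) (show x < m by omega)
    have h3 := (le_startTab (near := near) (D := reach m pass) (z := z + 1) (i := i)
      (y := y) (by omega)).2 ⟨x, by omega, h1, hyr⟩
    have h4 := (le_endTab (m := m) (near := near) (q := m - 1 - z) (j := j) (c := m - y)
      (by omega)).2 ⟨m - 1 - y, by omega, by rwa [show m - 1 - (m - 1 - y) = y by omega], by omega⟩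
    omega

end Tables

/-! ## Covers of the breakpoint intervals and the clustering cost -/

variable {d n m : ℕ}

/-- The parameter of breakpoint `x`. -/
def Breakpoints.tm (T : Breakpoints m) (x : ℕ) : ℝ := if h : x < m then T.time ⟨x, h⟩ else 0

theorem Breakpoints.tm_lt (T : Breakpoints m) {x y : ℕ} (h : x < y) (hy : y < m) :
    T.tm x < T.tm y := by
  rw [tm, tm, dif_pos hy, dif_pos (h.trans hy)]
  exact T.time_strictMono h

theorem Breakpoints.tm_le (T : Breakpoints m) {x y : ℕ} (h : x ≤ y) (hy : y < m) :
    T.tm x ≤ T.tm y := by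
  rcases h.lt_or_eq with h | rfl
  · exact (T.tm_lt h hy).le
  · exact le_rfl

theorem Breakpoints.tm_zero (T : Breakpoints m) : T.tm 0 = 0 := by
  have := T.two_le
  rw [tm, dif_pos (by omega)]; exact T.time_first

theorem Breakpoints.tm_last (T : Breakpoints m) : T.tm (m - 1) = 1 := by
  have := T.two_le
  rw [tm, dif_pos (by omega)]; exact T.time_last

theorem Breakpoints.tm_nonneg (T : Breakpoints m) {x : ℕ} (hx : x < m) : 0 ≤ T.tm x :=
  T.tm_zero ▸ T.tm_le (Nat.zero_le x) hx

theorem Breakpoints.tm_le_one (T : Breakpoints m) {x : ℕ} (hx : x < m) : T.tm x ≤ 1 :=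
  T.tm_last ▸ T.tm_le (by omega) (by omega)

theorem Breakpoints.tm_val (T : Breakpoints m) (x : Fin m) : T.tm x = T.time x := by
  rw [tm, dif_pos x.2]

variable (P : PolygonalCurve d n) (T : Breakpoints m) (Δ : ℝ)

/-- Breakpoint `x`. -/
def bpt (x : ℕ) : Pt d := P.toFun (T.tm x)

/-- The test of the subcurve between two breakpoints. -/
def BPass (x y : ℕ) : Prop := P.Pass Δ (T.tm x) (T.tm y)

/-- Two breakpoints at distance at most `2Δ`. -/
def Near (x i : ℕ) : Prop := ‖bpt P T x - bpt P T i‖ ≤ 2 * Δ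

/-- The covering relation of the instance. -/
abbrev Covered : ℕ → ℕ → ℕ → Prop := Cov m (BPass P T Δ) (Near P T Δ)

variable {P T Δ}

/-- The test contributes `4Δ`, and replacing the ends of the chord by near breakpoints contributes
`2Δ`. -/
theorem Covered.frechetDist_le {z i j : ℕ} (hΔ : 0 ≤ Δ) (hz : z < m) (h : Covered P T Δ z i j)
    {q : Center d 2} (h₀ : q 0 = bpt P T i) (h₁ : q 1 = bpt P T j) :
    ∃ x y, x ≤ z ∧ z < y ∧ y < m ∧
      frechetDist (subcurve P.toFun (T.tm x) (T.tm y)) (segmentCurve q) ≤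
        ENNReal.ofReal (6 * Δ) := by
  obtain ⟨x, hx, y, hy, hyr, h1, h2⟩ := (cov_iff hz).1 h
  have hym : y < m := hyr.trans_lt (reach_lt (by omega))
  have hxy := T.tm_lt (show x < y by omega) hym
  have hp : P.Pass Δ (T.tm x) (T.tm y) := pass_of_le_reach (by omega) hyr
  refine ⟨x, y, hx, hy, hym, ?_⟩
  rw [show 6 * Δ = 4 * Δ + 2 * Δ by ring]
  exact frechetDist_le_of_matched hxy ((hp.matched hΔ (T.tm_nonneg (by omega))
    (T.tm_le_one hym) hxy).perturb hxy.le (by rw [h₀]; exact h1) (by rw [h₁]; exact h2))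

theorem Breakpoints.exists_mem_Icc (T : Breakpoints m) {t : ℝ} (h₀ : 0 ≤ t) (h₁ : t ≤ 1) :
    ∃ z, z + 1 < m ∧ T.tm z ≤ t ∧ t ≤ T.tm (z + 1) := by
  classical
  have hm := T.two_le
  have hex : ∃ z, z + 1 < m ∧ t ≤ T.tm (z + 1) :=
    ⟨m - 2, by omega, by rw [show m - 2 + 1 = m - 1 by omega, T.tm_last]; exact h₁⟩
  obtain ⟨h2, h3⟩ := Nat.find_spec hex
  refine ⟨Nat.find hex, h2, ?_, h3⟩
  rcases Nat.eq_zero_or_pos (Nat.find hex) with h | h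
  · rw [h, T.tm_zero]; exact h₀
  · by_contra hcon
    refine Nat.find_min hex (m := Nat.find hex - 1) (by omega) ⟨by omega, ?_⟩
    rw [show Nat.find hex - 1 + 1 = Nat.find hex by omega]
    exact (not_le.1 hcon).le

theorem clusterCost_le {C : Finset (Center d 2)} (hΔ : 0 ≤ Δ)
    (h : ∀ z < m - 1, ∃ q ∈ C, ∃ i j, q 0 = bpt P T i ∧ q 1 = bpt P T j ∧ Covered P T Δ z i j) :
    clusterCost P T C ≤ ENNReal.ofReal (6 * Δ) := by
  classical
  set I : Finset (Fin m × Fin m) := Finset.univ.filter fun p => p.1 < p.2 ∧ ∃ q ∈ C,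
    frechetDist (subcurve P.toFun (T.time p.1) (T.time p.2)) (segmentCurve q) ≤
      ENNReal.ofReal (6 * Δ) with hI
  have hcov : Covers T I := by
    refine ⟨fun p hp => (Finset.mem_filter.1 hp).2.1, Set.Subset.antisymm ?_ ?_⟩
    · refine Set.iUnion₂_subset fun p _ => Set.Icc_subset_Icc ?_ ?_
      · rw [← T.tm_val]; exact T.tm_nonneg p.1.2
      · rw [← T.tm_val]; exact T.tm_le_one p.2.2
    · intro t ht
      obtain ⟨z, hz, h1, h2⟩ := T.exists_mem_Icc ht.1 ht.2
      obtain ⟨q, hq, i, j, h3, h4, h5⟩ := h z (by omega)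
      obtain ⟨x, y, hx, hy, hym, h6⟩ := h5.frechetDist_le hΔ (by omega) h3 h4
      have hxm : x < m := by omega
      rw [Breakpoints.tm, Breakpoints.tm, dif_pos hxm, dif_pos hym] at h6
      refine Set.mem_iUnion₂.2 ⟨(⟨x, hxm⟩, ⟨y, hym⟩), Finset.mem_filter.2
        ⟨Finset.mem_univ _, (by simp only [Fin.mk_lt_mk]; omega), q, hq, h6⟩, ?_, ?_⟩
      · refine le_trans ?_ h1
        have := T.tm_le hx (show z < m by omega)
        rwa [Breakpoints.tm, dif_pos hxm] at this
      · refine h2.trans ?_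
        have := T.tm_le (show z + 1 ≤ y by omega) hym
        rwa [Breakpoints.tm.eq_1 T y, dif_pos hym] at this
  refine (iInf₂_le I hcov).trans (iSup₂_le fun p hp => ?_)
  obtain ⟨-, -, q, hq, h1⟩ := Finset.mem_filter.1 hp
  exact (iInf₂_le q hq).trans h1

/-- The infima over covers and centers range over finite sets and are attained. Finiteness of `r`
excludes the empty ones. -/
theorem exists_cover_of_clusterCost_le {C : Finset (Center d 2)} {r : ℝ≥0∞} (hr : r ≠ ⊤)
    (h : clusterCost P T C ≤ r) : ∃ I, Covers T I ∧ ∀ p ∈ I, ∃ q ∈ C,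
      frechetDist (subcurve P.toFun (T.time p.1) (T.time p.2)) (segmentCurve q) ≤ r := by
  classical
  rw [clusterCost, iInf_subtype'] at h
  rcases isEmpty_or_nonempty {I // Covers T I} with he | he
  · rw [iInf_of_empty] at h; exact absurd (top_le_iff.1 h) hr
  obtain ⟨I, hI⟩ := exists_eq_ciInf_of_finite (f := fun I : {I // Covers T I} =>
    ⨆ p ∈ I.1, ⨅ q ∈ C,
      frechetDist (subcurve P.toFun (T.time p.1) (T.time p.2)) (segmentCurve q))
  rw [← hI] at h
  refine ⟨I.1, I.2, fun p hp => ?_⟩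
  have h1 := (le_iSup₂ (f := fun p (_ : p ∈ I.1) => ⨅ q ∈ C,
    frechetDist (subcurve P.toFun (T.time p.1) (T.time p.2)) (segmentCurve q)) p hp).trans h
  rcases C.eq_empty_or_nonempty with rfl | hne
  · simp at h1; exact absurd h1 hr
  · rw [← Finset.inf_eq_iInf] at h1
    obtain ⟨q, hq, hq'⟩ := C.exists_mem_eq_inf hne fun q =>
      frechetDist (subcurve P.toFun (T.time p.1) (T.time p.2)) (segmentCurve q)
    exact ⟨q, hq, hq' ▸ h1⟩

/-- Every element lies in an interval of breakpoints that is close to a center. -/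
theorem exists_intervals_of_clusterCost_le {C : Finset (Center d 2)} (hΔ : 0 ≤ Δ)
    (h : clusterCost P T C ≤ ENNReal.ofReal Δ) : ∀ z, z + 1 < m → ∃ x y, x ≤ z ∧ z < y ∧ y < m ∧
      ∃ q ∈ C, LineGood P.toFun Δ (T.tm x) (T.tm y) ∧ ‖bpt P T x - q 0‖ ≤ Δ ∧
        ‖bpt P T y - q 1‖ ≤ Δ := by
  intro z hz
  obtain ⟨I, hI, hq⟩ := exists_cover_of_clusterCost_le ENNReal.ofReal_ne_top h
  have hzz := T.tm_lt (Nat.lt_succ_self z) hz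
  -- The midpoint is interior to element `z`, so an interval of breakpoints that contains it
  -- contains the whole element.
  have hmid : (T.tm z + T.tm (z + 1)) / 2 ∈ Set.Icc (0 : ℝ) 1 :=
    ⟨by linarith [T.tm_nonneg (show z < m by omega)], by linarith [T.tm_le_one hz]⟩
  rw [← hI.2] at hmid
  obtain ⟨p, hp, h1, h2⟩ := Set.mem_iUnion₂.1 hmid
  obtain ⟨q, hqC, h3⟩ := hq p hp
  rw [← T.tm_val] at h1 h2
  rw [← T.tm_val, ← T.tm_val] at h3
  have hlt : (p.1 : ℕ) < p.2 := hI.1 p hp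
  have hxy := T.tm_lt hlt p.2.2
  refine ⟨p.1, p.2, ?_, ?_, p.2.2, q, hqC, .of_frechetDist_le hΔ hxy h3,
    endpoints_of_frechetDist_le hΔ h3⟩
  · by_contra hcon
    have := T.tm_le (show z + 1 ≤ p.1 by omega) p.1.2
    linarith
  · by_contra hcon
    have := T.tm_le (show (p.2 : ℕ) ≤ z by omega) (by omega)
    linarith

/-- All pairs inside a good interval pass the test, so the scan from `x'` cannot stop before `y'`.
-/
theorem le_reach_of_lineGood {x y x' y' : ℕ} (h : LineGood P.toFun Δ (T.tm x) (T.tm y))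
    (hx : x ≤ x') (hy : y' ≤ y) (hy' : y < m) (hx' : x' < m) :
    y' ≤ reach m (BPass P T Δ) x' := by
  refine le_reach_of_pass hx' (by omega) fun w hw hw' => ?_
  exact (h.subset (T.tm_le hx hx') (T.tm_le (hw'.trans hy) hy')).pass (T.tm_lt hw (by omega))

/-! ### Candidates of bounded length and small hitting sets -/

variable (P T Δ) in
/-- Element `z` is covered by candidate `c`, for candidates of length at most `L`. -/
def Hits (L z c : ℕ) : Prop := Covered P T Δ z (c / L) (min (c / L + 1 + c % L) (m - 1))

/-- The pair is coded by its first index and its length minus one in base `L`. The minimum with `m -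
1` in `Hits` affects only codes that stem from no pair. -/
theorem hits_encode {L z i j : ℕ} (hL : 0 < L) (hij : i < j) (hj : j < m) (hjL : j ≤ i + L)
    (h : Covered P T Δ z i j) :
    i * L + (j - i - 1) < m * L ∧ Hits P T Δ L z (i * L + (j - i - 1)) := by
  have hr : j - i - 1 < L := by omega
  constructor
  · calc _ < i * L + L := by omega
      _ = (i + 1) * L := by ring
      _ ≤ m * L := Nat.mul_le_mul_right _ (by omega)
  · rw [Hits, mul_comm i L, Nat.mul_add_div hL, Nat.div_eq_of_lt hr, Nat.mul_add_mod,
      Nat.mod_eq_of_lt hr, show min (i + 0 + 1 + (j - i - 1)) (m - 1) = j by omega]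
    exact h

/-- If there are `k` centers of cost `Δ`, then few candidates of length at most `L` cover all
elements. -/
theorem exists_hitting_set {C : Finset (Center d 2)} (hΔ : 0 ≤ Δ)
    (h : clusterCost P T C ≤ ENNReal.ofReal Δ) {L : ℕ} (hL : 0 < L) :
    ∃ H : Finset ℕ, H ⊆ Finset.range (m * L) ∧ H.card ≤ C.card + 2 * (m / L + 1) ∧
      ∀ z < m - 1, ∃ c ∈ H, Hits P T Δ L z c := by
  classical
  have hI := exists_intervals_of_clusterCost_le hΔ h
  set D := reach m (BPass P T Δ) with hD
  -- One short pair with ends within `Δ` of the center `q` serves all short intervals of `q`, as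
  -- their ends are within `2Δ` of its ends.
  let short : Center d 2 → ℕ × ℕ → Prop := fun q p => p.1 < p.2 ∧ p.2 < m ∧ p.2 ≤ p.1 + L ∧
    ‖bpt P T p.1 - q 0‖ ≤ Δ ∧ ‖bpt P T p.2 - q 1‖ ≤ Δ
  let enc : ℕ → ℕ → ℕ := fun i j => i * L + (j - i - 1)
  let hq : Center d 2 → ℕ := fun q =>
    if hp : ∃ p, short q p then enc hp.choose.1 hp.choose.2 else 0
  -- For block `a`: start at its left end, and go as far as possible within the block.
  let left : ℕ → ℕ := fun a => enc (a * L) (min ((a + 1) * L) (D (a * L)))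
  -- For block `a`: start at the first index of the block or later from which the right end of the
  -- block is reached.
  let right : ℕ → ℕ := fun a =>
    if hp : ∃ i, a * L ≤ i ∧ (a + 1) * L ≤ D i then enc (Nat.find hp) ((a + 1) * L) else 0
  set H := (C.image hq ∪ ((Finset.range (m / L + 1)).image left ∪
    (Finset.range (m / L + 1)).image right)) with hH
  have hnear : ∀ x, Near P T Δ x x := fun x => by simpa [Near] using hΔ
  refine ⟨H.filter (· < m * L), fun c hc => Finset.mem_range.2 (Finset.mem_filter.1 hc).2, ?_,
    fun z hz => ?_⟩
  · refine (Finset.card_filter_le _ _).trans ((Finset.card_union_le _ _).trans ?_)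
    refine add_le_add Finset.card_image_le ((Finset.card_union_le _ _).trans ?_)
    rw [two_mul]
    exact add_le_add (Finset.card_image_le.trans (by simp)) (Finset.card_image_le.trans (by simp))
  obtain ⟨x, y, hxz, hzy, hym, q, hqC, hgood, hx0, hy1⟩ := hI z (by omega)
  by_cases hlen : y ≤ x + L
  · have hp : ∃ p, short q p := ⟨(x, y), by omega, hym, hlen, hx0, hy1⟩
    obtain ⟨h1, h2, h3, h4, h5⟩ := hp.choose_spec
    have hcov : Covered P T Δ z hp.choose.1 hp.choose.2 := by
      refine (cov_iff (by omega)).2 ⟨x, hxz, y, hzy,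
        le_reach_of_lineGood hgood le_rfl le_rfl hym (by omega), ?_, ?_⟩
      · rw [Near, two_mul]
        refine (norm_sub_le_norm_sub_add_norm_sub _ (q 0) _).trans (add_le_add hx0 ?_)
        rw [norm_sub_rev]; exact h4
      · rw [Near, two_mul]
        refine (norm_sub_le_norm_sub_add_norm_sub _ (q 1) _).trans (add_le_add hy1 ?_)
        rw [norm_sub_rev]; exact h5
    obtain ⟨h6, h7⟩ := hits_encode hL h1 h2 h3 hcov
    have hval : hq q = enc hp.choose.1 hp.choose.2 := by simp only [hq, dif_pos hp]
    refine ⟨hq q, Finset.mem_filter.2 ⟨Finset.mem_union_left _ (Finset.mem_image_of_mem _ hqC), ?_⟩,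
      ?_⟩
    · rw [hval]; exact h6
    · rw [hval]; exact h7
  -- An interval longer than `L` around `z` contains the left end or the right end of the block of
  -- `z`. The candidate of that side covers `z` too.
  · set a := z / L with ha
    have haz : a * L ≤ z := Nat.div_mul_le_self z L
    have hza : z < (a + 1) * L := by
      rw [ha, mul_comm]; exact Nat.lt_mul_div_succ z hL
    have ham : a ∈ Finset.range (m / L + 1) :=
      Finset.mem_range.2 (Nat.lt_succ_of_le (Nat.div_le_div_right (by omega)))
    have haL : (a + 1) * L = a * L + L := by ring
    by_cases hxa : x ≤ a * L
    · have h1 : y ≤ D (a * L) := le_reach_of_lineGood hgood hxa le_rfl hym (by omega)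
      have h2 : D (a * L) < m := reach_lt (by omega)
      have hcov : Covered P T Δ z (a * L) (min ((a + 1) * L) (D (a * L))) :=
        (cov_iff (by omega)).2 ⟨a * L, haz, _, lt_min hza (hzy.trans_le h1), min_le_right _ _, hnear _,
          hnear _⟩
      obtain ⟨h6, h7⟩ := hits_encode hL (by omega) (by omega) (by omega) hcov
      exact ⟨left a, Finset.mem_filter.2 ⟨Finset.mem_union_right _ (Finset.mem_union_left _
        (Finset.mem_image_of_mem _ ham)), h6⟩, h7⟩
    · have hya : (a + 1) * L ≤ y := by omega
      have h1 : (a + 1) * L ≤ D x := le_reach_of_lineGood hgood le_rfl hya hym (by omega)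
      have hp : ∃ i, a * L ≤ i ∧ (a + 1) * L ≤ D i := ⟨x, by omega, h1⟩
      obtain ⟨h2, h3⟩ := Nat.find_spec hp
      have h4 : Nat.find hp ≤ x := Nat.find_min' hp ⟨by omega, h1⟩
      have hcov : Covered P T Δ z (Nat.find hp) ((a + 1) * L) :=
        (cov_iff (by omega)).2 ⟨_, by omega, _, hza, h3, hnear _, hnear _⟩
      obtain ⟨h6, h7⟩ := hits_encode hL (by omega) (by omega) (by omega) hcov
      have hval : right a = enc (Nat.find hp) ((a + 1) * L) := by simp only [right, dif_pos hp]
      refine ⟨right a, Finset.mem_filter.2 ⟨Finset.mem_union_right _ (Finset.mem_union_right _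
        (Finset.mem_image_of_mem _ ham)), ?_⟩, ?_⟩
      · rw [hval]; exact h6
      · rw [hval]; exact h7

/-- Consecutive breakpoints cover the element between them. -/
theorem covered_consecutive {C : Finset (Center d 2)} (hΔ : 0 ≤ Δ)
    (h : clusterCost P T C ≤ ENNReal.ofReal Δ) {z : ℕ} (hz : z + 1 < m) :
    Covered P T Δ z z (z + 1) := by
  obtain ⟨x, y, hxz, hzy, hym, q, -, hgood, -, -⟩ := exists_intervals_of_clusterCost_le hΔ h z hz
  refine (cov_iff (by omega)).2 ⟨z, le_rfl, z + 1, by omega,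
    le_reach_of_lineGood hgood hxz hzy hym (by omega), ?_, ?_⟩ <;> simpa [Near] using hΔ

end Subtraj

namespace Subtraj

open RealRAM

/-! ## Expressions for coordinates and distances -/

/-- The sum of `f 0, …, f (d - 1)`. -/
def sumExp : ℕ → (ℕ → RExp) → RExp
  | 0, _ => .ofNat (.lit 0)
  | d + 1, f => .add (sumExp d f) (f d)

theorem sumExp_eval (d : ℕ) (f : ℕ → RExp) (σ : Mem) :
    (sumExp d f).eval σ = ∑ c ∈ Finset.range d, (f c).eval σ := by
  induction d with
  | zero => simp [sumExp, RExp.eval, NExp.eval]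
  | succ d ih => rw [sumExp, RExp.eval, ih, Finset.sum_range_succ]

/-- The larger of two reals. -/
def maxExp (x y : RExp) : RExp :=
  .div (.add (.add x y) (.sqrt (.mul (.sub x y) (.sub x y)))) (.ofNat (.lit 2))

/-- The smaller of two reals. -/
def minExp (x y : RExp) : RExp :=
  .div (.sub (.add x y) (.sqrt (.mul (.sub x y) (.sub x y)))) (.ofNat (.lit 2))

/-- The maximum is `(x + y + |x - y|) / 2`, with the absolute value computed as the root of a
square. -/
theorem maxExp_eval (x y : RExp) (σ : Mem) : (maxExp x y).eval σ = max (x.eval σ) (y.eval σ) := by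
  simp only [maxExp, RExp.eval, NExp.eval, Real.sqrt_mul_self_eq_abs]
  rcases le_total (x.eval σ) (y.eval σ) with h | h
  · rw [abs_of_nonpos (by linarith), max_eq_right h]; push_cast; ring
  · rw [abs_of_nonneg (by linarith), max_eq_left h]; push_cast; ring

theorem minExp_eval (x y : RExp) (σ : Mem) : (minExp x y).eval σ = min (x.eval σ) (y.eval σ) := by
  simp only [minExp, RExp.eval, NExp.eval, Real.sqrt_mul_self_eq_abs]
  rcases le_total (x.eval σ) (y.eval σ) with h | h
  · rw [abs_of_nonpos (by linarith), min_eq_left h]; push_cast; ring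
  · rw [abs_of_nonneg (by linarith), min_eq_right h]; push_cast; ring

/-- The number of vertices. -/
abbrev nE : NExp := .get 0 (.lit 0)

/-- The number of breakpoints. -/
abbrev mE : NExp := .get 0 (.lit 1)

/-- The distance `Δ`. -/
abbrev deltaE : RExp := .get 0 (.lit 0)

/-- Coordinate `c` of vertex `v`. -/
def vcoord (d : ℕ) (v : NExp) (c : ℕ) : RExp := .get 3 (.add (.mul v (.lit d)) (.lit c))

/-- Coordinate `c` of breakpoint `x`, which lies on the edge that cell `x` of array `5` names. -/
def bcoord (d : ℕ) (x : NExp) (c : ℕ) : RExp :=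
  .add (.mul (.div (.sub (.get 2 x) (.get 1 (.get 5 x)))
    (.sub (.get 1 (.add (.get 5 x) (.lit 1))) (.get 1 (.get 5 x))))
    (.sub (vcoord d (.add (.get 5 x) (.lit 1)) c) (vcoord d (.get 5 x) c)))
    (vcoord d (.get 5 x) c)

/-- The inner product of `f - g` and `h - k`. -/
def innerExp (d : ℕ) (f g h k : ℕ → RExp) : RExp :=
  sumExp d fun c => .mul (.sub (f c) (g c)) (.sub (h c) (k c))

variable {d n m : ℕ} {P : PolygonalCurve d n} {T : Breakpoints m} {Δ : ℝ}

theorem sum_range_mul_eq_inner {f g : ℕ → ℝ} {u v : Pt d} (hf : ∀ c (h : c < d), f c = u ⟨c, h⟩)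
    (hg : ∀ c (h : c < d), g c = v ⟨c, h⟩) :
    ∑ c ∈ Finset.range d, f c * g c = inner ℝ u v := by
  rw [Finset.sum_range, PiLp.inner_apply]
  refine Finset.sum_congr rfl fun c _ => ?_
  rw [hf c c.2, hg c c.2]
  simp [mul_comm]

/-- The coordinate expressions `f` describe the point `u`. -/
def Describes (σ : Mem) (f : ℕ → RExp) (u : Pt d) : Prop :=
  ∀ c (h : c < d), (f c).eval σ = u ⟨c, h⟩

theorem innerExp_eval {σ : Mem} {f g h k : ℕ → RExp} {u v w x : Pt d} (hf : Describes σ f u)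
    (hg : Describes σ g v) (hh : Describes σ h w) (hk : Describes σ k x) :
    (innerExp d f g h k).eval σ = inner ℝ (u - v) (w - x) := by
  rw [innerExp, sumExp_eval]
  refine sum_range_mul_eq_inner (fun c hc => ?_) fun c hc => ?_
  · simp [RExp.eval, hf c hc, hg c hc]
  · simp [RExp.eval, hh c hc, hk c hc]

variable (P T Δ) in
/-- The input is in place. -/
structure HasInput (σ : Mem) : Prop where
  ints : σ.ints 0 = (inputMem P T Δ).ints 0
  reals : ∀ a < 4, σ.reals a = (inputMem P T Δ).reals a

namespace HasInput

variable {σ τ : Mem} {p : Prog}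

theorem frame (h : HasInput P T Δ σ) (hf : Frame p σ τ) (hI : ¬ writesI p 0)
    (hR : ∀ a < 4, ¬ writesR p a) : HasInput P T Δ τ :=
  ⟨(hf.ints 0 hI).trans h.ints, fun a ha => (hf.reals a (hR a ha)).trans (h.reals a ha)⟩

theorem nE (h : HasInput P T Δ σ) : σ.ints 0 0 = n := by rw [h.ints]; rfl

theorem mE (h : HasInput P T Δ σ) : σ.ints 0 1 = m := by rw [h.ints]; rfl

theorem delta (h : HasInput P T Δ σ) : σ.reals 0 0 = Δ := by
  rw [h.reals 0 (by norm_num)]; rfl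

theorem sv (h : HasInput P T Δ σ) (v : ℕ) : σ.reals 1 v = P.sv v := by
  rw [h.reals 1 (by norm_num)]; rfl

theorem tm (h : HasInput P T Δ σ) (x : ℕ) : σ.reals 2 x = T.tm x := by
  rw [h.reals 2 (by norm_num)]; rfl

theorem describes_vcoord (h : HasInput P T Δ σ) {v : NExp} {w : ℕ} (hv : v.eval σ = w)
    (hw : w < n) : Describes σ (vcoord d v) (P.vt w) := by
  intro c hc
  have hd : 0 < d := by omega
  have h1 : (w * d + c) / d = w := by
    rw [mul_comm, Nat.mul_add_div hd, Nat.div_eq_of_lt hc, add_zero]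
  have h2 : (w * d + c) % d = c := by
    rw [mul_comm, Nat.mul_add_mod, Nat.mod_eq_of_lt hc]
  simp only [vcoord, RExp.eval, NExp.eval, hv, h.reals 3 (by norm_num), inputMem]
  rw [dif_pos ⟨by rwa [h1], hd⟩, PolygonalCurve.vt, dif_pos hw]
  simp only [h1, h2]

end HasInput

variable (P T) in
/-- Cell `x` of array `5` names an edge on which breakpoint `x` lies. -/
def EdgeAt (σ : Mem) (x : ℕ) : Prop :=
  σ.ints 5 x + 1 < n ∧ P.sv (σ.ints 5 x) ≤ T.tm x ∧ T.tm x ≤ P.sv (σ.ints 5 x + 1)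

/-- On an edge of parameter length zero the program and the curve divide by zero with the same
default, so there is no separate case. -/
theorem HasInput.describes_bcoord {σ : Mem} (h : HasInput P T Δ σ) {x : NExp} {w : ℕ}
    (hx : x.eval σ = w) (he : EdgeAt P T σ w) : Describes σ (bcoord d x) (bpt P T w) := by
  intro c hc
  obtain ⟨h1, h2, h3⟩ := he
  have hv0 := h.describes_vcoord (v := .get 5 x) (w := σ.ints 5 w) (by simp [NExp.eval, hx])
    (by omega) c hc
  have hv1 := h.describes_vcoord (v := .add (.get 5 x) (.lit 1)) (w := σ.ints 5 w + 1)
    (by simp [NExp.eval, hx]) h1 c hc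
  rw [bpt, P.toFun_between h1 h2 h3]
  simp [bcoord, RExp.eval, NExp.eval, hx, hv0, hv1, h.sv, h.tm, AffineMap.lineMap_apply_module']

/-- The test whether two breakpoints are near each other. -/
def nearB (d : ℕ) (x i : NExp) : BExp :=
  .realLE (innerExp d (bcoord d x) (bcoord d i) (bcoord d x) (bcoord d i))
    (.mul (.ofNat (.lit 4)) (.mul deltaE deltaE))

theorem norm_le_iff_inner_le {u : Pt d} {r : ℝ} (hr : 0 ≤ r) : ‖u‖ ≤ r ↔ inner ℝ u u ≤ r * r := by
  rw [real_inner_self_eq_norm_mul_norm]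
  exact ⟨fun h => mul_self_le_mul_self (norm_nonneg _) h, fun h =>
    (mul_self_le_mul_self_iff (norm_nonneg _) hr).2 h⟩

theorem HasInput.nearB_eval {σ : Mem} (h : HasInput P T Δ σ) (hΔ : 0 ≤ Δ) {x i : NExp}
    {x' i' : ℕ} (hx : x.eval σ = x') (hi : i.eval σ = i') (hx' : EdgeAt P T σ x')
    (hi' : EdgeAt P T σ i') : (nearB d x i).eval σ ↔ Near P T Δ x' i' := by
  have h1 := h.describes_bcoord hx hx'
  have h2 := h.describes_bcoord hi hi'
  rw [nearB, BExp.eval, innerExp_eval h1 h2 h1 h2, Near, norm_le_iff_inner_le (by linarith)]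
  simp only [RExp.eval, NExp.eval, h.delta]
  push_cast
  rw [show (2 * Δ) * (2 * Δ) = 4 * (Δ * Δ) by ring]

/-! ## The edges of the breakpoints -/

/-- The limits leave enough room. -/
structure Ample (S : Limits) (d n m : ℕ) : Prop where
  arrays : 25 ≤ S.arrays
  len : 3000 * (d + 1) * m ^ 2 ≤ S.len
  word_vertices : n ≤ S.word
  word : 1000 * m ^ 4 ≤ S.word
  two_le : 3 ≤ m

namespace Ample

variable {S : Limits} (h : Ample S d n m)
include h

theorem sq_le_len : 3000 * m ^ 2 ≤ S.len :=
  le_trans (by nlinarith [Nat.zero_le (d * m ^ 2)]) h.len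

theorem lt_len {i : ℕ} (hi : i ≤ 1000 * m ^ 2) : i < S.len := by
  have h1 := h.sq_le_len
  have h2 : 0 < m ^ 2 := pow_pos (by have := h.two_le; omega) 2
  omega

theorem len_pos : 0 < S.len := h.lt_len (Nat.zero_le _)

theorem index_lt_len {i : ℕ} (hi : i ≤ 1000 * m) : i < S.len :=
  h.lt_len (hi.trans (by have := h.two_le; nlinarith))

theorem le_word {v : ℕ} (hv : v ≤ 1000 * m ^ 2) : v ≤ S.word := by
  refine hv.trans (le_trans ?_ h.word)
  have := Nat.pow_le_pow_right (show 0 < m by have := h.two_le; omega) (show 2 ≤ 4 by norm_num)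
  omega

theorem le_word' {v : ℕ} (hv : v ≤ 1000 * m) : v ≤ S.word :=
  h.le_word (hv.trans (by have := h.two_le; nlinarith))

end Ample

/-- Finds the edges of the breakpoints. -/
def edgeP : Prog :=
  forP 2 mE (forP 3 (.sub nE (.lit 1)) (.ite (.realLE (.get 1 (var 3)) (.get 2 (var 2)))
    (.setInt 5 (var 2) (var 3)) .skip))

variable {S : Limits}

/-- The last vertex before the final one with parameter at most that of the breakpoint starts a
correct edge: its successor has a larger parameter, or is the final vertex, with parameter 1. -/
theorem edgeP_runs (hS : Ample S d n m) {σ : Mem} (hσ : S.Safe σ) (hin : HasInput P T Δ σ) :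
    Runs S edgeP σ (((2 + 3) * (n - 1) + 3 + 3) * m + 3) fun τ => ∀ x < m, EdgeAt P T τ x := by
  have hA := hS.arrays
  have hn := P.two_le
  refine Runs.forP m (fun j τ => ∀ x < j, EdgeAt P T τ x) hσ (by omega) hS.len_pos
    (hS.le_word' (by omega)) (fun τ hf => ?_) (by simp [writesI, writesI_forP]) (by simp) ?_
  · simp [NExp.eval, hf.ints 0 (by simp [writesI, writesI_forP]), hin.mE]
  intro j hj τ hτ hf hv hI
  have hinτ : HasInput P T Δ τ := hin.frame hf (by simp [writesI, writesI_forP])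
    (by simp [writesR, writesR_forP])
  -- Before the first round the cell is arbitrary. Vertex 0 has parameter 0, so it is always written
  -- in that round.
  refine (Runs.forP (n - 1) (fun i ρ => (∀ x < j, EdgeAt P T ρ x) ∧ (0 < i → ρ.ints 5 j < i ∧
    P.sv (ρ.ints 5 j) ≤ T.tm j ∧ ∀ v < i, P.sv v ≤ T.tm j → v ≤ ρ.ints 5 j)) hτ (by omega)
    hS.len_pos ((Nat.sub_le _ _).trans hS.word_vertices) (fun ρ hf' => ?_) (by simp [writesI])
    ⟨?_, fun h => absurd h (lt_irrefl _)⟩ ?_ (T := 2)).mono le_rfl ?_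
  · simp [NExp.eval, hf'.ints 0 (by simp [writesI, writesI_forP]), hinτ.nE]
  · intro x hx
    simpa [EdgeAt, setInt_ints_ne] using hI x hx
  · intro i hi ρ hρ hf' hv' hI'
    have hinρ : HasInput P T Δ ρ := hinτ.frame hf' (by simp [writesI, writesI_forP])
      (by simp [writesR, writesR_forP])
    have h2 : ρ.ints 2 0 = j := by rw [hf'.ints 2 (by simp [writesI, writesI_forP]), hv]
    refine Runs.ite (T := 1) (T' := 1) (fun hb => ?_) fun hb => ?_
    · simp only [BExp.eval, RExp.eval, NExp.eval, hinρ.sv, hinρ.tm, hv', h2] at hb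
      refine Runs.setInt ?_ ?_
      · simp only [NExp.eval, h2, hv']
        exact hρ.setInt (by omega) (hS.index_lt_len (by omega))
          (by have := hS.word_vertices; omega)
      · simp only [NExp.eval, h2, hv']
        refine ⟨fun x hx => ?_, fun _ => ?_⟩
        · have := hI'.1 x hx
          simpa [EdgeAt, setInt_ints_ne, (show x ≠ j by omega)] using this
        · simp only [setInt_ints_ne _ _ _ (show (5 : ℕ) ≠ 3 by norm_num), setInt_ints_self,
            Function.update_self]
          exact ⟨by omega, hb, fun v hv _ => by omega⟩
    · simp only [BExp.eval, RExp.eval, NExp.eval, hinρ.sv, hinρ.tm, hv', h2] at hb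
      refine Runs.skip hρ ⟨fun x hx => ?_, fun _ => ?_⟩
      · simpa [EdgeAt, setInt_ints_ne] using hI'.1 x hx
      · have hi0 : 0 < i := by
          rcases Nat.eq_zero_or_pos i with rfl | h
          · exact absurd (by rw [P.sv_zero]; exact T.tm_nonneg hj) hb
          · exact h
        obtain ⟨h3, h4, h5⟩ := hI'.2 hi0
        simp only [setInt_ints_ne _ _ _ (show (5 : ℕ) ≠ 3 by norm_num)]
        refine ⟨by omega, h4, fun v hv hvt => ?_⟩
        rcases Nat.lt_succ_iff_lt_or_eq.1 hv with h6 | rfl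
        · exact h5 v h6 hvt
        · exact absurd hvt hb
  · rintro ρ hρ hf' ⟨h1, h2⟩ x hx
    obtain ⟨h3, h4, h5⟩ := h2 (by omega)
    have hgoal : EdgeAt P T ρ x := by
      rcases Nat.lt_succ_iff_lt_or_eq.1 hx with h6 | rfl
      · exact h1 x h6
      · refine ⟨by omega, h4, ?_⟩
        rcases Nat.lt_or_ge (ρ.ints 5 x + 1) (n - 1) with h6 | h6
        · by_contra hcon
          have := h5 _ h6 (not_le.1 hcon).le
          omega
        · rw [show ρ.ints 5 x + 1 = n - 1 by omega, P.sv_last]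
          exact T.tm_le_one hj
    simpa [EdgeAt, setInt_ints_ne] using hgoal

end Subtraj

namespace Subtraj

open RealRAM

variable {d n m : ℕ} {P : PolygonalCurve d n} {T : Breakpoints m} {Δ : ℝ} {S : Limits}

/-! ## The test of a subcurve as a program -/

/-- Tests the subcurve between the breakpoints in the variables `2` and `3`. -/
def testP (d : ℕ) : Prog :=
  .seq (.setInt 24 (.lit 0) (.lit 1)) (.seq (.setReal 5 (.lit 0) (.ofNat (.lit 0)))
    (forP 4 nE (.ite (.and (.not (.realLE (.get 1 (var 4)) (.get 2 (var 2))))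
        (.not (.realLE (.get 2 (var 3)) (.get 1 (var 4)))))
      (.seq (.setReal 5 (.lit 0) (maxExp (.get 5 (.lit 0)) (minExp (.ofNat (.lit 1))
          (.div (innerExp d (vcoord d (var 4)) (bcoord d (var 2)) (bcoord d (var 3))
              (bcoord d (var 2)))
            (innerExp d (bcoord d (var 3)) (bcoord d (var 2)) (bcoord d (var 3))
              (bcoord d (var 2)))))))
        (.ite (.realLE (innerExp d
            (fun c => .add (.mul (.get 5 (.lit 0)) (.sub (bcoord d (var 3) c) (bcoord d (var 2) c)))
              (bcoord d (var 2) c)) (vcoord d (var 4))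
            (fun c => .add (.mul (.get 5 (.lit 0)) (.sub (bcoord d (var 3) c) (bcoord d (var 2) c)))
              (bcoord d (var 2) c)) (vcoord d (var 4)))
            (.mul (.ofNat (.lit 16)) (.mul deltaE deltaE)))
          .skip (.setInt 24 (.lit 0) (.lit 0)))) .skip)))

theorem writesI_testP (a : ℕ) : writesI (testP d) a ↔ a = 24 ∨ a = 4 := by
  simp [testP, writesI, writesI_forP]; tauto

theorem writesR_testP (a : ℕ) : writesR (testP d) a ↔ a = 5 := by
  simp [testP, writesR, writesR_forP]

theorem testP_runs (hS : Ample S d n m) {σ : Mem} (hσ : S.Safe σ) (hin : HasInput P T Δ σ)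
    (hΔ : 0 ≤ Δ) {x y : ℕ} (hx : σ.ints 2 0 = x) (hy : σ.ints 3 0 = y) (hex : EdgeAt P T σ x)
    (hey : EdgeAt P T σ y) :
    Runs S (testP d) σ (8 * n + 7) fun τ => 1 ≤ τ.ints 24 0 ↔ BPass P T Δ x y := by
  have hA := hS.arrays
  have hn := P.two_le
  have hm := hS.two_le
  refine (Runs.seq (T := 1) (R := fun τ => τ.ints 24 0 = 1) (Runs.setInt ?_ (by simp [NExp.eval]))
    fun τ hτ hf h1 => Runs.seq (T := 1) (T' := (5 + 3) * n + 3) (R := fun ρ => ρ.reals 5 0 = 0) (Runs.setReal ?_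
      (by simp [NExp.eval, RExp.eval])) fun ρ hρ hf' h2 => ?_).le ?_
  · exact hσ.setInt (by omega) hS.len_pos (hS.le_word' (by simp [NExp.eval]; omega))
  · exact hτ.setReal (by omega) hS.len_pos
  rotate_left
  · rw [show 1 + 1 + (1 + 1 + ((5 + 3) * n + 3)) = 8 * n + 7 by ring]
  have hinρ : HasInput P T Δ ρ := (hin.frame hf (by simp [writesI]) (by simp [writesR])).frame hf'
    (by simp [writesI]) (by simp [writesR]; omega)
  have hρ24 : ρ.ints 24 0 = 1 := by rw [hf'.ints 24 (by simp [writesI]), h1]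
  have hρa : ∀ a, a ≠ 24 → ρ.ints a = σ.ints a := fun a ha => by
    rw [hf'.ints a (by simp [writesI]), hf.ints a (by simpa [writesI] using ha)]
  have hexρ : EdgeAt P T ρ x := by rwa [EdgeAt, hρa 5 (by norm_num)]
  have heyρ : EdgeAt P T ρ y := by rwa [EdgeAt, hρa 5 (by norm_num)]
  -- The real variable carries the running maximum, and the flag records whether all vertices so far
  -- stayed close to it.
  refine (Runs.forP n (fun j κ => κ.reals 5 0 = P.sweep (T.tm x) (T.tm y) j ∧
    (1 ≤ κ.ints 24 0 ↔ ∀ v < j, T.tm x < P.sv v → P.sv v < T.tm y →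
      ‖AffineMap.lineMap (bpt P T x) (bpt P T y) (P.sweep (T.tm x) (T.tm y) (v + 1)) - P.vt v‖ ≤
        4 * Δ)) hρ (by omega)
    hS.len_pos hS.word_vertices (fun κ hκ => ?_) (by simp [writesI])
    ⟨?_, ?_⟩ ?_).mono le_rfl fun κ _ _ h => h.2
  · simp [NExp.eval, hκ.ints 0 (by simp [writesI, writesI_forP]), hinρ.nE]
  · simpa [PolygonalCurve.sweep] using h2
  · simp [setInt_ints_ne, hρ24]
  intro j hj κ hκ hfκ hvκ hI
  have hinκ : HasInput P T Δ κ := hinρ.frame hfκ (by simp [writesI, writesI_forP])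
    (by simp [writesR, writesR_forP]; omega)
  have hκa : ∀ a, a ≠ 4 → a ≠ 24 → κ.ints a = ρ.ints a := fun a ha ha' =>
    hfκ.ints a (by simp [writesI, writesI_forP, ha, ha'])
  have hx2 : κ.ints 2 0 = x := by rw [hκa 2 (by simp) (by simp), hρa 2 (by simp), hx]
  have hy3 : κ.ints 3 0 = y := by rw [hκa 3 (by simp) (by simp), hρa 3 (by simp), hy]
  have hexκ : EdgeAt P T κ x := by rwa [EdgeAt, hκa 5 (by norm_num) (by norm_num)]
  have heyκ : EdgeAt P T κ y := by rwa [EdgeAt, hκa 5 (by norm_num) (by norm_num)]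
  have hdx : ∀ κ', κ'.ints = κ.ints → HasInput P T Δ κ' →
      Describes κ' (bcoord d (var 2)) (bpt P T x) := fun κ' h h' =>
    h'.describes_bcoord (by simp [NExp.eval, h, hx2]) (by rwa [EdgeAt, h])
  have hdy : ∀ κ', κ'.ints = κ.ints → HasInput P T Δ κ' →
      Describes κ' (bcoord d (var 3)) (bpt P T y) := fun κ' h h' =>
    h'.describes_bcoord (by simp [NExp.eval, h, hy3]) (by rwa [EdgeAt, h])
  have hdv : ∀ κ', κ'.ints = κ.ints → HasInput P T Δ κ' →
      Describes κ' (vcoord d (var 4)) (P.vt j) := fun κ' h h' =>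
    h'.describes_vcoord (by simp [NExp.eval, h, hvκ]) hj
  have hb : BExp.eval κ (.and (.not (.realLE (.get 1 (var 4)) (.get 2 (var 2))))
        (.not (.realLE (.get 2 (var 3)) (.get 1 (var 4))))) ↔
      T.tm x < P.sv j ∧ P.sv j < T.tm y := by
    simp [BExp.eval, RExp.eval, NExp.eval, hvκ, hx2, hy3, hinκ.sv, hinκ.tm]
  refine Runs.ite (T := 4) (T' := 1) (fun hb' => ?_) fun hb' => ?_
  · rw [hb] at hb'
    refine Runs.seq (T := 1) (T' := 2) (R := fun μ => μ.reals 5 0 =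
      P.sweep (T.tm x) (T.tm y) (j + 1)) (Runs.setReal (hκ.setReal (by omega) hS.len_pos) ?_)
      fun μ hμ hfμ hμ5 => ?_
    · simp only [NExp.eval, setReal_reals_self, Function.update_self, maxExp_eval, minExp_eval]
      rw [PolygonalCurve.sweep, if_pos hb']
      simp only [RExp.eval, NExp.eval, hI.1, projParam,
        innerExp_eval (hdv κ rfl hinκ) (hdx κ rfl hinκ) (hdy κ rfl hinκ) (hdx κ rfl hinκ),
        innerExp_eval (hdy κ rfl hinκ) (hdx κ rfl hinκ) (hdy κ rfl hinκ) (hdx κ rfl hinκ), bpt]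
      norm_num
    · have hμi : μ.ints = κ.ints := funext fun a => hfμ.ints a (by simp [writesI])
      have hinμ : HasInput P T Δ μ := hinκ.frame hfμ (by simp [writesI]) (by simp [writesR]; omega)
      have hdl : Describes μ (fun c => .add (.mul (.get 5 (.lit 0))
          (.sub (bcoord d (var 3) c) (bcoord d (var 2) c))) (bcoord d (var 2) c))
          (AffineMap.lineMap (bpt P T x) (bpt P T y) (P.sweep (T.tm x) (T.tm y) (j + 1))) := by
        intro c hc
        simp [RExp.eval, NExp.eval, hμ5, hdx μ hμi hinμ c hc, hdy μ hμi hinμ c hc,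
          AffineMap.lineMap_apply_module']
      have hcheck : BExp.eval μ (.realLE (innerExp d
            (fun c => .add (.mul (.get 5 (.lit 0)) (.sub (bcoord d (var 3) c) (bcoord d (var 2) c)))
              (bcoord d (var 2) c)) (vcoord d (var 4))
            (fun c => .add (.mul (.get 5 (.lit 0)) (.sub (bcoord d (var 3) c) (bcoord d (var 2) c)))
              (bcoord d (var 2) c)) (vcoord d (var 4)))
            (.mul (.ofNat (.lit 16)) (.mul deltaE deltaE))) ↔
          ‖AffineMap.lineMap (bpt P T x) (bpt P T y) (P.sweep (T.tm x) (T.tm y) (j + 1)) -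
            P.vt j‖ ≤ 4 * Δ := by
        rw [BExp.eval, innerExp_eval hdl (hdv μ hμi hinμ) hdl (hdv μ hμi hinμ),
          norm_le_iff_inner_le (by linarith)]
        simp only [RExp.eval, NExp.eval, hinμ.delta]
        push_cast
        rw [show (4 * Δ) * (4 * Δ) = 16 * (Δ * Δ) by ring]
      refine Runs.ite (T := 1) (T' := 1) (fun hc => Runs.skip hμ ⟨hμ5, ?_⟩)
        fun hc => Runs.setInt (hμ.setInt (by omega) hS.len_pos (Nat.zero_le _)) ⟨hμ5, ?_⟩
      · rw [hcheck] at hc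
        rw [setInt_ints_ne _ _ _ (by norm_num), hμi, hI.2]
        constructor
        · intro h v hv hv1 hv2
          rcases Nat.lt_succ_iff_lt_or_eq.1 hv with h' | rfl
          · exact h v h' hv1 hv2
          · exact hc
        · intro h v hv; exact h v (by omega)
      · rw [hcheck] at hc
        simp only [NExp.eval, setInt_ints_ne _ _ _ (show (24 : ℕ) ≠ 4 by norm_num),
          setInt_ints_self, Function.update_self]
        refine ⟨fun h => absurd h (by norm_num), fun h => absurd (h j (by omega) hb'.1 hb'.2) hc⟩
  · rw [hb] at hb'
    refine Runs.skip hκ ⟨?_, ?_⟩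
    · rw [PolygonalCurve.sweep, if_neg hb', ← hI.1]; rfl
    · rw [setInt_ints_ne _ _ _ (by norm_num), hI.2]
      constructor
      · intro h v hv hv1 hv2
        rcases Nat.lt_succ_iff_lt_or_eq.1 hv with h' | rfl
        · exact h v h' hv1 hv2
        · exact absurd ⟨hv1, hv2⟩ hb'
      · intro h v hv; exact h v (by omega)

/-- Computes how far the breakpoints reach. -/
def reachP (d : ℕ) : Prog :=
  forP 2 mE (.seq (.setInt 6 (var 2) (var 2)) (forP 3 mE
    (.ite (.and (.natLE (.add (.get 6 (var 2)) (.lit 1)) (var 3))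
        (.natLE (var 3) (.add (.get 6 (var 2)) (.lit 1))))
      (.seq (testP d) (.ite (.natLE (.lit 1) (var 24)) (.setInt 6 (var 2) (var 3)) .skip))
      .skip)))

theorem writesI_reachP (a : ℕ) :
    writesI (reachP d) a ↔ a = 2 ∨ a = 6 ∨ a = 3 ∨ a = 24 ∨ a = 4 := by
  simp [reachP, writesI, writesI_forP, writesI_testP]; tauto

theorem writesR_reachP (a : ℕ) : writesR (reachP d) a ↔ a = 5 := by
  simp [reachP, writesR, writesR_forP, writesR_testP]

theorem reachP_runs (hS : Ample S d n m) {σ : Mem} (hσ : S.Safe σ) (hin : HasInput P T Δ σ)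
    (hΔ : 0 ≤ Δ) (he : ∀ x < m, EdgeAt P T σ x) :
    Runs S (reachP d) σ (((8 * n + 14) * m + 8) * m + 3) fun τ =>
      ∀ x < m, τ.ints 6 x = reach m (BPass P T Δ) x := by
  have hA := hS.arrays
  have hm := hS.two_le
  refine (Runs.forP m (fun j τ => ∀ x < j, τ.ints 6 x = reach m (BPass P T Δ) x) hσ (by omega)
    hS.len_pos (hS.le_word' (by omega)) (fun τ hf => ?_)
    (by simp [writesI, writesI_forP, writesI_testP]) (by simp) ?_ (T := (8 * n + 14) * m + 5)).le
    (by ring_nf; rfl)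
  · simp [NExp.eval, hf.ints 0 (by simp [writesI, writesI_forP, writesI_testP]), hin.mE]
  intro j hj τ hτ hf hv hI
  have hinτ : HasInput P T Δ τ := hin.frame hf (by simp [writesI, writesI_forP, writesI_testP])
    (by simp [writesR, writesR_forP, writesR_testP]; omega)
  have hτ5 : τ.ints 5 = σ.ints 5 := hf.ints 5 (by simp [writesI, writesI_forP, writesI_testP])
  refine (Runs.seq (T := 1) (T' := (8 * n + 14) * m + 3) (R := fun ρ => ρ.ints 6 j = j ∧
    ∀ x < j, ρ.ints 6 x = reach m (BPass P T Δ) x) (Runs.setInt ?_ ?_)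
    fun ρ hρ hfρ hR => ?_).le (by omega)
  · simp only [NExp.eval, hv]
    exact hτ.setInt (by omega) (hS.index_lt_len (by omega)) (hS.le_word' (by omega))
  · simp only [NExp.eval, hv, setInt_ints_self]
    exact ⟨by simp, fun x hx => by simp [hx.ne, hI x hx]⟩
  have hinρ : HasInput P T Δ ρ := hinτ.frame hfρ (by simp [writesI]) (by simp [writesR])
  -- The scan for index `j` calls the test only at the successor of the current reach, at most once
  -- per round; over all `j` these tests give the term `m² n`.
  refine (Runs.forP m (fun i κ => κ.ints 6 j = reachAux (BPass P T Δ) j i ∧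
    ∀ x < j, κ.ints 6 x = reach m (BPass P T Δ) x) hρ (by omega)
    hS.len_pos (hS.le_word' (by omega)) (fun κ hfκ => ?_)
    (by simp [writesI, writesI_testP]) ?_ ?_ (T := 8 * n + 11)).mono le_rfl ?_
  · simp [NExp.eval, hfκ.ints 0 (by simp [writesI, writesI_forP, writesI_testP]), hinρ.mE]
  · simpa [setInt_ints_ne, reachAux] using hR
  · intro i hi κ hκ hfκ hvκ hIκ
    have hinκ : HasInput P T Δ κ := hinρ.frame hfκ
      (by simp [writesI, writesI_forP, writesI_testP])
      (by simp [writesR, writesR_forP, writesR_testP]; omega)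
    have hκ2 : κ.ints 2 0 = j := by
      rw [hfκ.ints 2 (by simp [writesI, writesI_forP, writesI_testP]),
        hfρ.ints 2 (by simp [writesI]), hv]
    have hκ5 : κ.ints 5 = σ.ints 5 := by
      rw [hfκ.ints 5 (by simp [writesI, writesI_forP, writesI_testP]),
        hfρ.ints 5 (by simp [writesI]), hτ5]
    have hb : BExp.eval κ (.and (.natLE (.add (.get 6 (var 2)) (.lit 1)) (var 3))
        (.natLE (var 3) (.add (.get 6 (var 2)) (.lit 1)))) ↔
        reachAux (BPass P T Δ) j i + 1 = i := by
      simp only [BExp.eval, NExp.eval, hκ2, hvκ, hIκ.1]; omega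
    refine (Runs.ite (T := 8 * n + 10) (T' := 1) (fun hb' => ?_) fun hb' => ?_).le
      (by rw [max_eq_left (by omega)]; omega)
    · rw [hb] at hb'
      refine (Runs.seq (testP_runs hS hκ hinκ hΔ hκ2 hvκ (by rw [EdgeAt, hκ5]; exact he j hj)
        (by rw [EdgeAt, hκ5]; exact he i hi)) fun μ hμ hfμ hiff =>
          Runs.ite (T := 1) (T' := 1) (fun hc => Runs.setInt ?_ ?_) fun hc => Runs.skip hμ ?_).le
        (by simp only [max_self]; omega)
      all_goals
        have hμ2 : μ.ints 2 0 = j := by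
          rw [hfμ.ints 2 (by simp [writesI_testP]), hκ2]
        have hμ3 : μ.ints 3 0 = i := by
          rw [hfμ.ints 3 (by simp [writesI_testP]), hvκ]
        have hμ6 : μ.ints 6 = κ.ints 6 := hfμ.ints 6 (by simp [writesI_testP])
        simp only [BExp.eval, NExp.eval, hiff] at hc
      · simp only [NExp.eval, hμ2, hμ3]
        exact hμ.setInt (by omega) (hS.index_lt_len (by omega)) (hS.le_word' (by omega))
      · simp only [NExp.eval, hμ2, hμ3, setInt_ints_ne _ _ _ (show (6 : ℕ) ≠ 3 by norm_num),
          setInt_ints_self, hμ6]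
        refine ⟨?_, fun x hx => by simp [hx.ne, hIκ.2 x hx]⟩
        rw [reachAux, if_pos ⟨hb', hc⟩]; simp
      · simp only [setInt_ints_ne _ _ _ (show (6 : ℕ) ≠ 3 by norm_num), hμ6]
        refine ⟨?_, hIκ.2⟩
        rw [reachAux, if_neg fun h => hc h.2, hIκ.1]
    · rw [hb] at hb'
      refine Runs.skip hκ ?_
      simp only [setInt_ints_ne _ _ _ (show (6 : ℕ) ≠ 3 by norm_num)]
      refine ⟨?_, hIκ.2⟩
      rw [reachAux, if_neg fun h => hb' h.1, hIκ.1]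
  · rintro κ hκ hfκ ⟨h1, h2⟩ x hx
    rw [setInt_ints_ne _ _ _ (by norm_num)]
    rcases Nat.lt_succ_iff_lt_or_eq.1 hx with h3 | rfl
    · exact h2 x h3
    · exact h1

/-! ## The tables as a program -/

/-- Fills the tables of the covering relation. -/
def tableP (d : ℕ) : Prog :=
  forP 2 mE (forP 3 mE (.seq
    (.ite (nearB d (var 2) (var 3))
      (.setInt 7 (.add (.mul (.add (var 2) (.lit 1)) mE) (var 3))
        (.add (.get 7 (.add (.mul (var 2) mE) (var 3)))
          (.sub (.get 6 (var 2)) (.get 7 (.add (.mul (var 2) mE) (var 3))))))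
      (.setInt 7 (.add (.mul (.add (var 2) (.lit 1)) mE) (var 3))
        (.get 7 (.add (.mul (var 2) mE) (var 3)))))
    (.ite (nearB d (.sub (.sub mE (.lit 1)) (var 2)) (var 3))
      (.setInt 8 (.add (.mul (.add (var 2) (.lit 1)) mE) (var 3)) (.add (var 2) (.lit 1)))
      (.setInt 8 (.add (.mul (.add (var 2) (.lit 1)) mE) (var 3))
        (.get 8 (.add (.mul (var 2) mE) (var 3)))))))

theorem writesI_tableP (a : ℕ) :
    writesI (tableP d) a ↔ a = 2 ∨ a = 3 ∨ a = 7 ∨ a = 8 := by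
  simp [tableP, writesI, writesI_forP]

theorem row_index_inj {m z z' i i' : ℕ} (hi : i < m) (hi' : i' < m)
    (h : z * m + i = z' * m + i') : z = z' ∧ i = i' := by
  have h1 : (z * m + i) / m = z := by
    rw [mul_comm, Nat.mul_add_div (by omega), Nat.div_eq_of_lt hi, add_zero]
  have h2 : (z' * m + i') / m = z' := by
    rw [mul_comm, Nat.mul_add_div (by omega), Nat.div_eq_of_lt hi', add_zero]
  have h3 : z = z' := by rw [← h1, ← h2, h]
  subst h3
  exact ⟨rfl, by omega⟩

/-- Rows `0, …, z - 1` of the table in array `a` are those of `f`, and so is row `z` up to column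
`i`. -/
def TableUpTo (m a : ℕ) (f : ℕ → ℕ → ℕ) (z i : ℕ) (σ : Mem) : Prop :=
  ∀ z' i', i' < m → (z' < z ∨ z' = z ∧ i' < i) → σ.ints a (z' * m + i') = f z' i'

theorem TableUpTo.step {a z i v : ℕ} {f : ℕ → ℕ → ℕ} {σ : Mem} (h : TableUpTo m a f z i σ)
    (hi : i < m) (hv : v = f z i) : TableUpTo m a f z (i + 1) (σ.setInt a (z * m + i) v) := by
  intro z' i' hi' h'
  rw [setInt_ints_self, Function.update_apply]
  split_ifs with heq
  · obtain ⟨rfl, rfl⟩ := row_index_inj hi' hi heq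
    exact hv
  · refine h z' i' hi' ?_
    rcases h' with h' | ⟨rfl, h'⟩
    · exact Or.inl h'
    · refine Or.inr ⟨rfl, ?_⟩
      rcases Nat.lt_succ_iff_lt_or_eq.1 h' with h2 | rfl
      · exact h2
      · exact absurd rfl heq

theorem TableUpTo.congr {a z i : ℕ} {f : ℕ → ℕ → ℕ} {σ τ : Mem} (h : TableUpTo m a f z i σ)
    (hτ : τ.ints a = σ.ints a) : TableUpTo m a f z i τ := by
  intro z' i' hi' h'
  rw [hτ]; exact h z' i' hi' h'

theorem TableUpTo.row {a z : ℕ} {f : ℕ → ℕ → ℕ} {σ : Mem} (h : TableUpTo m a f z m σ) :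
    TableUpTo m a f (z + 1) 0 σ := by
  intro z' i' hi' h'
  exact h z' i' hi' (by omega)

theorem startTab_le {near : ℕ → ℕ → Prop} {D : ℕ → ℕ} {B z i : ℕ} (h : ∀ x < z, D x ≤ B) :
    startTab near D z i ≤ B := by
  induction z with
  | zero => exact Nat.zero_le _
  | succ z ih =>
    have := ih fun x hx => h x (by omega)
    rw [startTab]
    split_ifs
    · exact max_le this (h z (by omega))
    · exact this

theorem endTab_le {near : ℕ → ℕ → Prop} {q j : ℕ} : endTab m near q j ≤ q := by
  induction q with
  | zero => exact le_rfl
  | succ q ih => rw [endTab]; split_ifs <;> omega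

variable (P T Δ) in
/-- The input and the tables are in place. -/
structure Ready (σ : Mem) : Prop where
  input : HasInput P T Δ σ
  edge : ∀ x < m, EdgeAt P T σ x
  start : TableUpTo m 7 (startTab (Near P T Δ) (reach m (BPass P T Δ))) m m σ
  fin : TableUpTo m 8 (endTab m (Near P T Δ)) m m σ

theorem tableP_runs (hS : Ample S d n m) {σ : Mem} (hσ : S.Safe σ) (hin : HasInput P T Δ σ)
    (hΔ : 0 ≤ Δ) (he : ∀ x < m, EdgeAt P T σ x)
    (hD : ∀ x < m, σ.ints 6 x = reach m (BPass P T Δ) x)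
    (h7 : ∀ i, σ.ints 7 i = 0) (h8 : ∀ i, σ.ints 8 i = 0) :
    Runs S (tableP d) σ ((8 * m + 6) * m + 3) (Ready P T Δ) := by
  have hA := hS.arrays
  have hm := hS.two_le
  set fS := startTab (Near P T Δ) (reach m (BPass P T Δ)) with hfS
  set fE := endTab m (Near P T Δ) with hfE
  -- Round `z` writes row `z + 1`. Row 0 of both tables is zero and is supplied by the untouched
  -- memory.
  refine (Runs.forP m (fun z τ => TableUpTo m 7 fS (z + 1) 0 τ ∧ TableUpTo m 8 fE (z + 1) 0 τ)
    hσ (by omega) hS.len_pos (hS.le_word' (by omega)) (fun τ hf => ?_)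
    (by simp [writesI, writesI_forP]) ⟨?_, ?_⟩ ?_ (T := (5 + 3) * m + 3)).mono
    (by ring_nf; rfl) ?_
  · simp [NExp.eval, hf.ints 0 (by simp [writesI, writesI_forP]), hin.mE]
  · intro z' i' hi' h'
    obtain rfl : z' = 0 := by omega
    simp [setInt_ints_ne, h7, hfS, startTab]
  · intro z' i' hi' h'
    obtain rfl : z' = 0 := by omega
    simp [setInt_ints_ne, h8, hfE, endTab]
  · intro z hz τ hτ hf hv hI
    have hinτ : HasInput P T Δ τ := hin.frame hf (by simp [writesI, writesI_forP])
      (by simp [writesR, writesR_forP])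
    have hτa : ∀ a, a ≠ 2 → a ≠ 3 → a ≠ 7 → a ≠ 8 → τ.ints a = σ.ints a := fun a h1 h2 h3 h4 =>
      hf.ints a (by simp [writesI, writesI_forP, h1, h2, h3, h4])
    refine (Runs.forP m (fun i ρ => TableUpTo m 7 fS (z + 1) i ρ ∧ TableUpTo m 8 fE (z + 1) i ρ)
      hτ (by omega) hS.len_pos (hS.le_word' (by omega)) (fun ρ hf' => ?_) (by simp [writesI])
      ⟨hI.1.congr (setInt_ints_ne _ _ _ (by norm_num)),
        hI.2.congr (setInt_ints_ne _ _ _ (by norm_num))⟩ ?_ (T := 5)).mono le_rfl ?_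
    · simp [NExp.eval, hf'.ints 0 (by simp [writesI, writesI_forP]), hinτ.mE]
    · intro i hi ρ hρ hf' hv' hI'
      have hinρ : HasInput P T Δ ρ := hinτ.frame hf' (by simp [writesI, writesI_forP])
        (by simp [writesR, writesR_forP])
      have hρa : ∀ a, a ≠ 3 → a ≠ 7 → a ≠ 8 → ρ.ints a = τ.ints a := fun a h1 h2 h3 =>
        hf'.ints a (by simp [writesI, writesI_forP, h1, h2, h3])
      have hρ2 : ρ.ints 2 0 = z := by rw [hρa 2 (by simp) (by simp) (by simp), hv]
      have hρ5 : ρ.ints 5 = σ.ints 5 := by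
        rw [hρa 5 (by simp) (by simp) (by simp), hτa 5 (by simp) (by simp) (by simp) (by simp)]
      have hρ6 : ρ.ints 6 z = reach m (BPass P T Δ) z := by
        rw [hρa 6 (by simp) (by simp) (by simp), hτa 6 (by simp) (by simp) (by simp) (by simp),
          hD z hz]
      have hzm : z * m + m ≤ m ^ 2 := by nlinarith
      have hidx : (z + 1) * m + i < S.len := hS.lt_len (by nlinarith)
      have hbound : ∀ z' ≤ m, fS z' i ≤ m := fun z' hz' =>
        startTab_le fun x hx => (reach_lt (by omega)).le
      have hrow7 : ρ.ints 7 (z * m + i) = fS z i := hI'.1 z i hi (by omega)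
      have hrow8 : ρ.ints 8 (z * m + i) = fE z i := hI'.2 z i hi (by omega)
      have hn1 := hinρ.nearB_eval hΔ (x := var 2) (i := var 3) (x' := z) (i' := i)
        (by simp [NExp.eval, hρ2]) (by simp [NExp.eval, hv']) (by rw [EdgeAt, hρ5]; exact he z hz)
        (by rw [EdgeAt, hρ5]; exact he i hi)
      have hrun7 : ∀ v : NExp, v.eval ρ = fS (z + 1) i →
          Runs S (.setInt 7 (.add (.mul (.add (var 2) (.lit 1)) mE) (var 3)) v) ρ 1 fun κ =>
            TableUpTo m 7 fS (z + 1) (i + 1) κ := by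
        intro v hvv
        refine Runs.setInt ?_ ?_
        · simp only [NExp.eval, hρ2, hv', hinρ.mE] at hvv ⊢
          exact hρ.setInt (by omega) hidx (hvv ▸ hS.le_word' ((hbound _ (by omega)).trans (by omega)))
        · simp only [NExp.eval, hρ2, hv', hinρ.mE]
          exact hI'.1.step hi hvv
      refine Runs.seq (T := 2) (T' := 2) (R := fun κ => TableUpTo m 7 fS (z + 1) (i + 1) κ)
        (Runs.ite (T := 1) (T' := 1) (fun hb => hrun7 _ ?_) fun hb => hrun7 _ ?_)
        fun κ hκ hfκ hR => ?_
      · rw [hn1] at hb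
        simp only [NExp.eval, hρ2, hv', hinρ.mE, hrow7, hρ6]
        -- The program computes a maximum as `a + (b - a)` with truncated subtraction.
        rw [hfS, startTab, if_pos hb, max_def]
        split_ifs <;> omega
      · rw [hn1] at hb
        simp only [NExp.eval, hρ2, hv', hinρ.mE, hrow7]
        rw [hfS, startTab, if_neg hb]
      · have hκa : ∀ a, a ≠ 7 → κ.ints a = ρ.ints a := fun a h1 =>
          hfκ.ints a (by simp [writesI, h1])
        have hinκ : HasInput P T Δ κ := hinρ.frame hfκ (by simp [writesI]) (by simp [writesR])
        have hκ2 : κ.ints 2 0 = z := by rw [hκa 2 (by simp), hρ2]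
        have hκ3 : κ.ints 3 0 = i := by rw [hκa 3 (by simp), hv']
        have hrun8 : ∀ v : NExp, v.eval κ = fE (z + 1) i →
            Runs S (.setInt 8 (.add (.mul (.add (var 2) (.lit 1)) mE) (var 3)) v) κ 1 fun μ =>
              TableUpTo m 7 fS (z + 1) (i + 1) (μ.setInt 3 0 (i + 1)) ∧
                TableUpTo m 8 fE (z + 1) (i + 1) (μ.setInt 3 0 (i + 1)) := by
          intro v hvv
          refine Runs.setInt ?_ ?_
          · simp only [NExp.eval, hκ2, hκ3, hinκ.mE] at hvv ⊢
            refine hκ.setInt (by omega) hidx (hvv ▸ hS.le_word' ?_)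
            have : fE (z + 1) i ≤ z + 1 := endTab_le
            omega
          · simp only [NExp.eval, hκ2, hκ3, hinκ.mE]
            refine ⟨hR.congr ?_, ((hI'.2.congr (hκa 8 (by simp))).step hi hvv).congr ?_⟩
            · rw [setInt_ints_ne _ _ _ (by norm_num), setInt_ints_ne _ _ _ (by norm_num)]
            · rw [setInt_ints_ne _ _ _ (by norm_num)]
        have hn2 := hinκ.nearB_eval hΔ (x := .sub (.sub mE (.lit 1)) (var 2)) (i := var 3)
          (x' := m - 1 - z) (i' := i)
          (by simp [NExp.eval, hκ2, hinκ.mE]) (by simp [NExp.eval, hκ3])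
          (by rw [EdgeAt, hκa 5 (by simp), hρ5]; exact he _ (by omega))
          (by rw [EdgeAt, hκa 5 (by simp), hρ5]; exact he i hi)
        refine Runs.ite (T := 1) (T' := 1) (fun hb => hrun8 _ ?_) fun hb => hrun8 _ ?_
        · rw [hn2] at hb
          simp only [NExp.eval, hκ2]
          rw [hfE, endTab, if_pos hb]
        · rw [hn2] at hb
          simp only [NExp.eval, hκ2, hκ3, hinκ.mE]
          rw [hκa 8 (by simp), hrow8, hfE, endTab, if_neg hb]
    · rintro ρ hρ hf' ⟨h1, h2⟩
      exact ⟨h1.row.congr (setInt_ints_ne _ _ _ (by norm_num)),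
        h2.row.congr (setInt_ints_ne _ _ _ (by norm_num))⟩
  · rintro τ hτ hf ⟨h1, h2⟩
    have hf5 : τ.ints 5 = σ.ints 5 := hf.ints 5 (by simp [writesI, writesI_forP])
    refine ⟨hin.frame hf (by simp [writesI, writesI_forP]) (by simp [writesR, writesR_forP]),
      fun x hx => by rw [EdgeAt, hf5]; exact he x hx,
      fun z' i' hi' h' => h1 z' i' hi' (by omega), fun z' i' hi' h' => h2 z' i' hi' (by omega)⟩

theorem Ready.frame {σ τ : Mem} {p : Prog} (h : Ready P T Δ σ) (hf : Frame p σ τ)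
    (hI : ∀ a, a = 0 ∨ a = 5 ∨ a = 7 ∨ a = 8 → ¬ writesI p a) (hR : ∀ a < 4, ¬ writesR p a) :
    Ready P T Δ τ :=
  ⟨h.input.frame hf (hI 0 (by simp)) hR,
    fun x hx => by rw [EdgeAt, hf.ints 5 (hI 5 (by simp))]; exact h.edge x hx,
    h.start.congr (hf.ints 7 (hI 7 (by simp))), h.fin.congr (hf.ints 8 (hI 8 (by simp)))⟩

/-- The first breakpoint of candidate `c`; variable `11` holds the length bound `L`. -/
def candStart (c : NExp) : NExp := .div c (var 11)

/-- The last breakpoint of candidate `c`. -/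
def candEnd (c : NExp) : NExp :=
  .sub (.add (.add (.div c (var 11)) (.lit 1)) (.sub c (.mul (var 11) (.div c (var 11)))))
    (.sub (.add (.add (.div c (var 11)) (.lit 1)) (.sub c (.mul (var 11) (.div c (var 11)))))
      (.sub mE (.lit 1)))

/-- The test whether candidate `c` covers element `z - 1`. -/
def hitsB (z c : NExp) : BExp :=
  .natLE mE (.add (.get 7 (.add (.mul z mE) (candStart c)))
    (.get 8 (.add (.mul (.sub mE z) mE) (candEnd c))))

theorem candStart_eval {σ : Mem} {c : NExp} {c' L : ℕ} (hL : σ.ints 11 0 = L)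
    (hc : c.eval σ = c') : (candStart c).eval σ = c' / L := by
  simp [candStart, NExp.eval, hL, hc]

/-- With truncated subtraction `x - (x - y)` is a minimum, and the remainder is recovered from the
quotient. -/
theorem candEnd_eval {σ : Mem} {c : NExp} {c' L : ℕ} (hm : σ.ints 0 1 = m)
    (hL : σ.ints 11 0 = L) (hc : c.eval σ = c') :
    (candEnd c).eval σ = min (c' / L + 1 + c' % L) (m - 1) := by
  have : c' - L * (c' / L) = c' % L := by
    have := Nat.div_add_mod c' L
    omega
  simp only [candEnd, NExp.eval, hL, hc, hm, this]
  generalize c' / L + 1 + c' % L = x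
  omega

/-- Elements are stored shifted by one. The shifted number is the row of the start table, and its
difference from `m` is the row of the end table. -/
theorem Ready.hitsB_eval {σ : Mem} (h : Ready P T Δ σ) {z c : NExp} {z' c' L : ℕ}
    (hL : σ.ints 11 0 = L) (hz : z.eval σ = z' + 1) (hc : c.eval σ = c') (hz' : z' < m)
    (hc' : c' < m * L) : (hitsB z c).eval σ ↔ Hits P T Δ L z' c' := by
  have h1 : c' / L < m := Nat.div_lt_of_lt_mul (by rwa [mul_comm])
  simp only [hitsB, BExp.eval, NExp.eval, candStart_eval hL hc, candEnd_eval h.input.mE hL hc, hz,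
    h.input.mE]
  rw [h.start (z' + 1) (c' / L) h1 (by omega), h.fin (m - (z' + 1)) _ (by omega) (by omega), Hits,
    Covered, Cov, show m - (z' + 1) = m - 1 - z' by omega]

end Subtraj

namespace Subtraj

open RealRAM

/-! ## The potential of a random sample -/

section Potential

open Classical in
/-- The total mass of the candidates that cover `z`. -/
def massAt (M : ℕ) (R : ℕ → ℕ → Prop) (a : ℕ → ℝ) (z : ℕ) : ℝ :=
  ∑ c ∈ Finset.range M, if R z c then a c else 0

/-- A bound on the probability that the sample gets too large, or misses an element that is covered
by a large mass: `a` is the mass sampled so far, at rate `s / W`, `mk z = 0` means that no sampled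
candidate covers `z < N`, and `cnt` is the size of the sample. -/
def samplePot (N M s W lim : ℕ) (R : ℕ → ℕ → Prop) (a : ℕ → ℝ) (mk : ℕ → ℕ) (cnt : ℕ) : ℝ :=
  (cnt + (2 * s - s / W * ∑ c ∈ Finset.range M, a c)) / lim +
    if cnt < lim then ∑ z ∈ Finset.range N,
      if mk z = 0 then Real.exp (s / W * massAt M R a z) / (4 * (N + 1)) else 0 else 0

variable {N M s W lim : ℕ} {R : ℕ → ℕ → Prop} {a a' : ℕ → ℝ} {mk mk' : ℕ → ℕ} {cnt : ℕ}

theorem sum_add_single {c : ℕ} (hc : c < M) {δ : ℝ}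
    (ha : ∀ c' < M, a' c' = a c' + if c' = c then δ else 0) :
    ∑ c ∈ Finset.range M, a' c = ∑ c ∈ Finset.range M, a c + δ := by
  rw [Finset.sum_congr rfl fun c' hc' => ha c' (Finset.mem_range.1 hc'), Finset.sum_add_distrib,
    Finset.sum_ite_eq' (Finset.range M) c fun _ => δ, if_pos (Finset.mem_range.2 hc)]

open Classical in
theorem massAt_add_single {c z : ℕ} (hc : c < M) {δ : ℝ}
    (ha : ∀ c' < M, a' c' = a c' + if c' = c then δ else 0) :
    massAt M R a' z = massAt M R a z + if R z c then δ else 0 := by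
  rw [massAt, massAt]
  exact sum_add_single (a := fun c => if R z c then a c else 0)
      (a' := fun c => if R z c then a' c else 0) (δ := if R z c then δ else 0) hc fun c' hc' => by
    simp only [ha c' hc']
    by_cases h : c' = c
    · subst h; by_cases hR : R z c' <;> simp [hR]
    · simp [h]

theorem samplePot_congr (ha : ∀ c < M, a' c = a c) (hmk : ∀ z < N, mk' z = mk z) :
    samplePot N M s W lim R a' mk' cnt = samplePot N M s W lim R a mk cnt := by
  classical
  have h1 : ∑ c ∈ Finset.range M, a' c = ∑ c ∈ Finset.range M, a c :=
    Finset.sum_congr rfl fun c hc => ha c (Finset.mem_range.1 hc)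
  have h2 : ∀ z, massAt M R a' z = massAt M R a z := fun z =>
    Finset.sum_congr rfl fun c hc => by rw [ha c (Finset.mem_range.1 hc)]
  rw [samplePot, samplePot, h1]
  congr 2
  refine Finset.sum_congr rfl fun z hz => ?_
  rw [h2, hmk z (Finset.mem_range.1 hz)]

theorem samplePot_nonneg (hlim : ∑ c ∈ Finset.range M, a c ≤ 2 * W) :
    0 ≤ samplePot N M s W lim R a mk cnt := by
  rw [samplePot]
  refine add_nonneg (div_nonneg (add_nonneg (Nat.cast_nonneg _) (sub_nonneg.2 ?_))
    (Nat.cast_nonneg _)) ?_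
  · rcases Nat.eq_zero_or_pos W with h | h
    · simp [h]
    · have hW : (0 : ℝ) < W := by exact_mod_cast h
      calc (s : ℝ) / W * ∑ c ∈ Finset.range M, a c ≤ s / W * (2 * W) := by gcongr
        _ = 2 * s := by field_simp
  · split_ifs
    · refine Finset.sum_nonneg fun z _ => ?_
      split_ifs <;> positivity
    · exact le_rfl

/-- A full sample gains no candidate and its second summand is switched off. Further mass only
lowers the first summand. -/
theorem samplePot_step_full {c : ℕ} (hc : c < M) {δ : ℝ} (hδ : 0 ≤ δ)
    (ha : ∀ c' < M, a' c' = a c' + if c' = c then δ else 0) (hcnt : lim ≤ cnt) :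
    samplePot N M s W lim R a' mk cnt ≤ samplePot N M s W lim R a mk cnt := by
  rw [samplePot, samplePot, sum_add_single hc ha, if_neg (by omega), if_neg (by omega)]
  gcongr
  linarith

theorem one_sub_min_one_le_exp_neg (x : ℝ) : 1 - min 1 x ≤ Real.exp (-x) := by
  rcases le_total 1 x with h | h
  · rw [min_eq_left h, sub_self]; exact (Real.exp_pos _).le
  · rw [min_eq_right h]; linarith [Real.add_one_le_exp (-x)]

open Classical in
/-- Sampling a candidate does not increase the expected potential. -/
theorem samplePot_step {c : ℕ} (hc : c < M) {δ : ℝ} (hδ : 0 ≤ δ)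
    (ha : ∀ c' < M, a' c' = a c' + if c' = c then δ else 0)
    (hmk : ∀ z < N, mk' z = if R z c then 1 else mk z) (hcnt : cnt < lim) {p : ℝ}
    (hp : p = min 1 (s / W * δ)) :
    p * samplePot N M s W lim R a' mk' (cnt + 1) + (1 - p) * samplePot N M s W lim R a' mk cnt ≤
      samplePot N M s W lim R a mk cnt := by
  have hx : 0 ≤ (s : ℝ) / W * δ := by positivity
  have hp0 : 0 ≤ p := by rw [hp]; exact le_min zero_le_one hx
  have hp1 : p ≤ 1 := by rw [hp]; exact min_le_left _ _
  have hpx : p ≤ s / W * δ := by rw [hp]; exact min_le_right _ _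
  have hlim : (0 : ℝ) < lim := by exact_mod_cast (by omega : 0 < lim)
  set f : ℕ → ℝ := fun z => if mk z = 0 then
    Real.exp (s / W * massAt M R a z) / (4 * (N + 1)) else 0 with hf
  set f' : ℕ → ℝ := fun z => if mk' z = 0 then
    Real.exp (s / W * massAt M R a' z) / (4 * (N + 1)) else 0 with hf'
  set g : ℕ → ℝ := fun z => if mk z = 0 then
    Real.exp (s / W * massAt M R a' z) / (4 * (N + 1)) else 0 with hg
  have hf'0 : 0 ≤ ∑ z ∈ Finset.range N, f' z := Finset.sum_nonneg fun z _ => by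
    simp only [hf']; split_ifs <;> positivity
  have hsum : p * (∑ z ∈ Finset.range N, f' z) + (1 - p) * ∑ z ∈ Finset.range N, g z ≤
      ∑ z ∈ Finset.range N, f z := by
    rw [Finset.mul_sum, Finset.mul_sum, ← Finset.sum_add_distrib]
    refine Finset.sum_le_sum fun z hz => ?_
    simp only [hf, hf', hg, hmk z (Finset.mem_range.1 hz), massAt_add_single hc ha]
    by_cases hz0 : mk z = 0
    · by_cases hR : R z c
      · have hexp : Real.exp (s / W * (massAt M R a z + δ)) =
            Real.exp (s / W * massAt M R a z) * Real.exp (s / W * δ) := by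
          rw [mul_add, Real.exp_add]
        simp only [hz0, hR, if_true, one_ne_zero, if_false, mul_zero, zero_add, hexp]
        -- The exponential of an uncovered element grows by the factor `exp x`, but it survives only
        -- if the candidate is not sampled, with probability `1 - min 1 x ≤ exp (-x)`.
        have h1 : (1 - p) * Real.exp (s / W * δ) ≤ 1 := by
          calc (1 - p) * Real.exp (s / W * δ) ≤
                Real.exp (-(s / W * δ)) * Real.exp (s / W * δ) := by
                gcongr; rw [hp]; exact one_sub_min_one_le_exp_neg _
            _ = 1 := by rw [← Real.exp_add]; simp
        have h2 : 0 ≤ Real.exp (s / W * massAt M R a z) / (4 * (N + 1)) := by positivity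
        calc (1 - p) * (Real.exp (s / W * massAt M R a z) * Real.exp (s / W * δ) / (4 * (N + 1)))
            = ((1 - p) * Real.exp (s / W * δ)) *
              (Real.exp (s / W * massAt M R a z) / (4 * (N + 1))) := by ring
          _ ≤ 1 * _ := by gcongr
          _ = _ := one_mul _
      · simp only [hz0, hR, if_true, if_false, add_zero]
        exact le_of_eq (by ring)
    · by_cases hR : R z c <;> simp [hz0, hR]
  have hite : (if cnt + 1 < lim then ∑ z ∈ Finset.range N, f' z else 0) ≤
      ∑ z ∈ Finset.range N, f' z := by
    split_ifs
    · exact le_rfl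
    · exact hf'0
  rw [samplePot, samplePot, samplePot, sum_add_single hc ha, if_pos hcnt, if_pos hcnt]
  push_cast
  -- The expected growth of the sample is at most `s / W * δ`, exactly what the mass term gives
  -- back.
  have h3 : p * (((cnt : ℝ) + 1 + (2 * s - s / W * (∑ c ∈ Finset.range M, a c + δ))) / lim) +
      (1 - p) * ((cnt + (2 * s - s / W * (∑ c ∈ Finset.range M, a c + δ))) / lim) ≤
      (cnt + (2 * s - s / W * ∑ c ∈ Finset.range M, a c)) / lim := by
    rw [← mul_div_assoc, ← mul_div_assoc, ← add_div]
    refine div_le_div_of_nonneg_right ?_ hlim.le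
    nlinarith
  have h4 := mul_le_mul_of_nonneg_left hite hp0
  calc _ = (p * (((cnt : ℝ) + 1 + (2 * s - s / W * (∑ c ∈ Finset.range M, a c + δ))) / lim) +
      (1 - p) * ((cnt + (2 * s - s / W * (∑ c ∈ Finset.range M, a c + δ))) / lim)) +
      (p * (if cnt + 1 < lim then ∑ z ∈ Finset.range N, f' z else 0) +
        (1 - p) * ∑ z ∈ Finset.range N, g z) := by ring
    _ ≤ _ := add_le_add h3 ((add_le_add h4 le_rfl).trans hsum)

/-- Both summands are at most `1/4`: the first is `2s / (8s)`, and the second has at most `N` terms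
`1 / (4 (N + 1))`. -/
theorem samplePot_start (hlim : lim = 8 * s) (ha : ∀ c < M, a c = 0) :
    samplePot N M s W lim R a mk 0 ≤ 1 / 2 := by
  classical
  have h1 : ∑ c ∈ Finset.range M, a c = 0 :=
    Finset.sum_eq_zero fun c hc => ha c (Finset.mem_range.1 hc)
  have h2 : ∀ z, massAt M R a z = 0 := fun z => Finset.sum_eq_zero fun c hc => by
    rw [ha c (Finset.mem_range.1 hc)]; simp
  have h3 : ((0 : ℕ) + (2 * (s : ℝ) - s / W * 0)) / lim ≤ 1 / 4 := by
    rw [hlim]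
    push_cast
    rcases Nat.eq_zero_or_pos s with h | h
    · simp [h]
    · have : (0 : ℝ) < s := by exact_mod_cast h
      refine le_of_eq ?_
      field_simp
      ring
  have h4 : (if 0 < lim then ∑ z ∈ Finset.range N,
      if mk z = 0 then Real.exp (s / W * massAt M R a z) / (4 * (N + 1)) else 0 else 0) ≤
      (1 / 4 : ℝ) := by
    split_ifs
    · calc _ ≤ ∑ z ∈ Finset.range N, (1 / (4 * (N + 1)) : ℝ) := by
            refine Finset.sum_le_sum fun z _ => ?_
            split_ifs
            · simp [h2]
            · positivity
        _ = N * (1 / (4 * (N + 1))) := by simp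
        _ ≤ 1 / 4 := by
            rw [mul_one_div, div_le_div_iff₀ (by positivity) (by norm_num)]
            linarith
    · norm_num
  rw [samplePot, h1]
  linarith

/-- If an unmarked element is covered by a large mass, then the potential is at least `1`. -/
theorem one_le_samplePot {z : ℕ} (hz : z < N) (hmk : mk z = 0) (hlim0 : 0 < lim)
    (hlim : ∑ c ∈ Finset.range M, a c ≤ 2 * W)
    (hbig : 4 * (N + 1) ≤ Real.exp (s / W * massAt M R a z)) :
    1 ≤ samplePot N M s W lim R a mk cnt := by
  have hl : (0 : ℝ) < lim := by exact_mod_cast hlim0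
  have hfirst : (0 : ℝ) ≤ 2 * s - s / W * ∑ c ∈ Finset.range M, a c := by
    rw [sub_nonneg]
    rcases Nat.eq_zero_or_pos W with h | h
    · simp [h]
    · have hW : (0 : ℝ) < W := by exact_mod_cast h
      calc (s : ℝ) / W * ∑ c ∈ Finset.range M, a c ≤ s / W * (2 * W) := by gcongr
        _ = 2 * s := by field_simp
  rw [samplePot]
  -- If the sample is not full, the exponential of `z` alone reaches 1. If it is full, the first
  -- summand does.
  split_ifs with hcnt
  · have h1 : (0 : ℝ) ≤ (cnt + (2 * s - s / W * ∑ c ∈ Finset.range M, a c)) / lim := by positivity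
    have h2 : 1 ≤ ∑ z ∈ Finset.range N,
        if mk z = 0 then Real.exp (s / W * massAt M R a z) / (4 * (N + 1)) else 0 := by
      refine le_trans ?_ (Finset.single_le_sum (f := fun z => if mk z = 0 then
        Real.exp (s / W * massAt M R a z) / (4 * (N + 1)) else 0) (fun z _ => ?_)
        (Finset.mem_range.2 hz))
      · simp only [hmk, if_true]
        rw [le_div_iff₀ (by positivity)]
        linarith
      · split_ifs <;> positivity
    linarith
  · rw [add_zero, le_div_iff₀ hl]
    have : (lim : ℝ) ≤ cnt := by exact_mod_cast not_lt.1 hcnt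
    linarith

/-- The average over the random choices. -/
theorem sum_fin_ite {N a : ℕ} (hN : 0 < N) {x y : ℝ} (hx : 0 ≤ x) (hy : 0 ≤ y) :
    ∑ v : Fin N, ((N : ℕ) : ℝ≥0∞)⁻¹ *
      (if (v : ℕ) < a then ENNReal.ofReal y else ENNReal.ofReal x) =
    ENNReal.ofReal (min 1 (a / N : ℝ) * y + (1 - min 1 (a / N : ℝ)) * x) := by
  have hN' : (0 : ℝ) < N := by exact_mod_cast hN
  have hinv : ((N : ℕ) : ℝ≥0∞)⁻¹ = ENNReal.ofReal (N : ℝ)⁻¹ := by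
    rw [ENNReal.ofReal_inv_of_pos hN', ENNReal.ofReal_natCast]
  have hterm : ∀ v : Fin N, ((N : ℕ) : ℝ≥0∞)⁻¹ *
      (if (v : ℕ) < a then ENNReal.ofReal y else ENNReal.ofReal x) =
      ENNReal.ofReal ((N : ℝ)⁻¹ * if (v : ℕ) < a then y else x) := by
    intro v
    rw [hinv, ENNReal.ofReal_mul (by positivity)]
    congr 1
    split_ifs <;> rfl
  rw [Finset.sum_congr rfl fun v _ => hterm v, ← ENNReal.ofReal_sum_of_nonneg fun v _ => by
    split_ifs <;> positivity]
  congr 1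
  rw [← Finset.mul_sum, Finset.sum_fin_eq_sum_range]
  have h1 : ∑ i ∈ Finset.range N, (if h : i < N then (if i < a then y else x) else 0) =
      ∑ i ∈ Finset.range N, (x + if i < min a N then y - x else 0) := by
    refine Finset.sum_congr rfl fun i hi => ?_
    have hi' := Finset.mem_range.1 hi
    rw [dif_pos hi']
    by_cases hia : i < a
    · rw [if_pos hia, if_pos (lt_min hia hi')]; ring
    · rw [if_neg hia, if_neg fun h => hia (h.trans_le (min_le_left _ _))]; ring
  have h2 : ∑ i ∈ Finset.range N, (if i < min a N then y - x else 0) = (min a N : ℕ) * (y - x) := by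
    rw [← Finset.sum_filter]
    have : (Finset.range N).filter (· < min a N) = Finset.range (min a N) := by
      ext i; simp
    rw [this]; simp [mul_sub]
  rw [h1, Finset.sum_add_distrib, h2]
  have h3 : min 1 (a / N : ℝ) = (min a N : ℕ) / N := by
    rw [Nat.cast_min, ← min_div_div_right hN'.le, div_self hN'.ne', min_comm]
  rw [h3]
  simp only [Finset.sum_const, Finset.card_range, nsmul_eq_mul]
  field_simp
  ring

end Potential

/-! ## Counting the doublings -/

/-- If `H` contains a total of `a * K` doublings, then its weight is at least `2 ^ a * K`. -/
theorem two_pow_mul_le_sum {H : Finset ℕ} {e : ℕ → ℕ} {a K : ℕ} (hH : H.card ≤ K) (ha : 1 ≤ a)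
    (he : a * K ≤ ∑ c ∈ H, e c) : 2 ^ a * K ≤ ∑ c ∈ H, 2 ^ e c := by
  -- A linear lower bound for `2 ^ x` that is exact at `a`. Summing it avoids Jensen's inequality
  -- with a fractional mean.
  have hone : ∀ x : ℕ, (2 : ℤ) ^ a * (1 + (x - a)) ≤ 2 ^ x := by
    intro x
    rcases le_total a x with h | h
    · obtain ⟨r, rfl⟩ := Nat.exists_eq_add_of_le h
      have hr : (r : ℤ) + 1 ≤ 2 ^ r := by exact_mod_cast Nat.lt_two_pow_self
      rw [pow_add]
      have : (0 : ℤ) < 2 ^ a := by positivity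
      push_cast
      nlinarith
    · rcases h.lt_or_eq with h' | rfl
      · have h1 : (1 : ℤ) + (x - a) ≤ 0 := by omega
        have h2 : (0 : ℤ) < 2 ^ a := by positivity
        have h3 : (0 : ℤ) < 2 ^ x := by positivity
        nlinarith
      · simp
  have hsum : (2 : ℤ) ^ a * (∑ c ∈ H, (1 + ((e c : ℤ) - a))) ≤ ∑ c ∈ H, 2 ^ e c := by
    rw [Finset.mul_sum]
    exact Finset.sum_le_sum fun c _ => hone _
  have hval : ∑ c ∈ H, (1 + ((e c : ℤ) - a)) = H.card * (1 - a) + ∑ c ∈ H, (e c : ℤ) := by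
    rw [Finset.sum_add_distrib, Finset.sum_sub_distrib]
    simp
    ring
  have he' : (a : ℤ) * K ≤ ∑ c ∈ H, (e c : ℤ) := by exact_mod_cast he
  -- The coefficient `1 - a` is not positive, so the size of `H` may be replaced by `K`.
  have hK : (K : ℤ) ≤ H.card * (1 - a) + ∑ c ∈ H, (e c : ℤ) := by
    have h1 : (H.card : ℤ) ≤ K := by exact_mod_cast hH
    have h2 : (1 : ℤ) ≤ a := by exact_mod_cast ha
    nlinarith
  have : (2 : ℤ) ^ a * K ≤ ∑ c ∈ H, 2 ^ e c := by
    refine le_trans ?_ hsum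
    rw [hval]
    gcongr
  exact_mod_cast this

/-- The power with exponent `4K` is at most `e`, which is less than 4. -/
theorem one_add_inv_pow_le {K t l : ℕ} (hK : 0 < K) (ht : t ≤ 4 * l * K) :
    (1 + 1 / (4 * K : ℝ)) ^ t ≤ 4 ^ l := by
  have hK' : (0 : ℝ) < K := by exact_mod_cast hK
  have h1 : (1 : ℝ) ≤ 1 + 1 / (4 * K : ℝ) := by
    have : (0 : ℝ) ≤ 1 / (4 * K : ℝ) := by positivity
    linarith
  calc (1 + 1 / (4 * K : ℝ)) ^ t ≤ (1 + 1 / (4 * K : ℝ)) ^ (4 * l * K) := pow_le_pow_right₀ h1 ht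
    _ = ((1 + 1 / (4 * K : ℝ)) ^ (4 * K)) ^ l := by rw [← pow_mul]; ring_nf
    _ ≤ 4 ^ l := by
        refine pow_le_pow_left₀ (by positivity) ?_ _
        calc (1 + 1 / (4 * K : ℝ)) ^ (4 * K) ≤ (Real.exp (1 / (4 * K : ℝ))) ^ (4 * K) := by
              refine pow_le_pow_left₀ (by positivity) ?_ _
              linarith [Real.add_one_le_exp (1 / (4 * K : ℝ))]
          _ = Real.exp 1 := by
              rw [← Real.exp_nat_mul]; congr 1; push_cast; field_simp
          _ ≤ 4 := by linarith [Real.exp_one_lt_d9]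

/-- The square is at most 4. This is what keeps the weight within a factor of 2 during an epoch of
at most `K` doublings. -/
theorem one_add_inv_pow_le_two {K u : ℕ} (hK : 0 < K) (hu : u ≤ K) :
    (1 + 1 / (4 * K : ℝ)) ^ u ≤ 2 := by
  have hK' : (0 : ℝ) < K := by exact_mod_cast hK
  have h1 : (1 : ℝ) ≤ 1 + 1 / (4 * K : ℝ) := by
    have : (0 : ℝ) ≤ 1 / (4 * K : ℝ) := by positivity
    linarith
  have h2 : ((1 + 1 / (4 * K : ℝ)) ^ u) ^ 2 ≤ 2 ^ 2 := by
    calc ((1 + 1 / (4 * K : ℝ)) ^ u) ^ 2 = (1 + 1 / (4 * K : ℝ)) ^ (2 * u) := by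
          rw [← pow_mul]; ring_nf
      _ ≤ (1 + 1 / (4 * K : ℝ)) ^ (4 * 1 * K) := pow_le_pow_right₀ h1 (by omega)
      _ ≤ 4 ^ 1 := one_add_inv_pow_le hK le_rfl
      _ = 2 ^ 2 := by norm_num
  exact le_of_sq_le_sq h2 (by norm_num)

/-- A guess that is large enough cannot exhaust its doublings. -/
theorem doublings_contradiction {m L l K W : ℕ} {H : Finset ℕ} {e : ℕ → ℕ} (hL : L = 2 ^ l)
    (hl : 1 ≤ l) (hK : K = 3 * (m / L + 1)) (hHM : H ⊆ Finset.range (m * L)) (hH : H.card ≤ K)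
    (he : 4 * l * K ≤ ∑ c ∈ H, e c) (hW : W = ∑ c ∈ Finset.range (m * L), 2 ^ e c)
    (hgrow : (W : ℝ) ≤ (m * L : ℕ) * (1 + 1 / (4 * K : ℝ)) ^ (4 * l * K)) : False := by
  have hLpos : 0 < L := hL ▸ by positivity
  have hKpos : 0 < K := by rw [hK]; positivity
  have h1 := two_pow_mul_le_sum hH (show 1 ≤ 4 * l by omega) he
  have h2 : 2 ^ (4 * l) * K ≤ W := h1.trans (hW ▸ Finset.sum_le_sum_of_subset hHM)
  have h3 : ((2 ^ (4 * l) * K : ℕ) : ℝ) ≤ ((m * L * 4 ^ l : ℕ) : ℝ) := by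
    calc ((2 ^ (4 * l) * K : ℕ) : ℝ) ≤ W := by exact_mod_cast h2
      _ ≤ _ := hgrow
      _ ≤ (m * L : ℕ) * 4 ^ l := by gcongr; exact one_add_inv_pow_le hKpos le_rfl
      _ = _ := by push_cast; ring
  have h4 : 2 ^ (4 * l) * K ≤ m * L * 4 ^ l := by exact_mod_cast h3
  have h5 : 2 ^ (4 * l) = L * L * 4 ^ l := by
    rw [hL, show (4 : ℕ) = 2 ^ 2 by norm_num, ← pow_mul, ← pow_add, ← pow_add]; congr 1; ring
  rw [h5] at h4
  -- Since `2 ^ (4l) = L * L * 4 ^ l`, the two bounds on the weight leave `L * K ≤ m`, whereas `K =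
  -- 3 (m / L + 1)` exceeds `3m / L` over the reals.
  have h6 : L * K ≤ m := by
    have : (L * K) * (L * 4 ^ l) ≤ m * (L * 4 ^ l) := by linarith
    exact Nat.le_of_mul_le_mul_right this (by positivity)
  have h7 : m < L * (m / L + 1) := Nat.lt_mul_div_succ m hLpos
  have h8 : L * K = 3 * (L * (m / L + 1)) := by rw [hK]; ring
  omega

end Subtraj

namespace Subtraj

open RealRAM

variable {d n m : ℕ} {P : PolygonalCurve d n} {T : Breakpoints m} {Δ : ℝ} {S : Limits}

/-! ## Adding a center to the output -/

theorem NExp.eval_congr {σ τ : Mem} (h : τ.ints = σ.ints) (x : NExp) : x.eval τ = x.eval σ := by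
  induction x with
  | lit c => rfl
  | get a i ih => simp [NExp.eval, ih, h]
  | add x y ihx ihy => simp [NExp.eval, ihx, ihy]
  | sub x y ihx ihy => simp [NExp.eval, ihx, ihy]
  | mul x y ihx ihy => simp [NExp.eval, ihx, ihy]
  | div x y ihx ihy => simp [NExp.eval, ihx, ihy]

/-- Writes the first coordinates of breakpoint `x` to row `row` of the output. -/
def writeP (d : ℕ) (row x : NExp) : ℕ → Prog
  | 0 => .skip
  | c + 1 => .seq (writeP d row x c) (.setReal 4 (.add (.mul row (.lit d)) (.lit c)) (bcoord d x c))

theorem writesI_writeP {row x : NExp} (a c : ℕ) : ¬ writesI (writeP d row x c) a := by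
  induction c with
  | zero => simp [writeP, writesI]
  | succ c ih => simp [writeP, writesI, ih]

theorem writesR_writeP {row x : NExp} {a c : ℕ} (h : writesR (writeP d row x c) a) : a = 4 := by
  induction c with
  | zero => simp [writeP, writesR] at h
  | succ c ih =>
    rcases h with h | h
    · exact ih h
    · exact h

variable (P T) in
/-- Row `row` of the output holds breakpoint `x`. -/
def RowIs (σ : Mem) (row x : ℕ) : Prop :=
  ∀ c (h : c < d), σ.reals 4 (row * d + c) = bpt P T x ⟨c, h⟩

theorem writeP_runs {σ : Mem} (hσ : S.Safe σ) (hin : HasInput P T Δ σ) {row x : NExp} {r w : ℕ}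
    (hr : row.eval σ = r) (hx : x.eval σ = w) (he : EdgeAt P T σ w) (ha : 4 < S.arrays)
    (hlen : r * d + d ≤ S.len) {c : ℕ} (hc : c ≤ d) :
    Runs S (writeP d row x c) σ (2 * c + 1) fun τ =>
      (∀ c' (h : c' < d), c' < c → τ.reals 4 (r * d + c') = bpt P T w ⟨c', h⟩) ∧
        ∀ i < r * d, τ.reals 4 i = σ.reals 4 i := by
  induction c with
  | zero => exact Runs.skip hσ ⟨fun _ _ h => absurd h (Nat.not_lt_zero _), fun _ _ => rfl⟩
  | succ c ih =>
    refine (Runs.seq (T' := 1) (ih (by omega)) fun τ hτ hf h => ?_).le (by omega)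
    have hi : τ.ints = σ.ints := funext fun a => hf.ints a (writesI_writeP a c)
    have hinτ : HasInput P T Δ τ := hin.frame hf (writesI_writeP 0 c)
      fun a ha h => by have := writesR_writeP h; omega
    have hrτ : row.eval τ = r := by rw [NExp.eval_congr hi, hr]
    have hxτ : x.eval τ = w := by rw [NExp.eval_congr hi, hx]
    have hcoord := hinτ.describes_bcoord hxτ (by rwa [EdgeAt, hi]) c (by omega)
    refine Runs.setReal ?_ ?_
    · simp only [NExp.eval, hrτ]
      exact hτ.setReal ha (by omega)
    · simp only [NExp.eval, hrτ, setReal_reals_self, hcoord]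
      refine ⟨fun c' h' hc' => ?_, fun i hi => ?_⟩
      · rcases Nat.lt_succ_iff_lt_or_eq.1 hc' with h1 | rfl
        · rw [Function.update_of_ne (by omega)]; exact h.1 c' h' h1
        · simp
      · rw [Function.update_of_ne (by omega)]; exact h.2 i hi

/-- Adds candidate `x`, given by its first and last breakpoints, to the output. -/
def pushP (d : ℕ) (x y : NExp) : Prog :=
  .seq (writeP d (.mul (.lit 2) (var 1)) x d) (.seq
    (writeP d (.add (.mul (.lit 2) (var 1)) (.lit 1)) y d)
    (.setInt 1 (.lit 0) (.add (var 1) (.lit 1))))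

theorem writesI_pushP {x y : NExp} (a : ℕ) : writesI (pushP d x y) a ↔ a = 1 := by
  simp [pushP, writesI, writesI_writeP]

theorem writesR_pushP {x y : NExp} {a : ℕ} (h : writesR (pushP d x y) a) : a = 4 := by
  rcases h with h | h | h
  · exact writesR_writeP h
  · exact writesR_writeP h
  · exact h.elim

variable (P T) in
/-- Center `r` of the output is the segment from breakpoint `i` to breakpoint `j`. -/
def CenterIs (σ : Mem) (r i j : ℕ) : Prop := RowIs P T σ (2 * r) i ∧ RowIs P T σ (2 * r + 1) j

theorem pushP_runs {σ : Mem} (hσ : S.Safe σ) (hin : HasInput P T Δ σ) {x y : NExp} {i j r : ℕ}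
    (hx : x.eval σ = i) (hy : y.eval σ = j) (hi : EdgeAt P T σ i) (hj : EdgeAt P T σ j)
    (hr : σ.ints 1 0 = r) (ha : 4 < S.arrays) (hlen : (2 * r + 2) * d + 1 ≤ S.len)
    (hw : r + 1 ≤ S.word) :
    Runs S (pushP d x y) σ (4 * d + 5) fun τ => τ.ints 1 = Function.update (σ.ints 1) 0 (r + 1) ∧
      CenterIs P T τ r i j ∧
      ∀ r' < r, ∀ i' j', CenterIs P T σ r' i' j' → CenterIs P T τ r' i' j' := by
  refine (Runs.seq (writeP_runs hσ hin (r := 2 * r) (by simp [NExp.eval, hr]) hx hi ha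
    (by nlinarith) le_rfl) fun τ hτ hf h => Runs.seq (writeP_runs (r := 2 * r + 1) (w := j) (P := P)
      (T := T) (Δ := Δ) hτ ?_ ?_ ?_ ?_ ha (by nlinarith) le_rfl) fun ρ hρ hf' h' =>
      Runs.setInt ?_ ?_).le (by omega)
  · exact hin.frame hf (writesI_writeP 0 d) fun a ha h => by have := writesR_writeP h; omega
  · simp [NExp.eval, hf.ints 1 (writesI_writeP 1 d), hr]
  · rw [NExp.eval_congr (funext fun a => hf.ints a (writesI_writeP a d)), hy]
  · rwa [EdgeAt, hf.ints 5 (writesI_writeP 5 d)]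
  · have h1 : ρ.ints 1 = σ.ints 1 := by
      rw [hf'.ints 1 (writesI_writeP 1 d), hf.ints 1 (writesI_writeP 1 d)]
    simp only [NExp.eval, h1, hr]
    exact hρ.setInt (by omega) (by omega) hw
  · have h1 : ρ.ints 1 = σ.ints 1 := by
      rw [hf'.ints 1 (writesI_writeP 1 d), hf.ints 1 (writesI_writeP 1 d)]
    simp only [NExp.eval, h1, hr, setInt_ints_self, CenterIs, RowIs, setInt_reals]
    refine ⟨trivial, ⟨fun c hc => ?_, fun c hc => h'.1 c hc hc⟩, fun r' hr' i' j' hc => ?_⟩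
    · rw [h'.2 _ (by rw [add_mul]; omega)]; exact h.1 c hc hc
    · have hle : (2 * r' + 1) * d + d ≤ 2 * r * d := by
        rw [← Nat.succ_mul]; exact Nat.mul_le_mul_right _ (by omega)
      have hle' : 2 * r' * d + d ≤ 2 * r * d := by
        rw [← Nat.succ_mul]; exact Nat.mul_le_mul_right _ (by omega)
      have hle2 : (2 * r + 1) * d = 2 * r * d + d := Nat.succ_mul _ _
      refine ⟨fun c hcd => ?_, fun c hcd => ?_⟩
      · rw [h'.2 _ (by omega), h.2 _ (by omega)]; exact hc.1 c hcd
      · rw [h'.2 _ (by omega), h.2 _ (by omega)]; exact hc.2 c hcd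

variable (P T Δ) in
/-- Every marked element is covered by a center in the output. -/
def Sound (σ : Mem) : Prop :=
  ∀ z < m - 1, σ.ints 10 z ≠ 0 → ∃ r < σ.ints 1 0, ∃ i j, CenterIs P T σ r i j ∧ Covered P T Δ z i j

/-- Adds the candidate in variable `2` to the output and marks the elements that it covers. -/
def addP (d : ℕ) : Prog :=
  .seq (pushP d (candStart (var 2)) (candEnd (var 2))) (forP 3 (.sub mE (.lit 1))
    (.ite (hitsB (.add (var 3) (.lit 1)) (var 2)) (.setInt 10 (var 3) (.lit 1)) .skip))

theorem writesI_addP (a : ℕ) : writesI (addP d) a ↔ a = 1 ∨ a = 3 ∨ a = 10 := by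
  simp [addP, writesI, writesI_forP, writesI_pushP]

theorem writesR_addP {a : ℕ} (h : writesR (addP d) a) : a = 4 := by
  rcases h with h | h
  · exact writesR_pushP h
  · simp [writesR_forP, writesR] at h

theorem div_lt_of_lt_mul {m L c : ℕ} (hc : c < m * L) : c / L < m :=
  Nat.div_lt_of_lt_mul (by rwa [mul_comm])

open Classical in
theorem addP_runs (hS : Ample S d n m) {σ : Mem} (hσ : S.Safe σ) (hR : Ready P T Δ σ) {L c r : ℕ}
    (hL : σ.ints 11 0 = L) (hc : σ.ints 2 0 = c) (hcM : c < m * L) (hr : σ.ints 1 0 = r)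
    (hrm : r ≤ 500 * m) (hsound : Sound P T Δ σ) :
    Runs S (addP d) σ (4 * d + 5 * m + 10) fun τ => τ.ints 1 0 = r + 1 ∧ Sound P T Δ τ ∧
      ∀ z < m - 1, τ.ints 10 z = if Hits P T Δ L z c then 1 else σ.ints 10 z := by
  have hA := hS.arrays
  have hm := hS.two_le
  have hcL : c / L < m := div_lt_of_lt_mul hcM
  have hlen : (2 * r + 2) * d + 1 ≤ S.len := by
    refine le_trans ?_ hS.len
    calc (2 * r + 2) * d + 1 ≤ (2 * (500 * m) + 2) * d + 1 := by gcongr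
      _ ≤ 3000 * m * (d + 1) := by nlinarith
      _ ≤ 3000 * (d + 1) * m ^ 2 := by nlinarith [Nat.zero_le (d * m)]
  refine (Runs.seq (pushP_runs hσ hR.input (i := c / L) (j := min (c / L + 1 + c % L) (m - 1))
    (candStart_eval hL (by simp [NExp.eval, hc])) (candEnd_eval hR.input.mE hL
    (by simp [NExp.eval, hc])) (hR.edge _ hcL) (hR.edge _ (by omega)) hr (by omega) hlen
    (hS.le_word' (by omega))) fun τ hτ hf h => (Runs.forP (m - 1)
      (fun j ρ => ∀ z < m - 1, ρ.ints 10 z =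
        if z < j ∧ Hits P T Δ L z c then 1 else σ.ints 10 z) hτ (by omega)
      hS.len_pos (hS.le_word' (by omega)) (fun ρ hf' => ?_) (by simp [writesI]) ?_ ?_
      (T := 2)).mono (T' := 5 * m + 3) (by omega) ?_).le (by omega)
  · simp [NExp.eval, hf'.ints 0 (by simp [writesI, writesI_forP]),
      hf.ints 0 (by simp [writesI_pushP]), hR.input.mE]
  · intro z hz
    simp [setInt_ints_ne, hf.ints 10 (by simp [writesI_pushP])]
  · intro j hj ρ hρ hf' hv hI
    have hRτ : Ready P T Δ τ := hR.frame hf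
      (by rintro a (rfl | rfl | rfl | rfl) <;> simp [writesI_pushP])
      fun a ha h => by have := writesR_pushP h; omega
    have hRρ : Ready P T Δ ρ := hRτ.frame hf'
      (by rintro a (rfl | rfl | rfl | rfl) <;> simp [writesI, writesI_forP])
      fun a ha h => by simp [writesR, writesR_forP] at h
    have hρ : ∀ a, a ≠ 3 → a ≠ 10 → a ≠ 1 → ρ.ints a = σ.ints a := fun a h1 h2 h3 => by
      rw [hf'.ints a (by simp [writesI, writesI_forP, h1, h2]),
        hf.ints a (by simp [writesI_pushP, h3])]
    have hb := hRρ.hitsB_eval (z := .add (var 3) (.lit 1)) (c := var 2) (z' := j) (c' := c) (L := L)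
      (by rw [hρ 11 (by simp) (by simp) (by simp), hL]) (by simp [NExp.eval, hv])
      (by simp [NExp.eval, hρ 2, hc]) (by omega) hcM
    refine Runs.ite (T := 1) (T' := 1) (fun h => ?_) fun h => ?_
    · rw [hb] at h
      refine Runs.setInt ?_ fun z hz => ?_
      · simp only [NExp.eval, hv]
        exact Limits.Safe.setInt ‹_› (by omega) (hS.index_lt_len (by omega)) (hS.le_word' (by omega))
      · simp only [NExp.eval, hv, setInt_ints_ne _ _ _ (show (10 : ℕ) ≠ 3 by norm_num),
          setInt_ints_self, Function.update_apply, hI z hz]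
        by_cases hzj : z = j
        · subst hzj; simp [h]
        · have : z < j + 1 ↔ z < j := by omega
          simp [hzj, this]
    · rw [hb] at h
      refine Runs.skip ‹_› fun z hz => ?_
      simp only [setInt_ints_ne _ _ _ (show (10 : ℕ) ≠ 3 by norm_num), hI z hz]
      by_cases hzj : z = j
      · subst hzj; simp [h]
      · have : z < j + 1 ↔ z < j := by omega
        simp [this]
  · intro ρ hρ hf' hI
    have h1 : ρ.ints 1 0 = r + 1 := by
      rw [hf'.ints 1 (by simp [writesI, writesI_forP]), h.1]; simp
    have hcen : ∀ r' i j, CenterIs P T τ r' i j → CenterIs P T ρ r' i j := fun r' i j hh => by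
      simpa only [CenterIs, RowIs, hf'.reals 4 (by simp [writesR, writesR_forP])] using hh
    refine ⟨h1, fun z hz hmk => ?_, fun z hz => ?_⟩
    · rw [hI z hz] at hmk
      by_cases hh : Hits P T Δ L z c
      · exact ⟨r, by omega, _, _, hcen _ _ _ h.2.1, hh⟩
      · rw [if_neg fun h => hh h.2] at hmk
        obtain ⟨r', hr', i, j, h2, h3⟩ := hsound z hz hmk
        exact ⟨r', by omega, i, j, hcen _ _ _ (h.2.2 r' (by omega) i j h2), h3⟩
    · rw [hI z hz]; simp [hz]

end Subtraj

namespace Subtraj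

open RealRAM

variable {d n m : ℕ} {P : PolygonalCurve d n} {T : Breakpoints m} {Δ : ℝ} {S : Limits}

/-! ## Sampling candidates -/

/-- The number of candidates. -/
abbrev candN : NExp := .mul mE (var 11)

/-- The sampling rate. -/
abbrev rateE : NExp := .mul (.mul (.lit 4) (var 14)) (.add (var 13) (.lit 2))

/-- The maximal size of the sample. -/
abbrev limE : NExp := .mul (.lit 8) rateE

/-- Selects all candidates if variable `19` is `1`, and those that cover element `z - 1` for `z` in
variable `21` otherwise. -/
def selB : BExp :=
  .not (.and (.not (.natLE (.lit 1) (var 19))) (.not (hitsB (var 21) (var 2))))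

/-- Adds the candidate in variable `2` if the random number in variable `23` says so, and doubles
its weight unless variable `19` is `1`. -/
def decideP (d : ℕ) : Prog :=
  .seq (.ite (.and (.natLE (.add (var 23) (.lit 1)) (.mul rateE (.get 9 (var 2))))
      (.natLE (.add (var 1) (.lit 1)) limE)) (addP d) .skip)
    (.setInt 9 (var 2) (.mul (.get 9 (var 2)) (.sub (.lit 2) (var 19))))

/-- Samples from the selected candidates, and doubles their weights unless variable `19` is `1`. -/
def passP (d : ℕ) : Prog :=
  forP 2 candN (.ite selB
    (.seq (.rand 23 (.lit 0) (.sub (var 16) (.lit 1))) (decideP d)) .skip)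

theorem writesI_decideP (a : ℕ) : writesI (decideP d) a ↔ a = 1 ∨ a = 3 ∨ a = 10 ∨ a = 9 := by
  simp [decideP, writesI, writesI_addP]; tauto

theorem writesR_decideP {a : ℕ} (h : writesR (decideP d) a) : a = 4 := by
  rcases h with (h | h) | h
  · exact writesR_addP h
  · exact h.elim
  · exact h.elim

theorem writesI_passP (a : ℕ) :
    writesI (passP d) a ↔ a = 2 ∨ a = 23 ∨ a = 1 ∨ a = 3 ∨ a = 10 ∨ a = 9 := by
  simp [passP, writesI_forP, writesI, writesI_decideP]

theorem writesR_passP {a : ℕ} (h : writesR (passP d) a) : a = 4 := by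
  rw [passP, writesR_forP] at h
  rcases h with (h | h) | h
  · exact h.elim
  · exact writesR_decideP h
  · exact h.elim

/-- The variables that are constant while candidates are sampled. -/
structure Setting (σ : Mem) (L lg K W fr z : ℕ) : Prop where
  len : σ.ints 11 0 = L
  log : σ.ints 13 0 = lg
  opt : σ.ints 14 0 = K
  weight : σ.ints 16 0 = W
  fresh : σ.ints 19 0 = fr
  elem : σ.ints 21 0 = z + 1

theorem Setting.of_ints_eq {σ τ : Mem} {L lg K W fr z : ℕ} (h : Setting σ L lg K W fr z)
    (hτ : ∀ a, 11 ≤ a → a ≤ 21 → τ.ints a = σ.ints a) : Setting τ L lg K W fr z :=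
  ⟨by rw [hτ 11 (by simp) (by simp), h.len], by rw [hτ 13 (by simp) (by simp), h.log],
    by rw [hτ 14 (by simp) (by simp), h.opt], by rw [hτ 16 (by simp) (by simp), h.weight],
    by rw [hτ 19 (by simp) (by simp), h.fresh], by rw [hτ 21 (by simp) (by simp), h.elem]⟩

/-- The state after the decision on candidate `j`. -/
structure Decided (P : PolygonalCurve d n) (T : Breakpoints m) (Δ : ℝ) (fr j r : ℕ)
    (mk : ℕ → ℕ) (σ τ : Mem) : Prop where
  sound : Sound P T Δ τ
  count : τ.ints 1 0 = r
  marks : ∀ z < m - 1, τ.ints 10 z = mk z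
  weights : τ.ints 9 = Function.update (σ.ints 9) j (σ.ints 9 j * (2 - fr))

section Decide

variable {σ : Mem} {L lg K W fr z j r : ℕ}

theorem Sound.of_eq {σ τ : Mem} (h : Sound P T Δ σ) (h1 : τ.ints 1 = σ.ints 1)
    (h10 : τ.ints 10 = σ.ints 10) (h4 : τ.reals 4 = σ.reals 4) : Sound P T Δ τ := by
  simpa only [Sound, h1, h10, CenterIs, RowIs, h4] using h

open Classical in
theorem decideP_runs_add (hS : Ample S d n m) (hσ : S.Safe σ) (hR : Ready P T Δ σ)
    (hset : Setting σ L lg K W fr z) (hj : σ.ints 2 0 = j) (hjM : j < m * L)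
    (hML : m * L ≤ 2 * m ^ 2)
    (hr : σ.ints 1 0 = r) (hrm : r ≤ 500 * m) (hw : σ.ints 9 j * (2 - fr) ≤ S.word)
    (hsound : Sound P T Δ σ) (hcoin : σ.ints 23 0 < 4 * K * (lg + 2) * σ.ints 9 j)
    (hlim : r < 8 * (4 * K * (lg + 2))) :
    Runs S (decideP d) σ (4 * d + 5 * m + 13) (Decided P T Δ fr j (r + 1)
      (fun z => if Hits P T Δ L z j then 1 else σ.ints 10 z) σ) := by
  have hA := hS.arrays
  refine (Runs.seq (Runs.ite (T := 4 * d + 5 * m + 10) (T' := 0)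
    (fun _ => addP_runs hS hσ hR hset.len hj hjM hr hrm hsound) fun h => absurd ?_ h)
    fun τ hτ hf h => Runs.setInt ?_ ?_).le (by omega)
  · simp only [BExp.eval, NExp.eval, hset.log, hset.opt, hj, hr]
    exact ⟨hcoin, hlim⟩
  · have hi : ∀ a, a ≠ 1 → a ≠ 3 → a ≠ 10 → τ.ints a = σ.ints a := fun a h1 h2 h3 =>
      hf.ints a (by simp [writesI, writesI_addP, h1, h2, h3])
    simp only [NExp.eval, hi 2 (by simp) (by simp) (by simp), hi 9 (by simp) (by simp) (by simp),
      hi 19 (by simp) (by simp) (by simp), hj, hset.fresh]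
    exact hτ.setInt (by omega) (hS.lt_len (by omega)) hw
  · have hi : ∀ a, a ≠ 1 → a ≠ 3 → a ≠ 10 → τ.ints a = σ.ints a := fun a h1 h2 h3 =>
      hf.ints a (by simp [writesI, writesI_addP, h1, h2, h3])
    simp only [NExp.eval, hi 2 (by simp) (by simp) (by simp), hi 9 (by simp) (by simp) (by simp),
      hi 19 (by simp) (by simp) (by simp), hj, hset.fresh]
    refine ⟨h.2.1.of_eq (setInt_ints_ne _ _ _ (by norm_num)) (setInt_ints_ne _ _ _ (by norm_num))
      rfl, ?_, fun z hz => ?_, ?_⟩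
    · rw [setInt_ints_ne _ _ _ (by norm_num), h.1]
    · rw [setInt_ints_ne _ _ _ (by norm_num), h.2.2 z hz]
    · rw [setInt_ints_self, hi 9 (by simp) (by simp) (by simp)]

theorem decideP_runs_skip (hS : Ample S d n m) (hσ : S.Safe σ)
    (hset : Setting σ L lg K W fr z) (hj : σ.ints 2 0 = j) (hjM : j < m * L)
    (hML : m * L ≤ 2 * m ^ 2)
    (hr : σ.ints 1 0 = r) (hw : σ.ints 9 j * (2 - fr) ≤ S.word) (hsound : Sound P T Δ σ)
    (hcoin : ¬ (σ.ints 23 0 < 4 * K * (lg + 2) * σ.ints 9 j ∧ r < 8 * (4 * K * (lg + 2)))) :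
    Runs S (decideP d) σ 4 (Decided P T Δ fr j r (σ.ints 10) σ) := by
  have hA := hS.arrays
  refine (Runs.seq (T := 2) (Runs.ite (T := 0) (T' := 1) (fun h => absurd ?_ hcoin)
    fun _ => Runs.skip (Q := fun τ => τ = σ) hσ rfl)
    fun τ hτ hf h => Runs.setInt ?_ ?_).le (by omega)
  · simp only [BExp.eval, NExp.eval, hset.log, hset.opt, hj, hr] at h
    exact h
  · subst h
    simp only [NExp.eval, hj, hset.fresh]
    exact hτ.setInt (by omega) (hS.lt_len (by omega)) hw
  · subst h
    simp only [NExp.eval, hj, hset.fresh]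
    refine ⟨hsound.of_eq (setInt_ints_ne _ _ _ (by norm_num)) (setInt_ints_ne _ _ _ (by norm_num))
      rfl, ?_, fun z hz => ?_, ?_⟩
    · rw [setInt_ints_ne _ _ _ (by norm_num), hr]
    · rw [setInt_ints_ne _ _ _ (by norm_num)]
    · rw [setInt_ints_self]

end Decide

variable (P T Δ) in
/-- The candidates that a pass selects. -/
def Sel (L fr z c : ℕ) : Prop := fr = 1 ∨ Hits P T Δ L z c

theorem selB_eval {σ : Mem} {L lg K W fr z c : ℕ} (hR : Ready P T Δ σ)
    (hset : Setting σ L lg K W fr z) (hfr : fr ≤ 1) (hz : fr = 0 → z < m) (hc : σ.ints 2 0 = c)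
    (hcM : c < m * L) : selB.eval σ ↔ Sel P T Δ L fr z c := by
  rw [Sel]
  by_cases h : fr = 1
  · simp [selB, BExp.eval, NExp.eval, hset.fresh, h]
  · have h0 : fr = 0 := by omega
    have := hR.hitsB_eval (z := var 21) (c := var 2) hset.len (z' := z) (c' := c)
      (by simp [NExp.eval, hset.elem]) (by simp [NExp.eval, hc]) (hz h0) hcM
    have hsel : selB.eval σ ↔
        ¬ (¬ (1 ≤ σ.ints 19 0) ∧ ¬ (hitsB (var 21) (var 2)).eval σ) := Iff.rfl
    rw [hsel, this, hset.fresh, h0]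
    simp

open Classical in
/-- The mass that was sampled before candidate `j`. -/
def massTo (Q : ℕ → Prop) (a : ℕ → ℝ) (w : ℕ → ℕ) (j c : ℕ) : ℝ :=
  a c + if c < j ∧ Q c then (w c : ℝ) else 0

set_option maxHeartbeats 1000000 in
open Classical in
-- The cost is bounded by a potential: 10 per scanned candidate, `C` per free place in the sample
-- for the possible addition of a candidate, `G` times `samplePot`, and `B` for what follows. The
-- coin of a selected candidate of weight `w` succeeds with probability `min 1 (s * w / W)`, as
-- `samplePot_step` requires. The mass `a` sampled earlier is 0 for a fresh sample, and is the old
-- weights when the increment of a doubling is sampled.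
theorem ert_passP_le (hS : Ample S d n m) {σ : Mem} (hσ : S.Safe σ) (hR : Ready P T Δ σ)
    {L lg K W fr z s lim : ℕ} (hset : Setting σ L lg K W fr z) (hfr : fr ≤ 1)
    (hz : fr = 0 → z < m) (hW : 1 ≤ W) (hs : s = 4 * K * (lg + 2)) (hlim : lim = 8 * s)
    (hlimm : lim ≤ 500 * m) (hML : m * L ≤ 2 * m ^ 2)
    (hw : ∀ c < m * L, σ.ints 9 c * (2 - fr) ≤ S.word) (hsound : Sound P T Δ σ)
    (hcnt : σ.ints 1 0 ≤ lim) {a : ℕ → ℝ}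
    (hmass : ∑ c ∈ Finset.range (m * L), massTo (Sel P T Δ L fr z) a (σ.ints 9) (m * L) c ≤ 2 * W)
    {B C G : ℝ} (hB : 0 ≤ B) (hC : (4 * d + 5 * m + 10 : ℝ) ≤ C) (hG : 0 ≤ G) {Φ : Mem → ℝ≥0∞}
    (hΦ : ∀ τ, S.Safe τ → Frame (passP d) σ τ → Sound P T Δ τ → τ.ints 1 0 ≤ lim →
      (∀ c < m * L, τ.ints 9 c = if Sel P T Δ L fr z c then σ.ints 9 c * (2 - fr)
        else σ.ints 9 c) →
      Φ τ ≤ ENNReal.ofReal (B + C * (lim - τ.ints 1 0) + G *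
        samplePot (m - 1) (m * L) s W lim (Hits P T Δ L)
          (massTo (Sel P T Δ L fr z) a (σ.ints 9) (m * L)) (τ.ints 10) (τ.ints 1 0))) :
    ert S (passP d) Φ σ ≤ ENNReal.ofReal (10 * (m * L : ℕ) + 4 + B + C * (lim - σ.ints 1 0) + G *
        samplePot (m - 1) (m * L) s W lim (Hits P T Δ L) a (σ.ints 10) (σ.ints 1 0)) := by
  have hA := hS.arrays
  have hm := hS.two_le
  have hC0 : 0 ≤ C := le_trans (by positivity) hC
  set M := m * L with hM
  set w := σ.ints 9 with hwdef
  set Q := Sel P T Δ L fr z with hQ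
  set pot := samplePot (m - 1) M s W lim (Hits P T Δ L) with hpot
  have hmono : ∀ j, ∑ c ∈ Finset.range M, massTo Q a w j c ≤ 2 * W := fun j => by
    refine le_trans (Finset.sum_le_sum fun c hc => ?_) hmass
    have hc' := Finset.mem_range.1 hc
    simp only [massTo]
    by_cases h : Q c
    · by_cases h' : c < j <;> simp [h, h', hc']
    · simp [h]
  have hpot0 : ∀ j mk r, 0 ≤ pot (massTo Q a w j) mk r := fun j mk r => samplePot_nonneg (hmono j)
  set I : ℕ → Mem → Prop := fun j τ => Sound P T Δ τ ∧ τ.ints 1 0 ≤ lim ∧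
    ∀ c < M, τ.ints 9 c = if c < j ∧ Q c then w c * (2 - fr) else w c with hI
  -- Only the candidates from `j` on remain to be paid for, and the mass of the earlier selected
  -- ones has entered the potential.
  set g : ℕ → Mem → ℝ≥0∞ := fun j τ => ENNReal.ofReal (10 * ((M : ℝ) - j) + 1 + B +
    C * (lim - τ.ints 1 0) + G * pot (massTo Q a w j) (τ.ints 10) (τ.ints 1 0)) with hg
  have hwI : ∀ b, writesI (passP d) b ↔ b = 2 ∨ b = 23 ∨ b = 1 ∨ b = 3 ∨ b = 10 ∨ b = 9 :=
    writesI_passP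
  refine (ert_forP_le M I g hσ (by omega) hS.len_pos (hS.le_word (by omega)) (fun τ hf => ?_)
    (by simp [writesI, writesI_decideP]) ⟨?_, ?_, ?_⟩ ?_ ?_).trans ?_
  · rw [← passP] at hf
    simp [NExp.eval, hf.ints 0 (by simp [hwI]), hf.ints 11 (by simp [hwI]), hR.input.mE, hset.len, hM]
  · exact hsound.of_eq (setInt_ints_ne _ _ _ (by norm_num)) (setInt_ints_ne _ _ _ (by norm_num)) rfl
  · rwa [setInt_ints_ne _ _ _ (by norm_num)]
  · intro c _
    simp [setInt_ints_ne, hwdef]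
  · intro j hj τ hτ hf hv hIj
    rw [← passP] at hf
    have hRτ : Ready P T Δ τ := hR.frame hf (by rintro a (rfl | rfl | rfl | rfl) <;> simp [hwI])
      fun a ha h => by have := writesR_passP h; omega
    have hsetτ : Setting τ L lg K W fr z := hset.of_ints_eq fun b h1 h2 =>
      hf.ints b (by rw [hwI]; omega)
    have hsel := selB_eval hRτ hsetτ hfr hz hv hj
    rw [← hQ] at hsel
    have hM1 : (1 : ℝ) ≤ (M : ℝ) - j := by
      have : (j : ℝ) + 1 ≤ M := by exact_mod_cast hj
      linarith
    have hcntR : (0 : ℝ) ≤ lim - τ.ints 1 0 := by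
      have : (τ.ints 1 0 : ℝ) ≤ lim := by exact_mod_cast hIj.2.1
      linarith
    have hwj : τ.ints 9 j = w j := by rw [hIj.2.2 j hj]; simp
    rw [ert]
    by_cases hQj : Q j
    · rw [if_pos (hsel.2 hQj), ert, ert]
      have hWe : (NExp.sub (var 16) (.lit 1)).eval τ = W - 1 := by
        simp [NExp.eval, hsetτ.weight]
      have hz0 : (NExp.lit 0).eval τ = 0 := rfl
      generalize (NExp.sub (var 16) (.lit 1)).eval τ = N' at hWe ⊢
      subst hWe
      simp only [hz0]
      have hτv : ∀ v ≤ W - 1, S.Safe (τ.setInt 23 0 v) := fun v hv =>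
        hτ.setInt (by omega) hS.len_pos (hv.trans ((Nat.sub_le _ _).trans
          (by rw [← hsetτ.weight]; exact hτ.word 16 0)))
      rw [if_pos hτv]
      have hW1 : W - 1 + 1 = W := by omega
      set Ψ : Mem → ℝ≥0∞ := fun ρ => @ite _ (I (j + 1) (ρ.setInt 2 0 (j + 1)))
        (Classical.propDecidable _) (g (j + 1) (ρ.setInt 2 0 (j + 1))) ⊤ with hΨ
      have hstepmass : ∀ c < M, massTo Q a w (j + 1) c =
          massTo Q a w j c + if c = j then (w j : ℝ) else 0 := fun c _ => by
        simp only [massTo]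
        by_cases hcj : c = j
        · subst hcj; simp [hQj]
        · have : c < j + 1 ↔ c < j := by omega
          simp [hcj, this]
      -- Both outcomes of the coin change the weights in the same way. They differ only in the size
      -- of the sample and in the marks.
      have hdecided : ∀ v r mk ρ, S.Safe ρ → r ≤ lim →
          Decided P T Δ fr j r mk (τ.setInt 23 0 v) ρ →
          Ψ ρ ≤ ENNReal.ofReal (10 * ((M : ℝ) - j - 1) + 1 + B + C * (lim - r) +
            G * pot (massTo Q a w (j + 1)) mk r) := by
        intro v r mk ρ hρ hr hd
        have h9 : (τ.setInt 23 0 v).ints 9 = τ.ints 9 := setInt_ints_ne _ _ _ (by norm_num)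
        have hI' : I (j + 1) (ρ.setInt 2 0 (j + 1)) := by
          refine ⟨hd.sound.of_eq (setInt_ints_ne _ _ _ (by norm_num))
            (setInt_ints_ne _ _ _ (by norm_num)) rfl, ?_, ?_⟩
          · rw [setInt_ints_ne _ _ _ (by norm_num), hd.count]; exact hr
          · intro c hc
            rw [setInt_ints_ne _ _ _ (by norm_num), hd.weights, h9, Function.update_apply]
            by_cases hcj : c = j
            · subst hcj; simp [hQj, hwj]
            · have : c < j + 1 ↔ c < j := by omega
              rw [if_neg hcj, hIj.2.2 c hc]; simp only [this]
        rw [hΨ]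
        beta_reduce
        rw [if_pos hI', hg]
        beta_reduce
        rw [setInt_ints_ne _ _ _ (show (1 : ℕ) ≠ 2 by norm_num),
          setInt_ints_ne _ _ _ (show (10 : ℕ) ≠ 2 by norm_num), hd.count]
        refine ENNReal.ofReal_le_ofReal (le_of_eq ?_)
        rw [hpot, samplePot_congr (fun _ _ => rfl) hd.marks]
        push_cast
        ring
      set r := τ.ints 1 0 with hr
      set A : ℝ := 10 * ((M : ℝ) - j - 1) + 5 + B + C * (lim - r) with hAdef
      have hA0 : 0 ≤ A := by
        have := mul_nonneg hC0 hcntR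
        rw [hAdef]; linarith
      set mk' : ℕ → ℕ := fun z => if Hits P T Δ L z j then 1 else τ.ints 10 z with hmk'
      set x : ℝ := A + G * pot (massTo Q a w (j + 1)) (τ.ints 10) r with hx
      set y : ℝ := A + G * pot (massTo Q a w (j + 1)) mk' (r + 1) with hy
      have hx0 : 0 ≤ x := add_nonneg hA0 (mul_nonneg hG (hpot0 _ _ _))
      have hy0 : 0 ≤ y := add_nonneg hA0 (mul_nonneg hG (hpot0 _ _ _))
      have hRv : ∀ v, Ready P T Δ (τ.setInt 23 0 v) := fun v =>
        hRτ.frame (p := .rand 23 (.lit 0) (.lit 0)) (.setInt_of rfl)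
          (by rintro a (rfl | rfl | rfl | rfl) <;> simp [writesI]) (by simp [writesR])
      have hsv : ∀ v, Setting (τ.setInt 23 0 v) L lg K W fr z := fun v =>
        hsetτ.of_ints_eq fun b h1 h2 => setInt_ints_ne _ _ _ (by omega)
      have hne : ∀ v b, b ≠ 23 → (τ.setInt 23 0 v).ints b = τ.ints b := fun v b hb =>
        setInt_ints_ne _ _ _ hb
      have hsoundv : ∀ v, Sound P T Δ (τ.setInt 23 0 v) := fun v =>
        hIj.1.of_eq (hne v 1 (by norm_num)) (hne v 10 (by norm_num)) rfl
      have hskip : ∀ v ≤ W - 1, ¬ (v < s * w j ∧ r < lim) →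
          ert S (decideP d) Ψ (τ.setInt 23 0 v) ≤ ENNReal.ofReal x := by
        intro v hvW hcoin
        refine (decideP_runs_skip (P := P) (T := T) (Δ := Δ) hS (hτv v hvW) (hsv v)
          (by rw [hne v 2 (by norm_num), hv]) hj hML (by rw [hne v 1 (by norm_num)])
          (by rw [hne v 9 (by norm_num), hwj]; exact hw j hj) (hsoundv v) ?_ Ψ _
          fun ρ hρ hfρ hd => hdecided v r _ ρ hρ hIj.2.1 (by rwa [← hr] at hd)).trans ?_
        · rw [hne v 9 (by norm_num), hwj, ← hs, ← hlim]; simpa using hcoin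
        · rw [hne v 10 (by norm_num), show ((4 : ℕ) : ℝ≥0∞) = ENNReal.ofReal 4 by simp,
            ← ENNReal.ofReal_add (by norm_num)]
          · refine ENNReal.ofReal_le_ofReal (le_of_eq ?_)
            rw [hx, hAdef]; ring
          · have := mul_nonneg hG (hpot0 (j + 1) (τ.ints 10) r)
            have := mul_nonneg hC0 hcntR
            linarith
      -- The addition takes one free place, which releases `C` and so pays for writing the center
      -- and marking the elements.
      have hadd : ∀ v ≤ W - 1, v < s * w j → r < lim →
          ert S (decideP d) Ψ (τ.setInt 23 0 v) ≤ ENNReal.ofReal y := by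
        intro v hvW hcoin hrl
        refine (decideP_runs_add (P := P) (T := T) (Δ := Δ) (r := r) hS (hτv v hvW) (hRv v) (hsv v)
          (by rw [hne v 2 (by norm_num), hv]) hj hML (by rw [hne v 1 (by norm_num)])
          (by omega)
          (by rw [hne v 9 (by norm_num), hwj]; exact hw j hj) (hsoundv v) ?_ ?_ Ψ _
          fun ρ hρ hfρ hd => hdecided v (r + 1) _ ρ hρ hrl hd).trans ?_
        · rw [hne v 9 (by norm_num), hwj, ← hs]; simpa using hcoin
        · rw [← hs, ← hlim]; exact hrl
        · rw [hne v 10 (by norm_num), ← ENNReal.ofReal_natCast, ← ENNReal.ofReal_add (by positivity)]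
          · refine ENNReal.ofReal_le_ofReal ?_
            rw [hy, hAdef]
            push_cast
            nlinarith
          · have h1 := mul_nonneg hG (hpot0 (j + 1) mk' (r + 1))
            have h2 : (0 : ℝ) ≤ lim - (r + 1 : ℕ) := by
              have : ((r + 1 : ℕ) : ℝ) ≤ lim := by exact_mod_cast hrl
              linarith
            have := mul_nonneg hC0 h2
            linarith
      have hbase : ∑ v : Fin (W - 1 + 1), ((W - 1 + 1 : ℕ) : ℝ≥0∞)⁻¹ *
          ert S (decideP d) Ψ (τ.setInt 23 0 v) ≤
          ENNReal.ofReal (A + G * pot (massTo Q a w j) (τ.ints 10) r) := by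
        have hnorm : ∑ v : Fin (W - 1 + 1), ((W - 1 + 1 : ℕ) : ℝ≥0∞)⁻¹ = 1 := by
          rw [Finset.sum_const, Finset.card_univ, Fintype.card_fin, nsmul_eq_mul,
            ENNReal.mul_inv_cancel (by simp) (ENNReal.natCast_ne_top _)]
        -- With room in the sample the two outcomes are averaged. In a full sample every outcome of
        -- the coin skips the candidate.
        by_cases hrl : r < lim
        · refine (Finset.sum_le_sum fun v _ => ?_).trans ((sum_fin_ite (a := s * w j) (x := x)
            (y := y) (Nat.succ_pos (W - 1)) hx0 hy0).le.trans (ENNReal.ofReal_le_ofReal ?_))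
          · gcongr
            by_cases hvc : (v : ℕ) < s * w j
            · rw [if_pos hvc]; exact hadd v (by have := v.2; omega) hvc hrl
            · rw [if_neg hvc]; exact hskip v (by have := v.2; omega) fun h => hvc h.1
          · rw [Nat.succ_eq_add_one, hW1]
            have hp : min 1 (((s * w j : ℕ) : ℝ) / W) = min 1 (s / W * (w j : ℝ)) := by
              push_cast; congr 1; ring
            rw [hp]
            have := samplePot_step (N := m - 1) (M := M) (s := s) (W := W) (lim := lim)
              (R := Hits P T Δ L) (a := massTo Q a w j) (a' := massTo Q a w (j + 1))
              (mk := τ.ints 10) (mk' := mk') (cnt := r) hj (Nat.cast_nonneg (w j)) hstepmass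
              (fun _ _ => rfl) hrl rfl
            have h2 := mul_le_mul_of_nonneg_left this hG
            rw [hx, hy, hpot]
            linarith
        · refine (Finset.sum_le_sum fun (v : Fin (W - 1 + 1)) _ => mul_le_mul le_rfl
            (hskip (v : ℕ) (by have := v.2; omega) fun h => hrl h.2) bot_le bot_le).trans ?_
          rw [← Finset.sum_mul, hnorm, one_mul]
          refine ENNReal.ofReal_le_ofReal ?_
          have := samplePot_step_full (N := m - 1) (M := M) (s := s) (W := W) (lim := lim)
              (R := Hits P T Δ L) (a := massTo Q a w j) (a' := massTo Q a w (j + 1))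
              (mk := τ.ints 10) (cnt := r) hj (Nat.cast_nonneg (w j)) hstepmass (not_lt.1 hrl)
          rw [hx, hpot]
          gcongr
      refine le_trans (add_le_add_right (add_le_add_right (add_le_add_right
        (add_le_add_right hbase 1) 1) 1) 3) ?_
      calc 3 + (1 + (1 + (1 + ENNReal.ofReal (A + G * pot (massTo Q a w j) (τ.ints 10) r))))
          = ENNReal.ofReal 6 + ENNReal.ofReal (A + G * pot (massTo Q a w j) (τ.ints 10) r) := by
            rw [show ENNReal.ofReal 6 = 6 by simp]; ring
        _ = ENNReal.ofReal (6 + (A + G * pot (massTo Q a w j) (τ.ints 10) r)) :=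
            (ENNReal.ofReal_add (by norm_num)
              (add_nonneg hA0 (mul_nonneg hG (hpot0 _ _ _)))).symm
        _ ≤ g j τ := by
            rw [hg]
            refine ENNReal.ofReal_le_ofReal (le_of_eq ?_)
            rw [hAdef, hr]; ring
    · have hI' : I (j + 1) (τ.setInt 2 0 (j + 1)) := by
        refine ⟨hIj.1.of_eq (setInt_ints_ne _ _ _ (by norm_num))
          (setInt_ints_ne _ _ _ (by norm_num)) rfl,
          by rw [setInt_ints_ne _ _ _ (by norm_num)]; exact hIj.2.1, fun c hc => ?_⟩
        rw [setInt_ints_ne _ _ _ (by norm_num), hIj.2.2 c hc]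
        by_cases hcj : c = j
        · subst hcj; simp [hQj]
        · have : c < j + 1 ↔ c < j := by omega
          simp only [this]
      rw [if_neg fun h => hQj (hsel.1 h), ert, if_pos hI']
      have hmasseq : ∀ c < M, massTo Q a w (j + 1) c = massTo Q a w j c := fun c _ => by
        simp only [massTo]
        by_cases hcj : c = j
        · subst hcj; simp [hQj]
        · have : c < j + 1 ↔ c < j := by omega
          simp [this]
      rw [hg]
      beta_reduce
      rw [setInt_ints_ne _ _ _ (show (1 : ℕ) ≠ 2 by norm_num),
        setInt_ints_ne _ _ _ (show (10 : ℕ) ≠ 2 by norm_num), hpot,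
        samplePot_congr hmasseq fun _ _ => rfl, ← hpot]
      have h1 := mul_nonneg hG (hpot0 j (τ.ints 10) (τ.ints 1 0))
      have h2 := mul_nonneg hC0 hcntR
      calc _ = ENNReal.ofReal 5 + ENNReal.ofReal (10 * ((M : ℝ) - (j + 1 : ℕ)) + 1 + B +
            C * (lim - τ.ints 1 0) + G * pot (massTo Q a w j) (τ.ints 10) (τ.ints 1 0)) := by
            rw [show ENNReal.ofReal 5 = 5 by simp]; ring
        _ = _ := (ENNReal.ofReal_add (by norm_num) (by push_cast; linarith)).symm
        _ ≤ _ := ENNReal.ofReal_le_ofReal (by push_cast; linarith)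
  · intro τ hτ hf hv hIM
    rw [← passP] at hf
    have hcntR : (0 : ℝ) ≤ lim - τ.ints 1 0 := by
      have : (τ.ints 1 0 : ℝ) ≤ lim := by exact_mod_cast hIM.2.1
      linarith
    have h1 := mul_nonneg hG (hpot0 M (τ.ints 10) (τ.ints 1 0))
    have h2 := mul_nonneg hC0 hcntR
    have := hΦ τ hτ hf hIM.1 hIM.2.1 fun c hc => by rw [hIM.2.2 c hc]; simp [hc]
    calc 1 + Φ τ ≤ ENNReal.ofReal 1 + ENNReal.ofReal (B + C * (lim - τ.ints 1 0) +
          G * pot (massTo Q a w M) (τ.ints 10) (τ.ints 1 0)) := by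
          rw [ENNReal.ofReal_one]; gcongr
      _ = _ := (ENNReal.ofReal_add (by norm_num) (by linarith)).symm
      _ ≤ _ := ENNReal.ofReal_le_ofReal (by linarith)
  · have hcntR : (0 : ℝ) ≤ lim - σ.ints 1 0 := by
      have : (σ.ints 1 0 : ℝ) ≤ lim := by exact_mod_cast hcnt
      linarith
    have hzero : ∀ c < M, massTo Q a w 0 c = a c := fun c _ => by simp [massTo]
    have h1 := mul_nonneg hG (hpot0 0 (σ.ints 10) (σ.ints 1 0))
    have h2 := mul_nonneg hC0 hcntR
    rw [hg]
    beta_reduce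
    rw [setInt_ints_ne _ _ _ (show (1 : ℕ) ≠ 2 by norm_num),
      setInt_ints_ne _ _ _ (show (10 : ℕ) ≠ 2 by norm_num)]
    have hpoteq : pot (massTo Q a w 0) (σ.ints 10) (σ.ints 1 0) = pot a (σ.ints 10) (σ.ints 1 0) :=
      samplePot_congr hzero fun _ _ => rfl
    rw [← hpoteq]
    calc _ = ENNReal.ofReal 2 + ENNReal.ofReal (10 * ((M : ℝ) - (0 : ℕ)) + 1 + B +
          C * (lim - σ.ints 1 0) + G * pot (massTo Q a w 0) (σ.ints 10) (σ.ints 1 0)) := by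
          rw [show ENNReal.ofReal 2 = 2 by simp]
      _ = _ := (ENNReal.ofReal_add (by norm_num) (by push_cast; linarith [Nat.cast_nonneg (α := ℝ) M])).symm
      _ ≤ _ := ENNReal.ofReal_le_ofReal (by push_cast; linarith)

end Subtraj

namespace Subtraj

open RealRAM

variable {d n m : ℕ} {P : PolygonalCurve d n} {T : Breakpoints m} {Δ : ℝ} {S : Limits}

/-! ## The steps of the reweighting algorithm -/

/-- Initializes the weights for the length bound in variable `11`. -/
def startP : Prog :=
  .seq (.setInt 14 (.lit 0) (.mul (.lit 3) (.add (.div mE (var 11)) (.lit 1))))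
    (.seq (forP 2 candN (.setInt 9 (var 2) (.lit 1))) (.seq (.setInt 15 (.lit 0) candN)
      (.seq (.setInt 17 (.lit 0) (.lit 0)) (.setInt 19 (.lit 0) (.lit 1)))))

/-- Prepares a fresh sample. -/
def resetP : Prog :=
  .seq (forP 2 mE (.setInt 10 (var 2) (.lit 0))) (.seq (.setInt 1 (.lit 0) (.lit 0))
    (.seq (.setInt 16 (.lit 0) (var 15)) (.seq (.setInt 18 (.lit 0) (.lit 0))
      (.setInt 21 (.lit 0) (.lit 1)))))

/-- Stores `z + 1` in variable `21` for an unmarked element `z`, or `0` if there is none. -/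
def findP : Prog :=
  .seq (.setInt 21 (.lit 0) (.lit 0)) (forP 2 (.sub mE (.lit 1))
    (.ite (.natLE (.get 10 (var 2)) (.lit 0)) (.setInt 21 (.lit 0) (.add (var 2) (.lit 1))) .skip))

/-- Computes the weight of the candidates that cover element `z - 1` for `z` in variable `21`. -/
def weighP : Prog :=
  .seq (.setInt 22 (.lit 0) (.lit 0)) (forP 2 candN
    (.ite (hitsB (var 21) (var 2)) (.setInt 22 (.lit 0) (.add (var 22) (.get 9 (var 2)))) .skip))

/-- Outputs the segments between consecutive breakpoints. -/
def trivialP (d : ℕ) : Prog :=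
  .seq (.setInt 1 (.lit 0) (.lit 0)) (.seq (forP 2 (.sub mE (.lit 1))
    (pushP d (var 2) (.add (var 2) (.lit 1)))) (.setInt 20 (.lit 0) (.lit 1)))

theorem writesI_startP (a : ℕ) :
    writesI startP a ↔ a = 14 ∨ a = 2 ∨ a = 9 ∨ a = 15 ∨ a = 17 ∨ a = 19 := by
  simp [startP, writesI, writesI_forP]; tauto

theorem writesR_startP (a : ℕ) : ¬ writesR startP a := by
  simp [startP, writesR, writesR_forP]

theorem writesI_resetP (a : ℕ) :
    writesI resetP a ↔ a = 2 ∨ a = 10 ∨ a = 1 ∨ a = 16 ∨ a = 18 ∨ a = 21 := by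
  simp [resetP, writesI, writesI_forP]; tauto

theorem writesR_resetP (a : ℕ) : ¬ writesR resetP a := by
  simp [resetP, writesR, writesR_forP]

theorem writesI_findP (a : ℕ) : writesI findP a ↔ a = 21 ∨ a = 2 := by
  simp [findP, writesI, writesI_forP]; tauto

theorem writesR_findP (a : ℕ) : ¬ writesR findP a := by
  simp [findP, writesR, writesR_forP]

theorem writesI_weighP (a : ℕ) : writesI weighP a ↔ a = 22 ∨ a = 2 := by
  simp [weighP, writesI, writesI_forP]; tauto

theorem writesR_weighP (a : ℕ) : ¬ writesR weighP a := by
  simp [weighP, writesR, writesR_forP]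

/-- Stores a number in cell `0`. -/
theorem Runs.setVar (hS : Ample S d n m) {σ : Mem} (hσ : S.Safe σ) {a v : ℕ} {x : NExp}
    (ha : a < 25) (hx : x.eval σ = v) (hv : v ≤ S.word) :
    Runs S (.setInt a (.lit 0) x) σ 1 fun τ => τ = σ.setInt a 0 v := by
  have hA := hS.arrays
  subst hx
  exact Runs.setInt (hσ.setInt (by omega) hS.len_pos hv) rfl

section

variable {σ : Mem} {L : ℕ}

theorem startP_runs (hS : Ample S d n m) (hσ : S.Safe σ) (hR : Ready P T Δ σ)
    (hL : σ.ints 11 0 = L) (hML : m * L ≤ 2 * m ^ 2) :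
    Runs S startP σ (4 * (m * L) + 11) fun τ => τ.ints 14 0 = 3 * (m / L + 1) ∧
      (∀ c < m * L, τ.ints 9 c = 1) ∧ τ.ints 15 0 = m * L ∧ τ.ints 17 0 = 0 ∧ τ.ints 19 0 = 1 := by
  have hA := hS.arrays
  have hm := hS.two_le
  have hdiv : m / L ≤ m := Nat.div_le_self _ _
  refine (Runs.seq (Runs.setVar hS hσ (v := 3 * (m / L + 1)) (by norm_num)
      (by simp [NExp.eval, hR.input.mE, hL]) (hS.le_word' (by omega))) fun τ hτ hf h1 =>
    Runs.seq (R := fun τ => τ.ints 14 0 = 3 * (m / L + 1) ∧ τ.ints 0 1 = m ∧ τ.ints 11 0 = L ∧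
      ∀ c < m * L, τ.ints 9 c = 1) (T := (1 + 3) * (m * L) + 3) ((Runs.forP (m * L)
        (fun j τ => ∀ c < j, τ.ints 9 c = 1) hτ (by omega)
      hS.len_pos (hS.le_word (by omega)) (fun ρ hf' => ?_) (by simp [writesI]) (by simp) ?_).mono
      le_rfl ?_) fun ρ hρ hf' h2 =>
    Runs.seq (Runs.setVar hS hρ (v := m * L) (by norm_num) (by simp [NExp.eval, h2])
      (hS.le_word (by omega))) fun μ hμ hfμ h3 =>
    Runs.seq (Runs.setVar hS hμ (v := 0) (by norm_num) rfl (Nat.zero_le _)) fun ν hν hfν h4 =>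
    (Runs.setVar hS hν (v := 1) (by norm_num) rfl (hS.le_word' (by omega))).mono le_rfl
      fun κ hκ hfκ h5 => ?_).le (by omega)
  · subst h1
    have h0 := hf'.ints 0 (by simp [writesI, writesI_forP])
    have h11 := hf'.ints 11 (by simp [writesI, writesI_forP])
    rw [setInt_ints_ne _ _ _ (by norm_num)] at h0 h11
    simp [NExp.eval, h0, h11, hR.input.mE, hL]
  · intro j hj ρ hρ hf' hv hI
    refine Runs.setInt ?_ ?_
    · simp only [NExp.eval, hv]
      exact hρ.setInt (by omega) (hS.lt_len (by omega)) (hS.le_word' (by omega))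
    · intro c hc
      simp only [NExp.eval, hv, setInt_ints_ne _ _ _ (show (9 : ℕ) ≠ 2 by norm_num),
        setInt_ints_self, Function.update_apply]
      split_ifs with h
      · rfl
      · exact hI c (by omega)
  · subst h1
    intro ρ hρ hf' hI
    have h0 := hf'.ints 0 (by simp [writesI, writesI_forP])
    have h11 := hf'.ints 11 (by simp [writesI, writesI_forP])
    have h14 := hf'.ints 14 (by simp [writesI, writesI_forP])
    rw [setInt_ints_ne _ _ _ (by norm_num)] at h0 h11
    exact ⟨by simp [h14], by rw [h0, hR.input.mE], by rw [h11, hL], hI⟩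
  · subst h3 h4 h5
    simp [setInt_ints_ne, h2.1]
    exact h2.2.2.2

theorem resetP_runs (hS : Ample S d n m) (hσ : S.Safe σ) (hR : Ready P T Δ σ) :
    Runs S resetP σ (4 * m + 11) fun τ => (∀ z < m, τ.ints 10 z = 0) ∧ τ.ints 1 0 = 0 ∧
      τ.ints 16 0 = σ.ints 15 0 ∧ τ.ints 18 0 = 0 ∧ τ.ints 21 0 = 1 := by
  have hA := hS.arrays
  have hm := hS.two_le
  refine (Runs.seq (T := (1 + 3) * m + 3) (Runs.forP m
        (fun j τ => ∀ z < j, τ.ints 10 z = 0) hσ (by omega)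
      hS.len_pos (hS.le_word' (by omega)) (fun ρ hf' => ?_) (by simp [writesI]) (by simp) ?_)
      fun ρ hρ hf' h2 =>
    Runs.seq (Runs.setVar hS hρ (v := 0) (by norm_num) rfl (Nat.zero_le _)) fun μ hμ hfμ h3 =>
    Runs.seq (Runs.setVar hS hμ (v := σ.ints 15 0) (by norm_num) ?_ (hσ.word _ _))
      fun ν hν hfν h4 =>
    Runs.seq (Runs.setVar hS hν (v := 0) (by norm_num) rfl (Nat.zero_le _)) fun κ hκ hfκ h5 =>
    (Runs.setVar hS hκ (v := 1) (by norm_num) rfl (hS.le_word' (by omega))).mono le_rfl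
      fun θ hθ hfθ h6 => ?_).le (by omega)
  · simp [NExp.eval, hf'.ints 0 (by simp [writesI, writesI_forP]), hR.input.mE]
  · intro j hj ρ hρ hf' hv hI
    refine Runs.setInt ?_ ?_
    · simp only [NExp.eval, hv]
      exact hρ.setInt (by omega) (hS.index_lt_len (by omega)) (Nat.zero_le _)
    · intro c hc
      simp only [NExp.eval, hv, setInt_ints_ne _ _ _ (show (10 : ℕ) ≠ 2 by norm_num),
        setInt_ints_self, Function.update_apply]
      split_ifs with h
      · rfl
      · exact hI c (by omega)
  · subst h3
    simp [NExp.eval, setInt_ints_ne, hf'.ints 15 (by simp [writesI, writesI_forP])]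
  · subst h3 h4 h5 h6
    simp [setInt_ints_ne]
    exact h2

theorem findP_runs (hS : Ample S d n m) (hσ : S.Safe σ) (hR : Ready P T Δ σ) :
    Runs S findP σ (5 * m + 5) fun τ =>
      (τ.ints 21 0 = 0 ∧ ∀ z < m - 1, σ.ints 10 z ≠ 0) ∨
        ∃ z < m - 1, τ.ints 21 0 = z + 1 ∧ σ.ints 10 z = 0 := by
  have hA := hS.arrays
  have hm := hS.two_le
  refine (Runs.seq (T' := (2 + 3) * (m - 1) + 3) (Runs.setVar hS hσ (v := 0) (by norm_num) rfl
    (Nat.zero_le _)) fun τ hτ hf h1 => Runs.forP (m - 1)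
      (fun j τ => (τ.ints 21 0 = 0 ∧ ∀ z < j, σ.ints 10 z ≠ 0) ∨
        ∃ z < m - 1, τ.ints 21 0 = z + 1 ∧ σ.ints 10 z = 0) hτ (by omega)
      hS.len_pos (hS.le_word' (by omega)) (fun ρ hf' => ?_) (by simp [writesI]) ?_ ?_).le (by omega)
  · simp [NExp.eval, hf'.ints 0 (by simp [writesI, writesI_forP]),
      hf.ints 0 (by simp [writesI]), hR.input.mE]
  · left
    simp [h1, setInt_ints_ne]
  · intro j hj ρ hρ hf' hv hI
    have h10 : ρ.ints 10 = σ.ints 10 := by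
      rw [hf'.ints 10 (by simp [writesI, writesI_forP]), hf.ints 10 (by simp [writesI])]
    refine Runs.ite (T := 1) (T' := 1) (fun h => ?_) fun h => ?_
    · simp only [BExp.eval, NExp.eval, hv, h10, Nat.le_zero] at h
      refine (Runs.setVar hS hρ (v := j + 1) (by norm_num) (by simp [NExp.eval, hv])
        (hS.le_word' (by omega))).mono le_rfl fun κ _ _ hκ => ?_
      subst hκ
      exact Or.inr ⟨j, hj, by simp [setInt_ints_ne], h⟩
    · simp only [BExp.eval, NExp.eval, hv, h10, Nat.le_zero] at h
      refine Runs.skip hρ ?_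
      simp only [setInt_ints_ne _ _ _ (show (21 : ℕ) ≠ 2 by norm_num)]
      rcases hI with ⟨h2, h3⟩ | hI
      · refine Or.inl ⟨h2, fun z hz => ?_⟩
        rcases Nat.lt_succ_iff_lt_or_eq.1 hz with h4 | rfl
        · exact h3 z h4
        · exact h
      · exact Or.inr hI

open Classical in
theorem weighP_runs (hS : Ample S d n m) (hσ : S.Safe σ) (hR : Ready P T Δ σ)
    (hL : σ.ints 11 0 = L) (hML : m * L ≤ 2 * m ^ 2) {z : ℕ} (hz : σ.ints 21 0 = z + 1)
    (hzm : z < m) (hW : ∑ c ∈ Finset.range (m * L), σ.ints 9 c ≤ S.word) :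
    Runs S weighP σ (5 * (m * L) + 5) fun τ => τ.ints 22 0 =
      ∑ c ∈ Finset.range (m * L), if Hits P T Δ L z c then σ.ints 9 c else 0 := by
  have hA := hS.arrays
  have hm := hS.two_le
  refine (Runs.seq (T' := (2 + 3) * (m * L) + 3) (Runs.setVar hS hσ (v := 0) (by norm_num) rfl
    (Nat.zero_le _)) fun τ hτ hf h1 => Runs.forP (m * L)
      (fun j τ => τ.ints 22 0 = ∑ c ∈ Finset.range j, if Hits P T Δ L z c then σ.ints 9 c else 0)
      hτ (by omega) hS.len_pos (hS.le_word (by omega)) (fun ρ hf' => ?_) (by simp [writesI]) ?_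
      ?_).le (by omega)
  · simp [NExp.eval, hf'.ints 0 (by simp [writesI, writesI_forP]),
      hf.ints 0 (by simp [writesI]), hR.input.mE, hf'.ints 11 (by simp [writesI, writesI_forP]),
      hf.ints 11 (by simp [writesI]), hL]
  · simp [h1, setInt_ints_ne]
  · intro j hj ρ hρ hf' hv hI
    have hi : ∀ a, a ≠ 2 → a ≠ 22 → ρ.ints a = σ.ints a := fun a h2 h22 => by
      rw [hf'.ints a (by simp [writesI, writesI_forP, h2, h22]),
        hf.ints a (by simp [writesI, h22])]
    have hRρ : Ready P T Δ ρ := (hR.frame hf (by rintro a (rfl | rfl | rfl | rfl) <;> simp [writesI])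
      (by simp [writesR])).frame hf'
      (by rintro a (rfl | rfl | rfl | rfl) <;> simp [writesI, writesI_forP])
      (by simp [writesR, writesR_forP])
    have hb := hRρ.hitsB_eval (z := var 21) (c := var 2) (z' := z) (c' := j) (L := L)
      (by rw [hi 11 (by simp) (by simp), hL]) (by simp [NExp.eval, hi 21, hz])
      (by simp [NExp.eval, hv]) hzm hj
    refine Runs.ite (T := 1) (T' := 1) (fun h => ?_) fun h => ?_
    · rw [hb] at h
      have hval : (NExp.add (var 22) (.get 9 (var 2))).eval ρ =
          ∑ c ∈ Finset.range (j + 1), if Hits P T Δ L z c then σ.ints 9 c else 0 := by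
        rw [Finset.sum_range_succ, if_pos h, ← hI]
        simp [NExp.eval, hv, hi 9]
      refine (Runs.setVar hS hρ (by norm_num) hval ?_).mono le_rfl fun κ _ _ hκ => ?_
      · refine le_trans ?_ hW
        refine (Finset.sum_le_sum_of_subset (Finset.range_subset_range.2 hj)).trans
          (Finset.sum_le_sum fun c _ => ?_)
        split_ifs <;> simp
      · subst hκ
        simp [setInt_ints_ne]
    · rw [hb] at h
      refine Runs.skip hρ ?_
      rw [Finset.sum_range_succ, if_neg h, ← hI, setInt_ints_ne _ _ _ (by norm_num), add_zero]

theorem trivialP_runs (hS : Ample S d n m) (hσ : S.Safe σ) (hR : Ready P T Δ σ) :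
    Runs S (trivialP d) σ ((4 * d + 8) * m + 7) fun τ => τ.ints 1 0 = m - 1 ∧ τ.ints 20 0 = 1 ∧
      ∀ z < m - 1, CenterIs P T τ z z (z + 1) := by
  have hA := hS.arrays
  have hm := hS.two_le
  refine (Runs.seq (T := 1) (Runs.setVar hS hσ (v := 0) (by norm_num) rfl
    (Nat.zero_le _)) fun τ hτ hf h1 => Runs.seq (T := (4 * d + 5 + 3) * (m - 1) + 3) (T' := 1)
      (Runs.forP (m - 1) (fun j τ => τ.ints 1 0 = j ∧ ∀ z < j, CenterIs P T τ z z (z + 1))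
      hτ (by omega) hS.len_pos (hS.le_word' (by omega)) (fun ρ hf' => ?_)
      (by simp [writesI_pushP]) ?_ ?_) fun κ hκ hfκ h =>
        (Runs.setVar hS hκ (v := 1) (by norm_num) rfl (hS.le_word' (by omega))).mono le_rfl
        fun μ _ _ hμ => ?_).le ?_
  · simp [NExp.eval, hf'.ints 0 (by simp [writesI_pushP, writesI_forP]),
      hf.ints 0 (by simp [writesI]), hR.input.mE]
  · simp [h1, setInt_ints_ne]
  · intro j hj ρ hρ hf' hv hI
    have hRρ : Ready P T Δ ρ := (hR.frame hf (by rintro a (rfl | rfl | rfl | rfl) <;> simp [writesI])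
      (by simp [writesR])).frame hf'
      (by rintro a (rfl | rfl | rfl | rfl) <;> simp [writesI_pushP, writesI_forP])
      (fun a ha h => by have := writesR_pushP (writesR_forP.1 h); omega)
    refine (pushP_runs hρ hRρ.input (i := j) (j := j + 1) (r := j) (by simp [NExp.eval, hv])
      (by simp [NExp.eval, hv]) (hRρ.edge _ (by omega)) (hRρ.edge _ (by omega)) hI.1 (by omega) ?_
      (hS.le_word' (by omega))).mono le_rfl fun κ _ _ hκ => ?_
    · refine le_trans ?_ hS.len
      calc (2 * j + 2) * d + 1 ≤ (2 * m + 2) * d + 1 := by gcongr; omega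
        _ ≤ 3000 * m * (d + 1) := by nlinarith
        _ ≤ 3000 * (d + 1) * m ^ 2 := by nlinarith [Nat.zero_le (d * m)]
    · refine ⟨by rw [setInt_ints_ne _ _ _ (by norm_num), hκ.1]; simp, fun z hz => ?_⟩
      change CenterIs P T κ z z (z + 1)
      rcases Nat.lt_succ_iff_lt_or_eq.1 hz with h4 | rfl
      · exact hκ.2.2 z h4 _ _ (hI.2 z h4)
      · exact hκ.2.1
  · subst hμ
    refine ⟨by rw [setInt_ints_ne _ _ _ (by norm_num), h.1], by simp, fun z hz => h.2 z hz⟩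
  · have : (4 * d + 5 + 3) * (m - 1) ≤ (4 * d + 8) * m := Nat.mul_le_mul_left _ (by omega)
    omega

end

end Subtraj

namespace Subtraj

open RealRAM

/-! ## The invariant of the reweighting algorithm -/

/-- The guess `L = 2 ^ ell` for the lengths of the candidates, with `2 ^ lg` about `m`, and the
bound `K` on the size of a hitting set. -/
structure Nums (m k e₀ L ell lg K : ℕ) : Prop where
  three_le : 3 ≤ m
  pow : L = 2 ^ ell
  -- Smaller guesses are never run, because then outputting all consecutive pairs is good enough.
  -- The inequality makes `K * lg = O(m)`.
  log_le : lg ≤ L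
  two_le_log : 2 ≤ lg
  log_le_size : lg ≤ m
  ell_le : ell ≤ lg
  size_le : m ≤ 2 ^ lg
  pow_lt : 2 ^ lg < 2 * m
  opt : K = 3 * (m / L + 1)
  -- A guess is halved only after `m / L + 1 < k` has been established, so the size of the target
  -- never exceeds the optimum by more than a factor of 2.
  card : m / L + 1 ≤ 2 * k
  -- `e₀` is an exponent with `k ≤ m / 2 ^ e₀ + 1`; a guess with this exponent cannot be exhausted,
  -- and the difference to `ell` counts the halvings that may remain.
  star : e₀ ≤ ell

namespace Nums

variable {m k e₀ L ell lg K : ℕ} (h : Nums m k e₀ L ell lg K)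
include h

theorem one_le_ell : 1 ≤ ell := by
  by_contra h0
  have h1 := h.pow
  rw [show ell = 0 by omega, pow_zero] at h1
  have := h.log_le
  have := h.two_le_log
  omega

theorem two_le : 2 ≤ L := h.two_le_log.trans h.log_le

theorem opt_pos : 0 < K := by rw [h.opt]; positivity

theorem len_le : L ≤ 2 * m :=
  (h.pow.trans_le (Nat.pow_le_pow_right (by norm_num) h.ell_le)).trans h.pow_lt.le

theorem card_le : m * L ≤ 2 * m ^ 2 := by
  have := Nat.mul_le_mul_left m h.len_le
  nlinarith

theorem size_le_card : 2 * m ≤ m * L := by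
  have := Nat.mul_le_mul_left m h.two_le
  linarith

/-- From `lg ≤ L` follows `m / L * lg ≤ m`. So the size of a sample and the number of doublings are
`O(m)` for every guess, which the storage needs. -/
theorem opt_mul_log_le : (m / L + 1) * (lg + 2) ≤ 4 * m := by
  have h1 : m / L * L ≤ m := Nat.div_mul_le_self m L
  have h2 : m / L * lg ≤ m / L * L := Nat.mul_le_mul_left _ h.log_le
  have h3 : m / L * 2 ≤ m / L * L := Nat.mul_le_mul_left _ h.two_le
  have h4 := h.log_le_size
  have h5 := h.three_le
  calc (m / L + 1) * (lg + 2) = m / L * lg + m / L * 2 + lg + 2 := by ring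
    _ ≤ 4 * m := by omega

theorem lim_le : 8 * (4 * K * (lg + 2)) ≤ 384 * m := by
  rw [h.opt]
  calc 8 * (4 * (3 * (m / L + 1)) * (lg + 2)) = 96 * ((m / L + 1) * (lg + 2)) := by ring
    _ ≤ 96 * (4 * m) := Nat.mul_le_mul_left _ h.opt_mul_log_le
    _ = _ := by ring

theorem doublings_le : 4 * ell * K ≤ 48 * m := by
  rw [h.opt]
  calc 4 * ell * (3 * (m / L + 1)) = 12 * ((m / L + 1) * ell) := by ring
    _ ≤ 12 * ((m / L + 1) * (lg + 2)) := by gcongr; have := h.ell_le; omega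
    _ ≤ 12 * (4 * m) := Nat.mul_le_mul_left _ h.opt_mul_log_le
    _ = _ := by ring

theorem opt_le : K ≤ 24 * m := by
  rw [h.opt]
  have := h.opt_mul_log_le
  have : (m / L + 1) * 2 ≤ (m / L + 1) * (lg + 2) := Nat.mul_le_mul_left _ (by omega)
  omega

end Nums

variable {d n m : ℕ} {P : PolygonalCurve d n} {T : Breakpoints m} {Δ : ℝ} {S : Limits}

/-- The state of the algorithm after `t` doublings for the guess `L`. -/
structure Guess (P : PolygonalCurve d n) (T : Breakpoints m) (Δ : ℝ) (k e₀ L ell lg K t : ℕ)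
    (σ : Mem) : Prop where
  nums : Nums m k e₀ L ell lg K
  ready : Ready P T Δ σ
  len : σ.ints 11 0 = L
  ell : σ.ints 12 0 = ell
  log : σ.ints 13 0 = lg
  opt : σ.ints 14 0 = K
  total : σ.ints 15 0 = ∑ c ∈ Finset.range (m * L), σ.ints 9 c
  count : σ.ints 17 0 = t
  running : σ.ints 20 0 = 0
  -- Each doubling raises the exponents of all candidates covering one element, and every hitting
  -- set contains such a candidate.
  exponents : ∃ e : ℕ → ℕ, (∀ c < m * L, σ.ints 9 c = 2 ^ e c) ∧
    ∀ H ⊆ Finset.range (m * L), (∀ z < m - 1, ∃ c ∈ H, Hits P T Δ L z c) → t ≤ ∑ c ∈ H, e c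
  growth : ((∑ c ∈ Finset.range (m * L), σ.ints 9 c : ℕ) : ℝ) ≤
    (m * L : ℕ) * (1 + 1 / (4 * K : ℝ)) ^ t

section

variable {k e₀ L ell lg K t : ℕ} {σ τ : Mem}

theorem Guess.of_eq (h : Guess P T Δ k e₀ L ell lg K t σ) (hR : Ready P T Δ τ)
    (h9 : ∀ c < m * L, τ.ints 9 c = σ.ints 9 c) (hi : ∀ a, 11 ≤ a → a ≤ 15 ∨ a = 17 ∨ a = 20 →
      τ.ints a = σ.ints a) : Guess P T Δ k e₀ L ell lg K t τ := by
  have hsum : ∑ c ∈ Finset.range (m * L), τ.ints 9 c = ∑ c ∈ Finset.range (m * L), σ.ints 9 c :=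
    Finset.sum_congr rfl fun c hc => h9 c (Finset.mem_range.1 hc)
  obtain ⟨e, he, he'⟩ := h.exponents
  exact ⟨h.nums, hR, by rw [hi 11 (by simp) (by simp), h.len],
    by rw [hi 12 (by simp) (by simp), h.ell], by rw [hi 13 (by simp) (by simp), h.log],
    by rw [hi 14 (by simp) (by simp), h.opt], by rw [hi 15 (by simp) (by simp), h.total, hsum],
    by rw [hi 17 (by simp) (by simp), h.count], by rw [hi 20 (by simp) (by simp), h.running],
    ⟨e, fun c hc => by rw [h9 c hc, he c hc], he'⟩, by rw [hsum]; exact h.growth⟩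

/-- The growth factor is at most `4 ^ ell = L²`, and `L ≤ 2m`. This polynomial bound gives integers
of logarithmic length. -/
theorem growth_le (hN : Nums m k e₀ L ell lg K) {W : ℕ} (ht : t ≤ 4 * ell * K)
    (hW : (W : ℝ) ≤ (m * L : ℕ) * (1 + 1 / (4 * K : ℝ)) ^ t) : W ≤ 8 * m ^ 4 := by
  have h1 := one_add_inv_pow_le hN.opt_pos ht
  have h2 : (W : ℝ) ≤ ((m * L * 4 ^ ell : ℕ) : ℝ) := by
    refine hW.trans ?_
    push_cast at h1 ⊢
    gcongr
  have h3 : W ≤ m * L * 4 ^ ell := by exact_mod_cast h2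
  refine h3.trans ?_
  have h4 : 4 ^ ell = L * L := by
    rw [hN.pow, show (4 : ℕ) = 2 * 2 by norm_num, Nat.mul_pow]
  calc m * L * 4 ^ ell = m * (L * (L * L)) := by rw [h4]; ring
    _ ≤ m * ((2 * m) * ((2 * m) * (2 * m))) := by gcongr <;> exact hN.len_le
    _ = 8 * m ^ 4 := by ring

theorem Guess.weight_pos (h : Guess P T Δ k e₀ L ell lg K t σ) :
    1 ≤ ∑ c ∈ Finset.range (m * L), σ.ints 9 c := by
  obtain ⟨e, he, -⟩ := h.exponents
  have hM : 0 < m * L := by have := h.nums.size_le_card; have := h.nums.three_le; omega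
  calc 1 ≤ σ.ints 9 0 := by rw [he 0 hM]; exact Nat.one_le_two_pow
    _ ≤ _ := Finset.single_le_sum (f := fun c => σ.ints 9 c) (fun _ _ => Nat.zero_le _)
      (Finset.mem_range.2 hM)

theorem Guess.weight_le (h : Guess P T Δ k e₀ L ell lg K t σ) (ht : t ≤ 4 * ell * K) :
    ∑ c ∈ Finset.range (m * L), σ.ints 9 c ≤ 8 * m ^ 4 :=
  growth_le h.nums ht h.growth

end

/-- A bound on the expected cost of a successful epoch. -/
def epochCost (d m L lg K : ℕ) : ℝ :=
  -- Twice what a fresh sample may cost: half pays for drawing it, and half is deposited in the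
  -- potential, which starts at `1/2` or below. A failure finds the potential at 1 or above, and
  -- with it the full amount.
  2 * (200 * (m * L : ℕ) + (8 * (4 * K * (lg + 2)) : ℕ) * (4 * d + 5 * m + 10))

theorem epochCost_nonneg (d m L lg K : ℕ) : 0 ≤ epochCost d m L lg K := by
  rw [epochCost]; positivity

/-- A bound on the cost of the remaining doublings. -/
def doublingCost (d m L ell lg K t : ℕ) : ℝ :=
  -- Each doubling pays for its own scans and for `1 / K` of an epoch, since an epoch is closed
  -- after `K` doublings.
  (4 * ell * K - t) * (100 * (m * L : ℕ) + epochCost d m L lg K / K)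

/-- A bound on the cost of the remaining guesses. -/
def guessCost (Gc E₀ : ℝ) (e₀ ell : ℕ) : ℝ := Gc * (ell - e₀) + E₀

/-- A sample is being taken, or about to be taken afresh. -/
def FreshAt (P : PolygonalCurve d n) (T : Breakpoints m) (Δ : ℝ) (k e₀ : ℕ) (Gc E₀ : ℝ) (σ : Mem)
    (v : ℝ) : Prop :=
  ∃ L ell lg K t, Guess P T Δ k e₀ L ell lg K t σ ∧ t < 4 * ell * K ∧ σ.ints 19 0 = 1 ∧
    v = doublingCost d m L ell lg K t + epochCost d m L lg K + guessCost Gc E₀ e₀ ell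

/-- The state after `u` doublings in an epoch that started with the weight `W`. -/
structure Epoch (P : PolygonalCurve d n) (T : Breakpoints m) (Δ : ℝ) (L lg K W u : ℕ)
    (σ : Mem) : Prop where
  active : σ.ints 19 0 = 0
  weight : σ.ints 16 0 = W
  doublings : σ.ints 18 0 = u
  card_le : σ.ints 1 0 ≤ 8 * (4 * K * (lg + 2))
  sound : Sound P T Δ σ
  pos : 1 ≤ W
  le : W ≤ ∑ c ∈ Finset.range (m * L), σ.ints 9 c
  growth : ((∑ c ∈ Finset.range (m * L), σ.ints 9 c : ℕ) : ℝ) ≤ W * (1 + 1 / (4 * K : ℝ)) ^ u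
  lt : u < K

/-- The potential of the current sample. -/
def potAt (P : PolygonalCurve d n) (T : Breakpoints m) (Δ : ℝ) (L lg K W : ℕ) (σ : Mem) : ℝ :=
  -- Within an epoch the mass that has been sampled is the current weight: the fresh sample takes
  -- all of it, and each doubling adds its increment.
  samplePot (m - 1) (m * L) (4 * K * (lg + 2)) W (8 * (4 * K * (lg + 2))) (Hits P T Δ L)
    (fun c => σ.ints 9 c) (σ.ints 10) (σ.ints 1 0)

/-- A sample has been taken. -/
def EpochAt (P : PolygonalCurve d n) (T : Breakpoints m) (Δ : ℝ) (k e₀ : ℕ) (Gc E₀ : ℝ) (σ : Mem)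
    (v : ℝ) : Prop :=
  ∃ L ell lg K t W u, Guess P T Δ k e₀ L ell lg K t σ ∧ t < 4 * ell * K ∧
    -- After `u` doublings the fraction `u / K` of the next epoch has been saved, each free place in
    -- the sample carries the price of an addition, and `100 * (m * L)` is kept ready for the next
    -- round.
    Epoch P T Δ L lg K W u σ ∧ v = doublingCost d m L ell lg K t + u / K * epochCost d m L lg K +
      (4 * d + 5 * m + 10) * ((8 * (4 * K * (lg + 2)) : ℕ) - σ.ints 1 0) + 100 * (m * L : ℕ) +
      epochCost d m L lg K * potAt P T Δ L lg K W σ + guessCost Gc E₀ e₀ ell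

/-- The output is complete and small. -/
def Good (P : PolygonalCurve d n) (T : Breakpoints m) (Δ : ℝ) (k : ℕ) (σ : Mem) : Prop :=
  (∃ lg, 2 ^ lg < 2 * m ∧ σ.ints 1 0 ≤ 192 * k * (lg + 2)) ∧
    ∀ z < m - 1, ∃ r < σ.ints 1 0, ∃ i j, CenterIs P T σ r i j ∧ Covered P T Δ z i j

/-- The expected cost of the main loop from `σ` on is at most `v`. -/
def CostAt (P : PolygonalCurve d n) (T : Breakpoints m) (Δ : ℝ) (k e₀ : ℕ) (Gc E₀ : ℝ) (σ : Mem)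
    (v : ℝ) : Prop :=
  FreshAt P T Δ k e₀ Gc E₀ σ v ∨ EpochAt P T Δ k e₀ Gc E₀ σ v ∨
    σ.ints 20 0 = 1 ∧ Good P T Δ k σ ∧ v = 1

theorem _root_.RealRAM.Runs.ert_le {p : Prog} {σ : Mem} {t : ℕ} {Q : Mem → Prop} (h : Runs S p σ t Q)
    {Φ : Mem → ℝ≥0∞} {v w : ℝ} (hv0 : 0 ≤ v)
    (hv : ∀ τ, S.Safe τ → Frame p σ τ → Q τ → Φ τ ≤ ENNReal.ofReal v) (hw : t + v ≤ w) :
    ert S p Φ σ ≤ ENNReal.ofReal w := by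
  refine (h Φ _ hv).trans ?_
  rw [← ENNReal.ofReal_natCast, ← ENNReal.ofReal_add (Nat.cast_nonneg _) hv0]
  exact ENNReal.ofReal_le_ofReal hw

theorem one_add_le_ofReal {x : ℝ≥0∞} {v w : ℝ} (hx : x ≤ ENNReal.ofReal v) (hv : 0 ≤ v)
    (hw : 1 + v ≤ w) : 1 + x ≤ ENNReal.ofReal w := by
  refine (add_le_add le_rfl hx).trans ?_
  rw [← ENNReal.ofReal_one, ← ENNReal.ofReal_add zero_le_one hv]
  exact ENNReal.ofReal_le_ofReal hw

/-- Halves the length bound, or outputs all segments between consecutive breakpoints. -/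
def nextP (d : ℕ) : Prog :=
  .seq (.setInt 11 (.lit 0) (.div (var 11) (.lit 2))) (.seq
    (.setInt 12 (.lit 0) (.sub (var 12) (.lit 1)))
    (.ite (.natLE (var 13) (var 11)) startP (trivialP d)))

section

variable {k e₀ L ell lg K t : ℕ} {σ τ : Mem} {Gc E₀ : ℝ}

theorem startP_guess (hS : Ample S d n m) (hσ : S.Safe σ) (hR : Ready P T Δ σ)
    (hN : Nums m k e₀ L ell lg (3 * (m / L + 1))) (h11 : σ.ints 11 0 = L) (h12 : σ.ints 12 0 = ell)
    (h13 : σ.ints 13 0 = lg) (h20 : σ.ints 20 0 = 0) :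
    Runs S startP σ (4 * (m * L) + 11) fun τ =>
      Guess P T Δ k e₀ L ell lg (3 * (m / L + 1)) 0 τ ∧ τ.ints 19 0 = 1 := by
  refine (startP_runs hS hσ hR h11 hN.card_le).mono le_rfl fun τ hτ hf h => ⟨?_, h.2.2.2.2⟩
  have hsum : ∑ c ∈ Finset.range (m * L), τ.ints 9 c = m * L := by
    rw [Finset.sum_congr rfl fun c hc => h.2.1 c (Finset.mem_range.1 hc)]; simp
  exact ⟨hN, hR.frame hf (by rintro a (rfl | rfl | rfl | rfl) <;> simp [writesI_startP])
    fun a _ => writesR_startP a, by rw [hf.ints 11 (by simp [writesI_startP]), h11],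
    by rw [hf.ints 12 (by simp [writesI_startP]), h12],
    by rw [hf.ints 13 (by simp [writesI_startP]), h13], h.1, by rw [h.2.2.1, hsum], h.2.2.2.1,
    by rw [hf.ints 20 (by simp [writesI_startP]), h20],
    ⟨fun _ => 0, fun c hc => by rw [h.2.1 c hc, pow_zero], fun _ _ _ => Nat.zero_le _⟩,
    by rw [hsum]; simp⟩

variable (d m k e₀ Gc E₀) in
/-- The bounds on the costs of guesses are large enough. -/
structure Enough : Prop where
  pos : 0 ≤ Gc
  guess : ∀ {L ell lg K}, Nums m k e₀ L ell lg K →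
    doublingCost d m L ell lg K 0 + epochCost d m L lg K + 4 * (m * L : ℕ) + 20 ≤ Gc
  final : ((4 * d + 8) * m + 20 : ℕ) ≤ E₀

theorem Enough.guessCost_nonneg (hE : Enough d m k e₀ Gc E₀) (h : e₀ ≤ ell) :
    ((4 * d + 8) * m + 20 : ℕ) ≤ guessCost Gc E₀ e₀ ell := by
  have h1 : (0 : ℝ) ≤ ell - e₀ := by
    have : (e₀ : ℝ) ≤ ell := by exact_mod_cast h
    linarith
  have := hE.final
  have := mul_nonneg hE.pos h1
  rw [guessCost]
  linarith

theorem doublingCost_nonneg (ht : t ≤ 4 * ell * K) : 0 ≤ doublingCost d m L ell lg K t := by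
  have h1 : (t : ℝ) ≤ 4 * ell * K := by exact_mod_cast ht
  have := epochCost_nonneg d m L lg K
  refine mul_nonneg (by linarith) (by positivity)

/-- The failed guess satisfies `m / L + 1 < k`, so halving `L` keeps `m / L + 1 ≤ 2k`, and the drop
of `guessCost` by `Gc` pays for the new guess. If the new bound is below `lg`, the consecutive pairs
are output instead. -/
theorem ert_nextP_le (hS : Ample S d n m) (hσ : S.Safe σ) (hE : Enough d m k e₀ Gc E₀)
    (hR : Ready P T Δ σ) (hN : Nums m k e₀ L ell lg K) (h11 : σ.ints 11 0 = L)
    (h12 : σ.ints 12 0 = ell) (h13 : σ.ints 13 0 = lg) (h20 : σ.ints 20 0 = 0)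
    (hk : m / L + 1 < k) (hk₀ : k ≤ m / 2 ^ e₀ + 1)
    (hcons : ∀ z, z + 1 < m → Covered P T Δ z z (z + 1)) {f : Mem → ℝ≥0∞}
    (hf : ∀ ρ v, S.Safe ρ → CostAt P T Δ k e₀ Gc E₀ ρ v → f ρ ≤ ENNReal.ofReal v) :
    ert S (nextP d) f σ ≤ ENNReal.ofReal (guessCost Gc E₀ e₀ ell) := by
  have hm := hN.three_le
  have hell := hN.one_le_ell
  -- At `ell = e₀` the guess would satisfy `k ≤ m / L + 1` and could not have failed.
  have hstar : e₀ ≤ ell - 1 := by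
    by_contra hcon
    have h1 : e₀ = ell := by have := hN.star; omega
    rw [h1, ← hN.pow] at hk₀
    omega
  have hL2 : L = 2 * 2 ^ (ell - 1) := by
    rw [hN.pow, ← pow_succ', Nat.sub_add_cancel hell]
  set L' := 2 ^ (ell - 1) with hL'
  have hLdiv : L / 2 = L' := by omega
  have hL'pos : 0 < L' := by rw [hL']; positivity
  have hEn := hE.guessCost_nonneg hstar
  have hstep : guessCost Gc E₀ e₀ (ell - 1) + Gc = guessCost Gc E₀ e₀ ell := by
    rw [guessCost, guessCost, Nat.cast_sub hell]; push_cast; ring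
  have hlen := hN.len_le
  have hpre : ∀ {p : Prog} {w : ℝ}, 0 ≤ w → (∀ τ, S.Safe τ → Ready P T Δ τ → τ.ints 11 0 = L' →
      τ.ints 12 0 = ell - 1 → τ.ints 13 0 = lg → τ.ints 20 0 = 0 →
      ert S p f τ ≤ ENNReal.ofReal w) →
      ert S (.seq (.setInt 11 (.lit 0) (.div (var 11) (.lit 2))) (.seq
        (.setInt 12 (.lit 0) (.sub (var 12) (.lit 1))) p)) f σ ≤ ENNReal.ofReal (w + 4) := by
    intro p w hw hp
    rw [ert]
    refine one_add_le_ofReal (v := w + 3) ?_ (by linarith) (by linarith)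
    refine (Runs.setVar hS hσ (v := L') (by norm_num) (by simp [NExp.eval, h11, hLdiv])
      (hS.le_word' (by omega))).ert_le (v := w + 2) (by linarith) (fun τ hτ hfτ h => ?_)
      (by push_cast; linarith)
    rw [ert]
    refine one_add_le_ofReal (v := w + 1) ?_ (by linarith) (by linarith)
    have hell' : ell - 1 ≤ 1000 * m := by have := hN.ell_le; have := hN.log_le_size; omega
    refine (Runs.setVar hS hτ (v := ell - 1) (by norm_num)
      (by simp [NExp.eval, h, h12, setInt_ints_ne]) (hS.le_word' hell')).ert_le (v := w)
      (by linarith) (fun ρ hρ hfρ h' => ?_) (by push_cast; linarith)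
    refine hp ρ hρ ((hR.frame hfτ (by rintro a (rfl | rfl | rfl | rfl) <;> simp [writesI])
      (by simp [writesR])).frame hfρ (by rintro a (rfl | rfl | rfl | rfl) <;> simp [writesI])
      (by simp [writesR])) ?_ ?_ ?_ ?_
    · subst h' h; simp [setInt_ints_ne]
    · subst h' h; simp
    · subst h' h; simp [setInt_ints_ne, h13]
    · subst h' h; simp [setInt_ints_ne, h20]
  by_cases hlog : lg ≤ L'
  · have hdiv : m / L' ≤ 2 * (m / L) + 1 := by
      have h1 : m / L = m / L' / 2 := by rw [hL2, mul_comm, Nat.div_div_eq_div_mul]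
      omega
    have hN' : Nums m k e₀ L' (ell - 1) lg (3 * (m / L' + 1)) :=
      ⟨hm, rfl, hlog, hN.two_le_log, hN.log_le_size, by have := hN.ell_le; omega, hN.size_le,
        hN.pow_lt, rfl, by omega, hstar⟩
    have hG := hE.guess hN'
    have h0 := doublingCost_nonneg (d := d) (m := m) (L := L') (lg := lg)
      (Nat.zero_le (4 * (ell - 1) * (3 * (m / L' + 1))))
    have h1 := epochCost_nonneg d m L' lg (3 * (m / L' + 1))
    set v := doublingCost d m L' (ell - 1) lg (3 * (m / L' + 1)) 0 +
      epochCost d m L' lg (3 * (m / L' + 1)) + guessCost Gc E₀ e₀ (ell - 1) with hv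
    have hEn0 : (0 : ℝ) ≤ guessCost Gc E₀ e₀ (ell - 1) := le_trans (Nat.cast_nonneg _) hEn
    have hM0 : (0 : ℝ) ≤ (m * L' : ℕ) := Nat.cast_nonneg _
    refine (hpre (w := 1 + ((4 * (m * L') + 11 : ℕ) + v)) (by positivity)
      fun τ hτ hRτ g11 g12 g13 g20 => ?_).trans
      (ENNReal.ofReal_le_ofReal (by push_cast at *; linarith))
    rw [ert, if_pos (by simp only [BExp.eval, NExp.eval, g11, g13]; exact hlog)]
    refine one_add_le_ofReal ((startP_guess hS hτ hRτ hN' g11 g12 g13 g20).ert_le (v := v)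
      (by positivity) (fun ρ hρ _ h => hf ρ v hρ (Or.inl ?_)) le_rfl) (by positivity) le_rfl
    refine ⟨_, _, _, _, 0, h.1, ?_, h.2, rfl⟩
    have := hN'.one_le_ell
    have := hN'.opt_pos
    positivity
  · have hEn' := hE.guessCost_nonneg hN.star
    refine (hpre (w := 1 + (((4 * d + 8) * m + 7 : ℕ) + 1)) (by positivity)
      fun τ hτ hRτ g11 g12 g13 g20 => ?_).trans
      (ENNReal.ofReal_le_ofReal (by push_cast at *; linarith))
    rw [ert, if_neg (by simp only [BExp.eval, NExp.eval, g11, g13]; exact hlog)]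
    refine one_add_le_ofReal ((trivialP_runs hS hτ hRτ).ert_le (v := 1)
      (by positivity) (fun ρ hρ _ h => hf ρ 1 hρ (Or.inr (Or.inr ⟨h.2.1, ⟨⟨lg, hN.pow_lt, ?_⟩,
        fun z hz => ⟨z, by rw [h.1]; exact hz, z, z + 1, h.2.2 z hz, hcons z (by omega)⟩⟩, rfl⟩)))
        le_rfl) (by positivity) le_rfl
    rw [h.1]
    -- The trivial output is small: `L` is below `2 * lg` and `m / L + 1` is below `k`, so `m ≤ 2 *
    -- lg * k`.
    have h1 : m < L * (m / L + 1) := Nat.lt_mul_div_succ m (by omega)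
    have h2 : L * (m / L + 1) ≤ (2 * lg) * k := Nat.mul_le_mul (by omega) hk.le
    have h3 : 2 * lg * k ≤ 192 * k * (lg + 2) := by
      calc 2 * lg * k = 2 * k * lg := by ring
        _ ≤ 192 * k * (lg + 2) := by gcongr <;> omega
    omega

end

end Subtraj

namespace Subtraj

open RealRAM

variable {d n m : ℕ} {P : PolygonalCurve d n} {T : Breakpoints m} {Δ : ℝ} {S : Limits}

/-! ## The main loop -/

/-- Takes a fresh sample. -/
def freshP (d : ℕ) : Prog :=
  .seq resetP (.seq (passP d) (.setInt 19 (.lit 0) (.lit 0)))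

/-- Counts a doubling. -/
def countP (d : ℕ) : Prog :=
  .seq (.setInt 15 (.lit 0) (.add (var 15) (var 22))) (.seq
    (.setInt 17 (.lit 0) (.add (var 17) (.lit 1)))
    (.ite (.natLE (.mul (.mul (.lit 4) (var 12)) (var 14)) (var 17)) (nextP d)
      (.seq (.setInt 18 (.lit 0) (.add (var 18) (.lit 1)))
        (.ite (.natLE (var 14) (var 18)) (.setInt 19 (.lit 0) (.lit 1)) .skip))))

/-- Looks for an uncovered element, and doubles the weights of the candidates that cover it. -/
def stepP (d : ℕ) : Prog :=
  .seq findP (.ite (.natLE (var 21) (.lit 0)) (.setInt 20 (.lit 0) (.lit 1)) (.seq weighP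
    (.ite (.natLE (.mul (.mul (.lit 4) (var 14)) (var 22)) (var 15)) (.seq (passP d) (countP d))
      (.setInt 19 (.lit 0) (.lit 1)))))

/-- The main loop. -/
def loopP (d : ℕ) : Prog :=
  .while (.natLE (var 20) (.lit 0)) (.ite (.natLE (.lit 1) (var 19)) (freshP d) (stepP d))

section

variable {k e₀ L ell lg K t W u : ℕ} {σ τ : Mem} {Gc E₀ : ℝ}

theorem Guess.setting {fr z : ℕ} (h : Guess P T Δ k e₀ L ell lg K t σ) (h16 : σ.ints 16 0 = W)
    (h19 : σ.ints 19 0 = fr) (h21 : σ.ints 21 0 = z + 1) : Setting σ L lg K W fr z :=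
  ⟨h.len, h.log, h.opt, h16, h19, h21⟩

theorem ready_passP (h : Ready P T Δ σ) (hf : Frame (passP d) σ τ) : Ready P T Δ τ :=
  h.frame hf (by rintro a (rfl | rfl | rfl | rfl) <;> simp [writesI_passP])
    fun a ha h' => by have := writesR_passP h'; omega

theorem ready_setInt (h : Ready P T Δ σ) {a i v : ℕ} (ha : 9 ≤ a) : Ready P T Δ (σ.setInt a i v) :=
  h.frame (p := .setInt a (.lit 0) (.lit 0)) (.setInt_of rfl)
    (by rintro b (rfl | rfl | rfl | rfl) <;> simp only [writesI] <;> omega) (by simp [writesR])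

/-- Half of `epochCost` covers the reset, the scan and all additions up to the limit. The other half
covers the potential of the new sample, which is at most `1/2` before the pass. -/
theorem ert_freshP_le (hS : Ample S d n m) (hσ : S.Safe σ) (hE : Enough d m k e₀ Gc E₀)
    (hG : Guess P T Δ k e₀ L ell lg K t σ) (ht : t < 4 * ell * K) (h19 : σ.ints 19 0 = 1)
    {f : Mem → ℝ≥0∞}
    (hf : ∀ ρ v, S.Safe ρ → CostAt P T Δ k e₀ Gc E₀ ρ v → f ρ ≤ ENNReal.ofReal v) :
    ert S (freshP d) f σ ≤ ENNReal.ofReal (doublingCost d m L ell lg K t +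
      epochCost d m L lg K + guessCost Gc E₀ e₀ ell - 2) := by
  classical
  have hA := hS.arrays
  have hm := hG.nums.three_le
  have hM := hG.nums.size_le_card
  have hlim := hG.nums.lim_le
  have hD := doublingCost_nonneg (d := d) (m := m) (L := L) (lg := lg) ht.le
  have hC0 := epochCost_nonneg d m L lg K
  have hG0 : 0 ≤ guessCost Gc E₀ e₀ ell :=
    le_trans (Nat.cast_nonneg _) (hE.guessCost_nonneg hG.nums.star)
  set s := 4 * K * (lg + 2) with hs
  set lim := 8 * s with hlimdef
  set D := doublingCost d m L ell lg K t with hDdef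
  set X := epochCost d m L lg K with hX
  set E := guessCost Gc E₀ e₀ ell with hEdef
  have hXval : X = 2 * (200 * (m * L : ℕ) + lim * (4 * d + 5 * m + 10)) := by
    rw [hX, epochCost, hlimdef]
  have hMreal : (6 : ℝ) ≤ (m * L : ℕ) := by exact_mod_cast (by omega : 6 ≤ m * L)
  have hMreal' : (2 * m : ℝ) ≤ (m * L : ℕ) := by exact_mod_cast hM
  have hC1 : (0 : ℝ) ≤ 4 * d + 5 * m + 10 := by positivity
  have hlC : (0 : ℝ) ≤ lim * (4 * d + 5 * m + 10) := by positivity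
  have hB0 : 0 ≤ 2 + D + 100 * (m * L : ℕ) + E := by positivity
  rw [freshP, ert]
  refine one_add_le_ofReal (v := D + X + E - 3) ?_ (by rw [hXval]; linarith) (by linarith)
  refine (resetP_runs hS hσ hG.ready).ert_le (v := 15 + 10 * (m * L : ℕ) + D + 100 * (m * L : ℕ) +
    E + (4 * d + 5 * m + 10) * lim + X / 2) (by positivity) (fun τ hτ hfτ h => ?_)
    (by rw [hXval]; push_cast at *; linarith)
  have hGτ : Guess P T Δ k e₀ L ell lg K t τ := hG.of_eq
    (hG.ready.frame hfτ (by rintro a (rfl | rfl | rfl | rfl) <;> simp [writesI_resetP])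
      fun a _ => writesR_resetP a)
    (fun c _ => by rw [hfτ.ints 9 (by simp [writesI_resetP])])
    fun a h1 h2 => hfτ.ints a (by rw [writesI_resetP]; omega)
  obtain ⟨hmk, hcnt, hW0, hu, hz⟩ := h
  have h15 := hG.total
  set W := ∑ c ∈ Finset.range (m * L), σ.ints 9 c with hW
  have hWτ : ∑ c ∈ Finset.range (m * L), τ.ints 9 c = W := by
    rw [hfτ.ints 9 (by simp [writesI_resetP])]
  have hset : Setting τ L lg K W 1 0 := hGτ.setting (by rw [hW0, h15])
    (by rw [hfτ.ints 19 (by simp [writesI_resetP]), h19]) hz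
  have hmassto : ∀ c < m * L, massTo (Sel P T Δ L 1 0) (fun _ => 0) (τ.ints 9) (m * L) c =
      (τ.ints 9 c : ℝ) := fun c hc => by simp [massTo, hc, Sel]
  rw [ert]
  refine one_add_le_ofReal (v := 14 + 10 * (m * L : ℕ) + D + 100 * (m * L : ℕ) +
    E + (4 * d + 5 * m + 10) * lim + X / 2) ?_ (by positivity) (by linarith)
  refine (ert_passP_le hS hτ hGτ.ready hset le_rfl (by simp) (hWτ ▸ hGτ.weight_pos) hs hlimdef
    (by omega) hG.nums.card_le (fun c _ => by simpa using hτ.word 9 c)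
    (fun z hz' hne => absurd (hmk z (by omega)) hne) (by rw [hcnt]; exact Nat.zero_le _)
    (a := fun _ => 0) ?_ hB0 le_rfl hC0 (Φ := ert S (.setInt 19 (.lit 0) (.lit 0)) f) ?_).trans
    (ENNReal.ofReal_le_ofReal ?_)
  · rw [Finset.sum_congr rfl fun c hc => hmassto c (Finset.mem_range.1 hc), ← Nat.cast_sum, hWτ]
    have : (0 : ℝ) ≤ W := Nat.cast_nonneg _
    linarith
  · intro ρ hρ hfρ hsound hcntρ hw
    have hwρ : ∀ c < m * L, ρ.ints 9 c = τ.ints 9 c := fun c hc => by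
      rw [hw c hc, if_pos (show Sel P T Δ L 1 0 c from Or.inl rfl)]; simp
    have hGρ : Guess P T Δ k e₀ L ell lg K t ρ := hGτ.of_eq (ready_passP hGτ.ready hfρ) hwρ
      fun a h1 h2 => hfρ.ints a (by rw [writesI_passP]; omega)
    have hWρ : ∑ c ∈ Finset.range (m * L), ρ.ints 9 c = W := by
      rw [← hWτ]; exact Finset.sum_congr rfl fun c hc => hwρ c (Finset.mem_range.1 hc)
    have hcntR : (0 : ℝ) ≤ (lim : ℝ) - ρ.ints 1 0 := by
      have : (ρ.ints 1 0 : ℝ) ≤ lim := by exact_mod_cast hcntρ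
      linarith
    have hpoteq : samplePot (m - 1) (m * L) s W lim (Hits P T Δ L)
        (massTo (Sel P T Δ L 1 0) (fun _ => 0) (τ.ints 9) (m * L)) (ρ.ints 10) (ρ.ints 1 0) =
        potAt P T Δ L lg K W ρ :=
      samplePot_congr (fun c hc => by rw [hmassto c hc, hwρ c hc]) fun _ _ => rfl
    have hpot0 : 0 ≤ potAt P T Δ L lg K W ρ := samplePot_nonneg (by
      rw [← Nat.cast_sum, hWρ]
      have : (0 : ℝ) ≤ W := Nat.cast_nonneg _
      linarith)
    rw [hpoteq]
    have hXp := mul_nonneg hC0 hpot0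
    have hCc := mul_nonneg hC1 hcntR
    refine (Runs.setVar hS hρ (v := 0) (by norm_num) rfl (Nat.zero_le _)).ert_le
      (v := D + (0 : ℕ) / K * X + (4 * d + 5 * m + 10) * ((lim : ℕ) - ρ.ints 1 0) +
        100 * (m * L : ℕ) + X * potAt P T Δ L lg K W ρ + E)
      (by simp only [Nat.cast_zero, zero_div, zero_mul]; positivity) (fun κ hκ hfκ hh => ?_)
      (by simp only [Nat.cast_zero, zero_div, zero_mul, Nat.cast_one]; linarith)
    subst hh
    refine hf _ _ hκ (Or.inr (Or.inl ⟨L, ell, lg, K, t, W, 0, hGρ.of_eq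
      (ready_setInt hGρ.ready (by norm_num)) (fun c _ => by rw [setInt_ints_ne _ _ _ (by norm_num)])
      (fun a h1 h2 => setInt_ints_ne _ _ _ (by omega)), ht, ⟨by simp,
        ?_, ?_, hcntρ, hsound.of_eq (setInt_ints_ne _ _ _ (by norm_num))
          (setInt_ints_ne _ _ _ (by norm_num)) rfl, hWτ ▸ hGτ.weight_pos, ?_, ?_,
          hG.nums.opt_pos⟩, ?_⟩))
    · rw [setInt_ints_ne _ _ _ (by norm_num), hfρ.ints 16 (by simp [writesI_passP]), hW0, h15]
    · rw [setInt_ints_ne _ _ _ (by norm_num), hfρ.ints 18 (by simp [writesI_passP]), hu]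
    · rw [setInt_ints_ne _ _ _ (by norm_num), hWρ]
    · rw [setInt_ints_ne _ _ _ (by norm_num), hWρ]; simp
    · rw [potAt, potAt, setInt_ints_ne _ _ _ (show (9 : ℕ) ≠ 19 by norm_num),
        setInt_ints_ne _ _ _ (show (10 : ℕ) ≠ 19 by norm_num),
        setInt_ints_ne _ _ _ (show (1 : ℕ) ≠ 19 by norm_num)]
  · rw [hcnt]
    have hstart := samplePot_start (N := m - 1) (M := m * L) (s := s) (W := W) (lim := lim)
      (R := Hits P T Δ L) (a := fun _ => 0) (mk := τ.ints 10) hlimdef fun _ _ => rfl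
    have := mul_le_mul_of_nonneg_left hstart hC0
    push_cast at *
    linarith

open Classical in
/-- The growth of the total weight when the weights of the candidates that cover a light element
are doubled. -/
theorem sum_double_le {M z W' : ℕ} {R : ℕ → ℕ → Prop} {w w' : ℕ → ℕ} (hK : 0 < K)
    (hW' : W' = ∑ c ∈ Finset.range M, if R z c then w c else 0)
    (hlight : 4 * K * W' ≤ ∑ c ∈ Finset.range M, w c)
    (h9 : ∀ c < M, w' c = if R z c then w c * 2 else w c) :
    ∑ c ∈ Finset.range M, w' c = (∑ c ∈ Finset.range M, w c) + W' ∧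
      ((∑ c ∈ Finset.range M, w' c : ℕ) : ℝ) ≤
        (∑ c ∈ Finset.range M, w c : ℕ) * (1 + 1 / (4 * K : ℝ)) := by
  have hK' : (0 : ℝ) < K := by exact_mod_cast hK
  have hsum : ∑ c ∈ Finset.range M, w' c = (∑ c ∈ Finset.range M, w c) + W' := by
    rw [hW', ← Finset.sum_add_distrib]
    refine Finset.sum_congr rfl fun c hc => ?_
    rw [h9 c (Finset.mem_range.1 hc)]
    split_ifs <;> omega
  refine ⟨hsum, ?_⟩
  have h1 : (4 * K * W' : ℝ) ≤ (∑ c ∈ Finset.range M, w c : ℕ) := by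
    exact_mod_cast hlight
  rw [hsum, Nat.cast_add, mul_add, mul_one, mul_one_div]
  gcongr
  rw [le_div_iff₀ (by positivity)]
  linarith

open Classical in
/-- Doubling the weights of the candidates that cover a light element. -/
theorem Guess.double {z W' : ℕ} (hG : Guess P T Δ k e₀ L ell lg K t σ) (hz : z < m - 1)
    (hR : Ready P T Δ τ)
    (hW' : W' = ∑ c ∈ Finset.range (m * L), if Hits P T Δ L z c then σ.ints 9 c else 0)
    (hlight : 4 * K * W' ≤ ∑ c ∈ Finset.range (m * L), σ.ints 9 c)
    (h9 : ∀ c < m * L, τ.ints 9 c = if Hits P T Δ L z c then σ.ints 9 c * 2 else σ.ints 9 c)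
    (h15 : τ.ints 15 0 = σ.ints 15 0 + W') (h17 : τ.ints 17 0 = t + 1)
    (hi : ∀ a, 11 ≤ a → a ≤ 14 ∨ a = 20 → τ.ints a = σ.ints a) :
    Guess P T Δ k e₀ L ell lg K (t + 1) τ := by
  obtain ⟨hsum, hgr⟩ := sum_double_le hG.nums.opt_pos hW' hlight h9
  obtain ⟨e, he, he'⟩ := hG.exponents
  refine ⟨hG.nums, hR, by rw [hi 11 (by simp) (by simp), hG.len],
    by rw [hi 12 (by simp) (by simp), hG.ell], by rw [hi 13 (by simp) (by simp), hG.log],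
    by rw [hi 14 (by simp) (by simp), hG.opt], by rw [h15, hG.total, hsum], h17,
    by rw [hi 20 (by simp) (by simp), hG.running],
    ⟨fun c => e c + if Hits P T Δ L z c then 1 else 0, fun c hc => ?_, fun H hH hhit => ?_⟩, ?_⟩
  · rw [h9 c hc, he c hc]
    by_cases hh : Hits P T Δ L z c <;> simp [hh, pow_succ]
  · rw [Finset.sum_add_distrib]
    obtain ⟨c, hc, hcz⟩ := hhit z hz
    have h1 : 1 ≤ ∑ c ∈ H, if Hits P T Δ L z c then 1 else 0 := by
      refine le_trans ?_ (Finset.single_le_sum (f := fun c => if Hits P T Δ L z c then 1 else 0)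
        (fun _ _ => Nat.zero_le _) hc)
      simp [hcz]
    exact add_le_add (he' H hH hhit) h1
  · refine hgr.trans ?_
    rw [pow_succ, ← mul_assoc]
    exact mul_le_mul_of_nonneg_right hG.growth (by positivity)

/-- The optimum is larger than `m / L + 1` if the doublings of the guess `L` are exhausted. -/
theorem Guess.lt_of_exhausted (hG : Guess P T Δ k e₀ L ell lg K (4 * ell * K) σ)
    (hhit : ∃ H ⊆ Finset.range (m * L), H.card ≤ k + 2 * (m / L + 1) ∧
      ∀ z < m - 1, ∃ c ∈ H, Hits P T Δ L z c) : m / L + 1 < k := by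
  by_contra hcon
  obtain ⟨H, hH, hcard, hz⟩ := hhit
  obtain ⟨e, he, he'⟩ := hG.exponents
  refine doublings_contradiction hG.nums.pow hG.nums.one_le_ell hG.nums.opt hH
    (by rw [hG.nums.opt]; omega) (he' H hH hz) ?_ hG.growth
  exact Finset.sum_congr rfl fun c hc => he c (Finset.mem_range.1 hc)

/-- Three outcomes: the doublings of the guess are exhausted and the next guess follows; the epoch
has had `K` doublings, and the savings `(u + 1) / K = 1` pay for a fresh one; or the epoch goes on.
-/
theorem ert_countP_le (hS : Ample S d n m) (hσ : S.Safe σ) (hE : Enough d m k e₀ Gc E₀)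
    (hk₀ : k ≤ m / 2 ^ e₀ + 1) (hcons : ∀ z, z + 1 < m → Covered P T Δ z z (z + 1))
    (hhit : ∀ L, 0 < L → ∃ H ⊆ Finset.range (m * L), H.card ≤ k + 2 * (m / L + 1) ∧
      ∀ z < m - 1, ∃ c ∈ H, Hits P T Δ L z c)
    (hR : Ready P T Δ σ) (hnums : Nums m k e₀ L ell lg K)
    (ht : t < 4 * ell * K) (hword : σ.ints 15 0 + σ.ints 22 0 ≤ S.word) (h17 : σ.ints 17 0 = t)
    -- At this point the weights are doubled but the counters are not yet updated, so the invariant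
    -- can be demanded only of memories with the new counters.
    (hG : ∀ τ, Ready P T Δ τ → τ.ints 9 = σ.ints 9 →
      τ.ints 15 0 = σ.ints 15 0 + σ.ints 22 0 → τ.ints 17 0 = t + 1 →
      (∀ a, 11 ≤ a → a ≤ 14 ∨ a = 20 → τ.ints a = σ.ints a) →
      Guess P T Δ k e₀ L ell lg K (t + 1) τ)
    (h14 : σ.ints 14 0 = K)
    (h18 : σ.ints 18 0 = u) (hu : u < K) (h19 : σ.ints 19 0 = 0)
    (h16 : σ.ints 16 0 = W) (hcnt : σ.ints 1 0 ≤ 8 * (4 * K * (lg + 2)))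
    (hsound : Sound P T Δ σ) (hWpos : 1 ≤ W)
    (hWle : W ≤ ∑ c ∈ Finset.range (m * L), σ.ints 9 c)
    (hgrow : ((∑ c ∈ Finset.range (m * L), σ.ints 9 c : ℕ) : ℝ) ≤
      W * (1 + 1 / (4 * K : ℝ)) ^ (u + 1)) {f : Mem → ℝ≥0∞}
    (hf : ∀ ρ v, S.Safe ρ → CostAt P T Δ k e₀ Gc E₀ ρ v → f ρ ≤ ENNReal.ofReal v) :
    ert S (countP d) f σ ≤ ENNReal.ofReal (9 + doublingCost d m L ell lg K (t + 1) +
      (u + 1) / K * epochCost d m L lg K +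
      (4 * d + 5 * m + 10) * ((8 * (4 * K * (lg + 2)) : ℕ) - σ.ints 1 0) + 100 * (m * L : ℕ) +
      epochCost d m L lg K * potAt P T Δ L lg K W σ + guessCost Gc E₀ e₀ ell) := by
  have hm := hnums.three_le
  have hKpos : (0 : ℝ) < K := by exact_mod_cast hnums.opt_pos
  have htd := hnums.doublings_le
  have hKm := hnums.opt_le
  have hD := doublingCost_nonneg (d := d) (m := m) (L := L) (lg := lg) (show t + 1 ≤ 4 * ell * K from ht)
  have hX0 := epochCost_nonneg d m L lg K
  have hE0 : 0 ≤ guessCost Gc E₀ e₀ ell :=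
    le_trans (Nat.cast_nonneg _) (hE.guessCost_nonneg hnums.star)
  have hC1 : (0 : ℝ) ≤ 4 * d + 5 * m + 10 := by positivity
  have hcntR : (0 : ℝ) ≤ ((8 * (4 * K * (lg + 2)) : ℕ) : ℝ) - σ.ints 1 0 := by
    have : (σ.ints 1 0 : ℝ) ≤ (8 * (4 * K * (lg + 2)) : ℕ) := by exact_mod_cast hcnt
    linarith
  have hpot0 : 0 ≤ potAt P T Δ L lg K W σ := samplePot_nonneg (by
    rw [← Nat.cast_sum]
    refine hgrow.trans ?_
    have := one_add_inv_pow_le_two hnums.opt_pos (show u + 1 ≤ K from hu)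
    have hW0 : (0 : ℝ) ≤ W := Nat.cast_nonneg _
    nlinarith)
  have hCc := mul_nonneg hC1 hcntR
  have hXp := mul_nonneg hX0 hpot0
  have hM0 : (0 : ℝ) ≤ (m * L : ℕ) := Nat.cast_nonneg _
  have huX : 0 ≤ (u + 1) / K * epochCost d m L lg K := by positivity
  set D := doublingCost d m L ell lg K (t + 1) with hDdef
  set X := epochCost d m L lg K with hX
  set E := guessCost Gc E₀ e₀ ell with hEdef
  set Y := (4 * d + 5 * m + 10) * (((8 * (4 * K * (lg + 2)) : ℕ) : ℝ) - σ.ints 1 0) with hY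
  set Z := X * potAt P T Δ L lg K W σ with hZ
  rw [countP, ert]
  refine one_add_le_ofReal (v := 8 + D + (u + 1) / K * X + Y + 100 * (m * L : ℕ) + Z + E) ?_
    (by positivity) (by linarith)
  refine (Runs.setVar hS hσ (v := σ.ints 15 0 + σ.ints 22 0) (by norm_num) (by simp [NExp.eval])
    hword).ert_le (v := 7 + D + (u + 1) / K * X + Y + 100 * (m * L : ℕ) + Z + E)
    (by positivity) (fun τ hτ hfτ h => ?_) (by push_cast; linarith)
  rw [ert]
  refine one_add_le_ofReal (v := 6 + D + (u + 1) / K * X + Y + 100 * (m * L : ℕ) + Z + E) ?_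
    (by positivity) (by linarith)
  refine (Runs.setVar hS hτ (v := t + 1) (by norm_num)
    (by subst h; simp [NExp.eval, setInt_ints_ne, h17]) (hS.le_word' (by omega))).ert_le
    (v := 5 + D + (u + 1) / K * X + Y + 100 * (m * L : ℕ) + Z + E)
    (by positivity) (fun ρ hρ hfρ h' => ?_) (by push_cast; linarith)
  have hiρ : ∀ a, a ≠ 15 → a ≠ 17 → ρ.ints a = σ.ints a := fun a h1 h2 => by
    subst h' h; rw [setInt_ints_ne _ _ _ h2, setInt_ints_ne _ _ _ h1]
  have hrρ : ρ.reals = σ.reals := by subst h' h; rfl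
  have hRρ : Ready P T Δ ρ := by
    subst h' h; exact ready_setInt (ready_setInt hR (by norm_num)) (by norm_num)
  have hGρ : Guess P T Δ k e₀ L ell lg K (t + 1) ρ := hG ρ hRρ (hiρ 9 (by simp) (by simp))
    (by subst h' h; simp [setInt_ints_ne]) (by subst h' h; simp)
    fun a h1 h2 => hiρ a (by omega) (by omega)
  rw [ert]
  refine one_add_le_ofReal (v := 4 + D + (u + 1) / K * X + Y + 100 * (m * L : ℕ) + Z + E) ?_
    (by positivity) (by linarith)
  by_cases hlast : 4 * ell * K ≤ t + 1
  · have hteq : t + 1 = 4 * ell * K := by omega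
    rw [if_pos (by simpa [BExp.eval, NExp.eval, hGρ.ell, hGρ.opt, hGρ.count] using hlast)]
    refine (ert_nextP_le hS hρ hE hRρ hnums hGρ.len hGρ.ell hGρ.log hGρ.running
      ((hteq ▸ hGρ).lt_of_exhausted (hhit L (by have := hnums.two_le; omega))) hk₀ hcons
      hf).trans (ENNReal.ofReal_le_ofReal (by linarith))
  rw [if_neg (by simpa [BExp.eval, NExp.eval, hGρ.ell, hGρ.opt, hGρ.count] using hlast), ert]
  refine one_add_le_ofReal (v := 3 + D + (u + 1) / K * X + Y + 100 * (m * L : ℕ) + Z + E) ?_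
    (by positivity) (by linarith)
  refine (Runs.setVar hS hρ (v := u + 1) (by norm_num)
    (by simp [NExp.eval, hiρ 18, h18]) (hS.le_word' (by omega))).ert_le
    (v := 2 + D + (u + 1) / K * X + Y + 100 * (m * L : ℕ) + Z + E)
    (by positivity) (fun κ hκ hfκ h'' => ?_) (by push_cast; linarith)
  have hGκ : ∀ v, Guess P T Δ k e₀ L ell lg K (t + 1) (κ.setInt 19 0 v) := fun v => by
    subst h''
    refine hGρ.of_eq (ready_setInt (ready_setInt hRρ (by norm_num)) (by norm_num))
      (fun c _ => ?_) fun a h1 h2 => ?_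
    · rw [setInt_ints_ne _ _ _ (by norm_num), setInt_ints_ne _ _ _ (by norm_num)]
    · rw [setInt_ints_ne _ _ _ (by omega), setInt_ints_ne _ _ _ (by omega)]
  have hiκ : ∀ a, a ≠ 15 → a ≠ 17 → a ≠ 18 → κ.ints a = σ.ints a := fun a h1 h2 h3 => by
    subst h''; rw [setInt_ints_ne _ _ _ h3, hiρ a h1 h2]
  have hrκ : κ.reals = σ.reals := by subst h''; exact hrρ
  have h18κ : κ.ints 18 0 = u + 1 := by subst h''; simp
  rw [ert]
  refine one_add_le_ofReal (v := 1 + D + (u + 1) / K * X + Y + 100 * (m * L : ℕ) + Z + E) ?_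
    (by positivity) (by linarith)
  by_cases hfull : K ≤ u + 1
  · rw [if_pos (by simpa [BExp.eval, NExp.eval, hiκ 14, h14, h18κ] using hfull)]
    have hKeq : (u + 1 : ℝ) / K = 1 := by
      rw [div_eq_one_iff_eq hKpos.ne']
      exact_mod_cast (by omega : u + 1 = K)
    rw [hKeq, one_mul]
    refine (Runs.setVar hS hκ (v := 1) (by norm_num) rfl (hS.le_word' (by omega))).ert_le
      (v := D + X + E) (by positivity) (fun μ hμ _ hh => ?_)
      (by rw [Nat.cast_one]; linarith)
    subst hh
    exact hf _ _ hμ (Or.inl ⟨L, ell, lg, K, t + 1, hGκ 1, by omega, by simp, rfl⟩)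
  · rw [if_neg (by simpa [BExp.eval, NExp.eval, hiκ 14, h14, h18κ] using hfull)]
    refine (Runs.skip (Q := fun τ => τ = κ) hκ rfl).ert_le
      (v := D + (u + 1) / K * X + Y + 100 * (m * L : ℕ) + Z + E) (by positivity)
      (fun μ hμ _ hh => ?_) (by push_cast; linarith)
    subst hh
    have hGμ : Guess P T Δ k e₀ L ell lg K (t + 1) μ := (hGκ 0).of_eq ?_ ?_ ?_
    refine hf _ _ hμ (Or.inr (Or.inl ⟨L, ell, lg, K, t + 1, W, u + 1, hGμ, by omega,
      ⟨by rw [hiκ 19 (by simp) (by simp) (by simp), h19],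
        by rw [hiκ 16 (by simp) (by simp) (by simp), h16], h18κ,
        by rw [hiκ 1 (by simp) (by simp) (by simp)]; exact hcnt,
        hsound.of_eq (hiκ 1 (by simp) (by simp) (by simp)) (hiκ 10 (by simp) (by simp) (by simp))
          (by rw [hrκ]), hWpos, by rw [hiκ 9 (by simp) (by simp) (by simp)]; exact hWle,
        by rw [hiκ 9 (by simp) (by simp) (by simp)]; exact hgrow, by omega⟩, ?_⟩))
    · rw [hZ, hY, potAt, potAt, hiκ 1 (by simp) (by simp) (by simp),
        hiκ 9 (by simp) (by simp) (by simp), hiκ 10 (by simp) (by simp) (by simp)]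
      push_cast
      ring
    · subst h''; exact ready_setInt hRρ (by norm_num)
    · intro c _; rw [setInt_ints_ne _ _ _ (by norm_num)]
    · intro a h1 h2; rw [setInt_ints_ne _ _ _ (by omega)]

end

end Subtraj

/-! ### Light and heavy elements, and the cost of the loop -/

namespace Subtraj

open RealRAM

variable {d n m : ℕ} {P : PolygonalCurve d n} {T : Breakpoints m} {Δ : ℝ} {S : Limits}

section

variable {k e₀ L ell lg K t W u : ℕ} {σ τ : Mem} {Gc E₀ : ℝ}

theorem doublingCost_succ : doublingCost d m L ell lg K t =
    doublingCost d m L ell lg K (t + 1) + 100 * (m * L : ℕ) + epochCost d m L lg K / K := by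
  rw [doublingCost, doublingCost]; push_cast; ring

open Classical in
/-- If an uncovered element is heavy, then the potential is large. -/
theorem one_le_potAt {z : ℕ} (hN : Nums m k e₀ L ell lg K) (hz : z < m - 1)
    (hmk : σ.ints 10 z = 0) (hWpos : 1 ≤ W) (hWle : W ≤ ∑ c ∈ Finset.range (m * L), σ.ints 9 c)
    (hmass : ((∑ c ∈ Finset.range (m * L), σ.ints 9 c : ℕ) : ℝ) ≤ 2 * W)
    (hheavy : (∑ c ∈ Finset.range (m * L), σ.ints 9 c) <
      4 * K * ∑ c ∈ Finset.range (m * L), if Hits P T Δ L z c then σ.ints 9 c else 0) :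
    1 ≤ potAt P T Δ L lg K W σ := by
  have hW : (0 : ℝ) < W := by exact_mod_cast hWpos
  have hm := hN.three_le
  have hK := hN.opt_pos
  refine one_le_samplePot hz hmk (by positivity) (by exact_mod_cast hmass) ?_
  have hval : massAt (m * L) (Hits P T Δ L) (fun c => (σ.ints 9 c : ℝ)) z =
      ((∑ c ∈ Finset.range (m * L), if Hits P T Δ L z c then σ.ints 9 c else 0 : ℕ) : ℝ) := by
    rw [massAt]; push_cast; rfl
  rw [hval]
  set w' := ∑ c ∈ Finset.range (m * L), if Hits P T Δ L z c then σ.ints 9 c else 0 with hw'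
  have h1 : (W : ℝ) ≤ 4 * K * w' := by exact_mod_cast hWle.trans hheavy.le
  -- A heavy element carries more than a `1 / (4K)` fraction of the weight, so at rate `4K(lg + 2) /
  -- W` its exponent is at least `lg + 2`, and `exp (lg + 2) ≥ 2 ^ (lg + 2) ≥ 4m`.
  have h2 : ((lg + 2 : ℕ) : ℝ) ≤ ((4 * K * (lg + 2) : ℕ) : ℝ) / W * w' := by
    rw [div_mul_eq_mul_div, le_div_iff₀ hW]
    push_cast
    nlinarith
  have h3 : (4 * m : ℝ) ≤ 2 ^ (lg + 2) := by
    have : 4 * m ≤ 2 ^ (lg + 2) := by rw [pow_add]; have := hN.size_le; omega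
    exact_mod_cast this
  have h4 : (2 : ℝ) ^ (lg + 2) ≤ Real.exp ((lg + 2 : ℕ) : ℝ) := by
    rw [← mul_one ((lg + 2 : ℕ) : ℝ), Real.exp_nat_mul]
    gcongr
    linarith [Real.add_one_le_exp 1]
  have h5 : ((m - 1 : ℕ) : ℝ) + 1 = m := by
    rw [← Nat.cast_add_one, Nat.sub_add_cancel (by omega)]
  rw [h5]
  exact h3.trans (h4.trans (Real.exp_le_exp.2 h2))

open Classical in
-- The pass samples the increments, on top of the old weights as the mass sampled before, and
-- doubles the weights. Afterwards the sampled mass is again the weight, so the potential keeps its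
-- form.
theorem ert_lightP_le (hS : Ample S d n m) (hσ : S.Safe σ) (hE : Enough d m k e₀ Gc E₀)
    (hk₀ : k ≤ m / 2 ^ e₀ + 1) (hcons : ∀ z, z + 1 < m → Covered P T Δ z z (z + 1))
    (hhit : ∀ L, 0 < L → ∃ H ⊆ Finset.range (m * L), H.card ≤ k + 2 * (m / L + 1) ∧
      ∀ z < m - 1, ∃ c ∈ H, Hits P T Δ L z c)
    (hG : Guess P T Δ k e₀ L ell lg K t σ) (ht : t < 4 * ell * K) (hep : Epoch P T Δ L lg K W u σ)
    {z : ℕ} (hz : z < m - 1) (h21 : σ.ints 21 0 = z + 1)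
    (h22 : σ.ints 22 0 = ∑ c ∈ Finset.range (m * L), if Hits P T Δ L z c then σ.ints 9 c else 0)
    (hlight : 4 * K * σ.ints 22 0 ≤ σ.ints 15 0) {f : Mem → ℝ≥0∞}
    (hf : ∀ ρ v, S.Safe ρ → CostAt P T Δ k e₀ Gc E₀ ρ v → f ρ ≤ ENNReal.ofReal v) :
    ert S (.seq (passP d) (countP d)) f σ ≤ ENNReal.ofReal (10 * (m * L : ℕ) + 14 +
      doublingCost d m L ell lg K (t + 1) + (u + 1) / K * epochCost d m L lg K +
      (4 * d + 5 * m + 10) * ((8 * (4 * K * (lg + 2)) : ℕ) - σ.ints 1 0) + 100 * (m * L : ℕ) +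
      epochCost d m L lg K * potAt P T Δ L lg K W σ + guessCost Gc E₀ e₀ ell) := by
  have hN := hG.nums
  have hm := hN.three_le
  have hword := hS.word
  have hlim := hN.lim_le
  have hWle8 := hG.weight_le ht.le
  have hW0 : (0 : ℝ) ≤ W := Nat.cast_nonneg _
  rw [hG.total] at hlight
  have hWz : σ.ints 22 0 ≤ ∑ c ∈ Finset.range (m * L), σ.ints 9 c := by
    refine le_trans ?_ hlight
    exact Nat.le_mul_of_pos_left _ (Nat.mul_pos (by norm_num) hN.opt_pos)
  have hdouble := sum_double_le (w' := fun c => if Hits P T Δ L z c then σ.ints 9 c * 2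
    else σ.ints 9 c) hN.opt_pos h22 hlight fun _ _ => rfl
  have hgrow : ∀ w' : ℕ → ℕ, (∀ c < m * L, w' c = if Hits P T Δ L z c then σ.ints 9 c * 2
      else σ.ints 9 c) → W ≤ ∑ c ∈ Finset.range (m * L), w' c ∧
      ((∑ c ∈ Finset.range (m * L), w' c : ℕ) : ℝ) ≤ W * (1 + 1 / (4 * K : ℝ)) ^ (u + 1) := by
    intro w' hw'
    rw [Finset.sum_congr rfl fun c hc => hw' c (Finset.mem_range.1 hc)]
    refine ⟨by rw [hdouble.1]; exact hep.le.trans (Nat.le_add_right _ _), hdouble.2.trans ?_⟩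
    rw [pow_succ, ← mul_assoc]
    exact mul_le_mul_of_nonneg_right hep.growth (by positivity)
  have htwo : W * (1 + 1 / (4 * K : ℝ)) ^ (u + 1) ≤ 2 * W := by
    have := one_add_inv_pow_le_two hN.opt_pos (show u + 1 ≤ K from hep.lt)
    nlinarith
  have hSel : ∀ c, Sel P T Δ L 0 z c ↔ Hits P T Δ L z c := fun c => by simp [Sel]
  have hmassto : ∀ c < m * L, massTo (Sel P T Δ L 0 z) (fun c => σ.ints 9 c) (σ.ints 9) (m * L) c =
      ((if Hits P T Δ L z c then σ.ints 9 c * 2 else σ.ints 9 c : ℕ) : ℝ) := fun c hc => by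
    by_cases hh : Hits P T Δ L z c
    · simp [massTo, hc, hSel, hh]; ring
    · simp [massTo, hc, hSel, hh]
  have hset : Setting σ L lg K W 0 z := hG.setting hep.weight hep.active h21
  have hD := doublingCost_nonneg (d := d) (m := m) (L := L) (lg := lg) (show t + 1 ≤ 4 * ell * K from ht)
  have hX0 := epochCost_nonneg d m L lg K
  have hE0 : 0 ≤ guessCost Gc E₀ e₀ ell :=
    le_trans (Nat.cast_nonneg _) (hE.guessCost_nonneg hN.star)
  have hC1 : (0 : ℝ) ≤ 4 * d + 5 * m + 10 := by positivity
  have hcntR : (0 : ℝ) ≤ ((8 * (4 * K * (lg + 2)) : ℕ) : ℝ) - σ.ints 1 0 := by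
    have : (σ.ints 1 0 : ℝ) ≤ (8 * (4 * K * (lg + 2)) : ℕ) := by exact_mod_cast hep.card_le
    linarith
  have hmassw : ((∑ c ∈ Finset.range (m * L), σ.ints 9 c : ℕ) : ℝ) ≤ 2 * W := by
    refine le_trans ?_ ((hgrow _ fun _ _ => rfl).2.trans htwo)
    exact_mod_cast Finset.sum_le_sum fun c _ => by split_ifs <;> omega
  have hpot0 : 0 ≤ potAt P T Δ L lg K W σ := samplePot_nonneg (by exact_mod_cast hmassw)
  have hCc := mul_nonneg hC1 hcntR
  have hXp := mul_nonneg hX0 hpot0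
  have huX : 0 ≤ (u + 1) / K * epochCost d m L lg K := by positivity
  set D := doublingCost d m L ell lg K (t + 1) with hDdef
  set X := epochCost d m L lg K with hX
  set E := guessCost Gc E₀ e₀ ell with hEdef
  have hB : 0 ≤ 9 + D + (u + 1) / K * X + 100 * (m * L : ℕ) + E := by positivity
  rw [ert]
  refine one_add_le_ofReal (v := 10 * (m * L : ℕ) + 4 + (9 + D + (u + 1) / K * X +
      100 * (m * L : ℕ) + E) + (4 * d + 5 * m + 10) * ((8 * (4 * K * (lg + 2)) : ℕ) - σ.ints 1 0) +
      X * potAt P T Δ L lg K W σ) ?_ (by positivity) (by linarith)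
  refine ert_passP_le hS hσ hG.ready hset (by norm_num) (fun _ => by omega) hep.pos rfl rfl
    (by omega) hN.card_le (fun c hc => ?_) hep.sound hep.card_le ?_ hB le_rfl hX0
    fun ρ hρ hfρ hsound hcnt hw => ?_
  · have : σ.ints 9 c ≤ _ := Finset.single_le_sum (f := fun c => σ.ints 9 c) (fun _ _ => Nat.zero_le _)
      (Finset.mem_range.2 hc)
    omega
  · rw [Finset.sum_congr rfl fun c hc => hmassto c (Finset.mem_range.1 hc), ← Nat.cast_sum]
    exact (hgrow _ fun _ _ => rfl).2.trans htwo
  · have hw9 : ∀ c < m * L, ρ.ints 9 c = if Hits P T Δ L z c then σ.ints 9 c * 2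
        else σ.ints 9 c := fun c hc => by
      rw [hw c hc]
      by_cases hh : Hits P T Δ L z c
      · rw [if_pos ((hSel c).2 hh), if_pos hh]
      · rw [if_neg fun h => hh ((hSel c).1 h), if_neg hh]
    have hi : ∀ a, 11 ≤ a → a ≤ 22 → ρ.ints a = σ.ints a := fun a h1 h2 =>
      hfρ.ints a (by rw [writesI_passP]; omega)
    have hpoteq : samplePot (m - 1) (m * L) (4 * K * (lg + 2)) W (8 * (4 * K * (lg + 2)))
        (Hits P T Δ L) (massTo (Sel P T Δ L 0 z) (fun c => σ.ints 9 c) (σ.ints 9) (m * L))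
        (ρ.ints 10) (ρ.ints 1 0) = potAt P T Δ L lg K W ρ :=
      samplePot_congr (fun c hc => by rw [hmassto c hc, hw9 c hc]) fun _ _ => rfl
    rw [hpoteq]
    refine (ert_countP_le (W := W) (u := u) (t := t) (L := L) (lg := lg) (ell := ell) (K := K)
      hS hρ hE hk₀ hcons hhit (ready_passP hG.ready hfρ) hN ht ?_ ?_
      (fun κ hRκ h9 h15 h17 hκ => hG.double hz hRκ h22 hlight (fun c hc => by rw [h9, hw9 c hc])
        (by rw [h15, hi 15 (by simp) (by simp), hi 22 (by simp) (by simp)]) h17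
        fun a h1 h2 => by rw [hκ a h1 h2, hi a h1 (by omega)]) ?_ ?_ hep.lt ?_ ?_ hcnt hsound
      hep.pos (hgrow _ hw9).1 (hgrow _ hw9).2 hf).trans (ENNReal.ofReal_le_ofReal (le_of_eq ?_))
    · rw [hi 15 (by simp) (by simp), hi 22 (by simp) (by simp), hG.total]
      omega
    · rw [hi 17 (by simp) (by simp), hG.count]
    · rw [hi 14 (by simp) (by simp), hG.opt]
    · rw [hi 18 (by simp) (by simp), hep.doublings]
    · rw [hi 19 (by simp) (by simp), hep.active]
    · rw [hi 16 (by simp) (by simp), hep.weight]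
    · ring

/-- If all elements are marked, the output is complete. A light unmarked element leads to a
doubling, paid for by the drop of `doublingCost`. A heavy one forces the potential to be at least 1,
which pays for a fresh sample. -/
theorem ert_stepP_le (hS : Ample S d n m) (hσ : S.Safe σ) (hE : Enough d m k e₀ Gc E₀)
    (hk₀ : k ≤ m / 2 ^ e₀ + 1) (hcons : ∀ z, z + 1 < m → Covered P T Δ z z (z + 1))
    (hhit : ∀ L, 0 < L → ∃ H ⊆ Finset.range (m * L), H.card ≤ k + 2 * (m / L + 1) ∧
      ∀ z < m - 1, ∃ c ∈ H, Hits P T Δ L z c)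
    (hG : Guess P T Δ k e₀ L ell lg K t σ) (ht : t < 4 * ell * K) (hep : Epoch P T Δ L lg K W u σ)
    {f : Mem → ℝ≥0∞}
    (hf : ∀ ρ v, S.Safe ρ → CostAt P T Δ k e₀ Gc E₀ ρ v → f ρ ≤ ENNReal.ofReal v) :
    ert S (stepP d) f σ ≤ ENNReal.ofReal (doublingCost d m L ell lg K t +
      u / K * epochCost d m L lg K +
      (4 * d + 5 * m + 10) * ((8 * (4 * K * (lg + 2)) : ℕ) - σ.ints 1 0) + 100 * (m * L : ℕ) +
      epochCost d m L lg K * potAt P T Δ L lg K W σ + guessCost Gc E₀ e₀ ell - 2) := by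
  classical
  have hN := hG.nums
  have hm := hN.three_le
  have hM := hN.size_le_card
  have hMreal : (6 : ℝ) ≤ (m * L : ℕ) := by exact_mod_cast (by omega : 6 ≤ m * L)
  have hMreal' : (2 * m : ℝ) ≤ (m * L : ℕ) := by exact_mod_cast hM
  have hW0 : (0 : ℝ) ≤ W := Nat.cast_nonneg _
  have hD := doublingCost_nonneg (d := d) (m := m) (L := L) (lg := lg) ht.le
  have hD' := doublingCost_nonneg (d := d) (m := m) (L := L) (lg := lg) (show t + 1 ≤ 4 * ell * K from ht)
  have hX0 := epochCost_nonneg d m L lg K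
  have hE0 : 0 ≤ guessCost Gc E₀ e₀ ell :=
    le_trans (Nat.cast_nonneg _) (hE.guessCost_nonneg hN.star)
  have hC1 : (0 : ℝ) ≤ 4 * d + 5 * m + 10 := by positivity
  have hcntR : (0 : ℝ) ≤ ((8 * (4 * K * (lg + 2)) : ℕ) : ℝ) - σ.ints 1 0 := by
    have : (σ.ints 1 0 : ℝ) ≤ (8 * (4 * K * (lg + 2)) : ℕ) := by exact_mod_cast hep.card_le
    linarith
  have hmassw : ((∑ c ∈ Finset.range (m * L), σ.ints 9 c : ℕ) : ℝ) ≤ 2 * W := by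
    refine hep.growth.trans ?_
    have := one_add_inv_pow_le_two hN.opt_pos hep.lt.le
    nlinarith
  have hpot0 : 0 ≤ potAt P T Δ L lg K W σ := samplePot_nonneg (by exact_mod_cast hmassw)
  have hCc := mul_nonneg hC1 hcntR
  have hXp := mul_nonneg hX0 hpot0
  have huX : 0 ≤ u / K * epochCost d m L lg K := by positivity
  have huX' : (u + 1) / K * epochCost d m L lg K = u / K * epochCost d m L lg K +
      epochCost d m L lg K / K := by ring
  have huX'' : 0 ≤ (u + 1) / K * epochCost d m L lg K := by positivity
  have hDs := doublingCost_succ (d := d) (m := m) (L := L) (ell := ell) (lg := lg) (K := K)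
    (t := t)
  have hlight := @ert_lightP_le d n m P T Δ S k e₀ L ell lg K t W u
  set D' := doublingCost d m L ell lg K (t + 1) with hD'def
  set D := doublingCost d m L ell lg K t with hDdef
  set X := epochCost d m L lg K with hX
  set E := guessCost Gc E₀ e₀ ell with hEdef
  set Y := (4 * d + 5 * m + 10) * (((8 * (4 * K * (lg + 2)) : ℕ) : ℝ) - σ.ints 1 0) with hY
  set Z := X * potAt P T Δ L lg K W σ with hZ
  rw [stepP, ert]
  refine one_add_le_ofReal (v := D + u / K * X + Y + 100 * (m * L : ℕ) + Z + E - 3) ?_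
    (by linarith) (by linarith)
  refine (findP_runs hS hσ hG.ready).ert_le (v := D + u / K * X + Y + 97 * (m * L : ℕ) + Z + E - 8)
    (by linarith) (fun τ hτ hfτ h => ?_) (by push_cast at *; linarith)
  have hi : ∀ a, a ≠ 21 → a ≠ 2 → τ.ints a = σ.ints a := fun a h1 h2 =>
    hfτ.ints a (by simp [writesI_findP, h1, h2])
  have hRτ : Ready P T Δ τ :=
    hG.ready.frame hfτ (by rintro a (rfl | rfl | rfl | rfl) <;> simp [writesI_findP])
      fun a _ => writesR_findP a
  rw [ert]
  refine one_add_le_ofReal (v := D + u / K * X + Y + 97 * (m * L : ℕ) + Z + E - 9) ?_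
    (by linarith) (by linarith)
  rcases h with ⟨h21, hmk⟩ | ⟨z, hz, h21, hmk⟩
  · rw [if_pos (by simp [BExp.eval, NExp.eval, h21])]
    refine (Runs.setVar hS hτ (v := 1) (by norm_num) rfl (hS.le_word' (by omega))).ert_le
      (v := 1) (by positivity) (fun μ hμ _ hh => hf _ _ hμ (Or.inr (Or.inr ⟨?_, ⟨⟨lg, hN.pow_lt, ?_⟩,
        fun z hz => ?_⟩, rfl⟩))) (by rw [Nat.cast_one]; linarith)
    · subst hh; simp
    · subst hh
      rw [setInt_ints_ne _ _ _ (by norm_num), hi 1 (by simp) (by simp)]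
      refine hep.card_le.trans ?_
      rw [hN.opt]
      calc 8 * (4 * (3 * (m / L + 1)) * (lg + 2)) = 96 * (m / L + 1) * (lg + 2) := by ring
        _ ≤ 96 * (2 * k) * (lg + 2) := by gcongr; exact hN.card
        _ = _ := by ring
    · obtain ⟨r, hr, i, j, hc⟩ := hep.sound z hz (hmk z hz)
      subst hh
      rw [setInt_ints_ne _ _ _ (by norm_num), hi 1 (by simp) (by simp)]
      refine ⟨r, hr, i, j, ?_, hc.2⟩
      simpa only [CenterIs, RowIs, setInt_reals, hfτ.reals 4 (writesR_findP 4)] using hc.1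
  rw [if_neg (by simp [BExp.eval, NExp.eval, h21]), ert]
  refine one_add_le_ofReal (v := D + u / K * X + Y + 97 * (m * L : ℕ) + Z + E - 10) ?_
    (by linarith) (by linarith)
  have hGτ : Guess P T Δ k e₀ L ell lg K t τ := hG.of_eq hRτ
    (fun c _ => by rw [hi 9 (by simp) (by simp)]) fun a h1 h2 => hi a (by omega) (by omega)
  have hw8 := hG.weight_le ht.le
  refine (weighP_runs hS hτ hRτ hGτ.len hN.card_le h21 (by omega) (by
      rw [hi 9 (by simp) (by simp)]; have := hS.word; omega)).ert_le
    (v := D + u / K * X + Y + 92 * (m * L : ℕ) + Z + E - 15) (by linarith) (fun ρ hρ hfρ h => ?_)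
    (by push_cast at *; linarith)
  rw [hi 9 (by simp) (by simp)] at h
  have hiρ : ∀ a, a ≠ 21 → a ≠ 2 → a ≠ 22 → ρ.ints a = σ.ints a := fun a h1 h2 h3 => by
    rw [hfρ.ints a (by simp [writesI_weighP, h2, h3]), hi a h1 h2]
  have hrρ : ρ.reals 4 = σ.reals 4 := by
    rw [hfρ.reals 4 (writesR_weighP 4), hfτ.reals 4 (writesR_findP 4)]
  have hGρ : Guess P T Δ k e₀ L ell lg K t ρ := hG.of_eq
    (hRτ.frame hfρ (by rintro a (rfl | rfl | rfl | rfl) <;> simp [writesI_weighP])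
      fun a _ => writesR_weighP a)
    (fun c _ => by rw [hiρ 9 (by simp) (by simp) (by simp)])
    fun a h1 h2 => hiρ a (by omega) (by omega) (by omega)
  have hepρ : Epoch P T Δ L lg K W u ρ :=
    ⟨by rw [hiρ 19 (by simp) (by simp) (by simp), hep.active],
      by rw [hiρ 16 (by simp) (by simp) (by simp), hep.weight],
      by rw [hiρ 18 (by simp) (by simp) (by simp), hep.doublings],
      by rw [hiρ 1 (by simp) (by simp) (by simp)]; exact hep.card_le,
      hep.sound.of_eq (hiρ 1 (by simp) (by simp) (by simp)) (hiρ 10 (by simp) (by simp) (by simp))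
        hrρ, hep.pos, by rw [hiρ 9 (by simp) (by simp) (by simp)]; exact hep.le,
      by rw [hiρ 9 (by simp) (by simp) (by simp)]; exact hep.growth, hep.lt⟩
  have hpoteq : potAt P T Δ L lg K W ρ = potAt P T Δ L lg K W σ := by
    rw [potAt, potAt, hiρ 1 (by simp) (by simp) (by simp), hiρ 9 (by simp) (by simp) (by simp),
      hiρ 10 (by simp) (by simp) (by simp)]
  rw [ert]
  refine one_add_le_ofReal (v := D + u / K * X + Y + 92 * (m * L : ℕ) + Z + E - 16) ?_
    (by linarith) (by linarith)
  by_cases hl : 4 * K * ρ.ints 22 0 ≤ ρ.ints 15 0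
  · rw [if_pos (by simpa [BExp.eval, NExp.eval, hGρ.opt] using hl)]
    refine (hlight hS hρ hE hk₀ hcons hhit hGρ ht hepρ hz
      (by rw [hfρ.ints 21 (by simp [writesI_weighP]), h21])
      (by rw [h, hiρ 9 (by simp) (by simp) (by simp)]) hl hf).trans (ENNReal.ofReal_le_ofReal ?_)
    rw [hpoteq, hiρ 1 (by simp) (by simp) (by simp), ← hY, ← hZ, huX', hDs]
    linarith
  · rw [if_neg (by simpa [BExp.eval, NExp.eval, hGρ.opt] using hl)]
    have hone : 1 ≤ potAt P T Δ L lg K W σ := one_le_potAt hN hz hmk hep.pos hep.le hmassw (by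
      rw [← h, ← hG.total, ← hiρ 15 (by simp) (by simp) (by simp)]; omega)
    have hZX : X ≤ Z := by
      have := mul_le_mul_of_nonneg_left hone hX0
      rw [mul_one] at this
      exact this
    refine (Runs.setVar hS hρ (v := 1) (by norm_num) rfl (hS.le_word' (by omega))).ert_le
      (v := D + X + E) (by positivity) (fun μ hμ _ hh => ?_) (by rw [Nat.cast_one]; linarith)
    subst hh
    refine hf _ _ hμ (Or.inl ⟨L, ell, lg, K, t, hGρ.of_eq (ready_setInt hGρ.ready (by norm_num))
      (fun c _ => ?_) (fun a h1 h2 => ?_), ht, by simp, rfl⟩)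
    · rw [setInt_ints_ne _ _ _ (by norm_num)]
    · rw [setInt_ints_ne _ _ _ (by omega)]

/-- The infimum of all bounds that `CostAt` offers at a safe memory, `⊤` where there is none, is a
pre-fixed point of the loop. -/
theorem ert_loopP_le (hS : Ample S d n m) (hE : Enough d m k e₀ Gc E₀)
    (hk₀ : k ≤ m / 2 ^ e₀ + 1) (hcons : ∀ z, z + 1 < m → Covered P T Δ z z (z + 1))
    (hhit : ∀ L, 0 < L → ∃ H ⊆ Finset.range (m * L), H.card ≤ k + 2 * (m / L + 1) ∧
      ∀ z < m - 1, ∃ c ∈ H, Hits P T Δ L z c)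
    {Φ : Mem → ℝ≥0∞} (hΦ : ∀ τ, S.Safe τ → Good P T Δ k τ → Φ τ = 0) (hσ : S.Safe σ) {v : ℝ}
    (hv : CostAt P T Δ k e₀ Gc E₀ σ v) : ert S (loopP d) Φ σ ≤ ENNReal.ofReal v := by
  classical
  set f : Mem → ℝ≥0∞ := fun τ => ⨅ (v : ℝ) (_ : S.Safe τ ∧ CostAt P T Δ k e₀ Gc E₀ τ v),
    ENNReal.ofReal v with hfdef
  have hf : ∀ ρ v, S.Safe ρ → CostAt P T Δ k e₀ Gc E₀ ρ v → f ρ ≤ ENNReal.ofReal v :=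
    fun ρ v h1 h2 => iInf₂_le v ⟨h1, h2⟩
  rw [loopP, ert]
  refine (iInf₂_le f fun τ => ?_).trans (hf σ v hσ hv)
  refine le_iInf₂ fun v hv => ?_
  obtain ⟨hτ, hv⟩ := hv
  rcases hv with ⟨L, ell, lg, K, t, hG, ht, h19, rfl⟩ |
    ⟨L, ell, lg, K, t, W, u, hG, ht, hep, rfl⟩ | ⟨h20, hgood, rfl⟩
  · have hN := hG.nums
    have hMreal : (6 : ℝ) ≤ (m * L : ℕ) := by
      have := hN.size_le_card; have := hN.three_le
      exact_mod_cast (by omega : 6 ≤ m * L)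
    have hD := doublingCost_nonneg (d := d) (m := m) (L := L) (lg := lg) ht.le
    have hX : (2 : ℝ) ≤ epochCost d m L lg K := by
      rw [epochCost]
      have : (0 : ℝ) ≤ (8 * (4 * K * (lg + 2)) : ℕ) * (4 * d + 5 * m + 10) := by positivity
      linarith
    have hE0 : 0 ≤ guessCost Gc E₀ e₀ ell :=
      le_trans (Nat.cast_nonneg _) (hE.guessCost_nonneg hN.star)
    rw [if_pos (by simp [BExp.eval, NExp.eval, hG.running]), ert,
      if_pos (by simp [BExp.eval, NExp.eval, h19])]
    exact one_add_le_ofReal (one_add_le_ofReal (ert_freshP_le hS hτ hE hG ht h19 hf)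
      (by linarith) le_rfl) (by linarith) (by linarith)
  · have hN := hG.nums
    have hMreal : (6 : ℝ) ≤ (m * L : ℕ) := by
      have := hN.size_le_card; have := hN.three_le
      exact_mod_cast (by omega : 6 ≤ m * L)
    have hW0 : (0 : ℝ) ≤ W := Nat.cast_nonneg _
    have hD := doublingCost_nonneg (d := d) (m := m) (L := L) (lg := lg) ht.le
    have hX0 := epochCost_nonneg d m L lg K
    have hE0 : 0 ≤ guessCost Gc E₀ e₀ ell :=
      le_trans (Nat.cast_nonneg _) (hE.guessCost_nonneg hN.star)
    have hcntR : (0 : ℝ) ≤ ((8 * (4 * K * (lg + 2)) : ℕ) : ℝ) - τ.ints 1 0 := by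
      have : (τ.ints 1 0 : ℝ) ≤ (8 * (4 * K * (lg + 2)) : ℕ) := by exact_mod_cast hep.card_le
      linarith
    have hmassw : ((∑ c ∈ Finset.range (m * L), τ.ints 9 c : ℕ) : ℝ) ≤ 2 * W := by
      refine hep.growth.trans ?_
      have := one_add_inv_pow_le_two hN.opt_pos hep.lt.le
      nlinarith
    have hpot0 : 0 ≤ potAt P T Δ L lg K W τ := samplePot_nonneg (by exact_mod_cast hmassw)
    have hCc := mul_nonneg (show (0 : ℝ) ≤ 4 * d + 5 * m + 10 by positivity) hcntR
    have hXp := mul_nonneg hX0 hpot0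
    have huX : 0 ≤ u / K * epochCost d m L lg K := by positivity
    rw [if_pos (by simp [BExp.eval, NExp.eval, hG.running]), ert,
      if_neg (by simp [BExp.eval, NExp.eval, hep.active])]
    exact one_add_le_ofReal (one_add_le_ofReal (ert_stepP_le hS hτ hE hk₀ hcons hhit hG ht hep hf)
      (by linarith) le_rfl) (by linarith) (by linarith)
  · rw [if_neg (by simp [BExp.eval, NExp.eval, h20]), hΦ τ hτ hgood]
    simp

end

end Subtraj

/-! ### Initialization and the bound for the whole program -/

namespace Subtraj

open RealRAM

/-! ## The whole program -/

/-- Stores the least power of two that is at least `m` in variable `11`, its exponent in variables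
`12` and `13`, and initializes the weights. -/
def initP : Prog :=
  .seq (.setInt 11 (.lit 0) (.lit 1)) (.seq (.setInt 13 (.lit 0) (.lit 0)) (.seq
    (forP 2 mE (.ite (.natLE (.add (var 11) (.lit 1)) mE)
      (.seq (.setInt 11 (.lit 0) (.mul (.lit 2) (var 11)))
        (.setInt 13 (.lit 0) (.add (var 13) (.lit 1)))) .skip))
    (.seq (.setInt 12 (.lit 0) (var 13)) startP)))

/-- Computes the tables and initializes the weights. -/
def prepareP (d : ℕ) : Prog := .seq edgeP (.seq (reachP d) (.seq (tableP d) initP))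

/-- The program. -/
def clusterP (d : ℕ) : Prog := .seq (prepareP d) (loopP d)

variable {d n m k : ℕ} {P : PolygonalCurve d n} {T : Breakpoints m} {Δ : ℝ} {S : Limits}
  {σ : Mem}

/-- The first guess is a power of two between `m` and `2m`, so `m / L + 1 ≤ 2`, which is at most
`2k`. -/
theorem exists_nums (hm : 3 ≤ m) (hk : 1 ≤ k) {lg : ℕ} (h1 : lg ≤ m) (h2 : m ≤ 2 ^ lg)
    (h3 : 2 ^ lg < 2 * m) : Nums m k (lg - (Nat.clog 2 k + 1)) (2 ^ lg) lg lg
      (3 * (m / 2 ^ lg + 1)) := by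
  refine ⟨hm, rfl, Nat.lt_two_pow_self.le, ?_, h1, le_rfl, h2, h3, rfl, ?_, Nat.sub_le _ _⟩
  · by_contra hlt
    have : 2 ^ lg ≤ 2 ^ 1 := Nat.pow_le_pow_right (by norm_num) (by omega)
    omega
  · have : m / 2 ^ lg ≤ 1 := by
      calc m / 2 ^ lg ≤ 2 ^ lg / 2 ^ lg := Nat.div_le_div_right h2
        _ = 1 := Nat.div_self (by positivity)
    omega

/-- With `e₀` equal to `lg - clog k - 1`, the product `k * 2 ^ e₀` is at most `2 ^ (lg - 1)`, which
is below `m`. If the subtraction is truncated, `e₀ = 0` and `k < m` suffices. -/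
theorem le_div_two_pow_sub (hk : k < m) {lg : ℕ} (h : 2 ^ lg < 2 * m) :
    k ≤ m / 2 ^ (lg - (Nat.clog 2 k + 1)) + 1 := by
  rcases Nat.lt_or_ge lg (Nat.clog 2 k + 1) with hlt | hge
  · rw [Nat.sub_eq_zero_of_le hlt.le]; simp; omega
  · refine le_trans ?_ (Nat.le_succ _)
    rw [Nat.le_div_iff_mul_le (by positivity)]
    have h1 : k ≤ 2 ^ Nat.clog 2 k := Nat.le_pow_clog (by norm_num) k
    have h2 : 2 ^ lg = 2 * (2 ^ Nat.clog 2 k * 2 ^ (lg - (Nat.clog 2 k + 1))) := by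
      rw [← pow_add, ← pow_succ']; congr 1; omega
    have h3 := Nat.mul_le_mul_right (2 ^ (lg - (Nat.clog 2 k + 1))) h1
    omega

theorem initP_runs (hS : Ample S d n m) (hσ : S.Safe σ) (hR : Ready P T Δ σ)
    (hk : 1 ≤ k) (h20 : σ.ints 20 0 = 0) :
    Runs S initP σ (14 * m ^ 2 + 30) fun τ => ∃ lg, 2 ^ lg < 2 * m ∧
      Guess P T Δ k (lg - (Nat.clog 2 k + 1)) (2 ^ lg) lg lg (3 * (m / 2 ^ lg + 1)) 0 τ ∧
      τ.ints 19 0 = 1 := by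
  have hA := hS.arrays
  have hm := hS.two_le
  refine (Runs.seq (Runs.setVar hS hσ (v := 1) (by norm_num) (by simp [NExp.eval])
      (hS.le_word' (by omega))) fun τ hτ hf h1 =>
    Runs.seq (Runs.setVar hS hτ (v := 0) (by norm_num) (by simp [NExp.eval]) (Nat.zero_le _))
      fun ρ hρ hf' h2 => Runs.seq (Runs.forP (T := 4) m (fun j κ => ∃ lg, κ.ints 11 0 = 2 ^ lg ∧
        κ.ints 13 0 = lg ∧ lg ≤ j ∧ 2 ^ lg < 2 * m ∧ (m ≤ 2 ^ lg ∨ lg = j)) hρ (by omega)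
        hS.len_pos (hS.le_word' (by omega)) (fun κ hκ => ?_) (by simp [writesI]) ?_ ?_)
        fun κ hκ hf2 ⟨lg, h11, h13, hlg, hpow, hor⟩ => (Runs.seq (Runs.setVar hS hκ (v := lg)
          (by norm_num) (by simp [NExp.eval, h13]) (hS.le_word' (by omega)))
          fun π hπ hf3 h3 => ?_ : Runs S _ _ (1 + 1 + (4 * (m * (2 * m)) + 11)) _)).le ?_
  · have hmE : ρ.ints 0 1 = m := by
      rw [hf'.ints 0 (by simp [writesI]), hf.ints 0 (by simp [writesI]), hR.input.mE]
    simp [NExp.eval, hκ.ints 0 (by simp [writesI, writesI_forP]), hmE]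
  · subst h2 h1
    exact ⟨0, by simp [Mem.setInt], by simp [Mem.setInt], le_rfl, by simp; omega, Or.inr rfl⟩
  · rintro j hj κ hκ hfκ - ⟨lg, h11, h13, hlg, hpow, hor⟩
    have hmE : κ.ints 0 1 = m := by
      rw [hfκ.ints 0 (by simp [writesI, writesI_forP]), hf'.ints 0 (by simp [writesI]),
        hf.ints 0 (by simp [writesI]), hR.input.mE]
    refine (Runs.ite (T := 3) (T' := 1) (fun hb => ?_) fun hb => Runs.skip hκ ?_).le (by omega)
    · have hb' : 2 ^ lg + 1 ≤ m := by simpa [BExp.eval, NExp.eval, h11, hmE] using hb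
      refine (Runs.seq (Runs.setVar hS hκ (v := 2 ^ (lg + 1)) (by norm_num)
        (by simp [NExp.eval, h11, pow_succ']) (hS.le_word' (by rw [pow_succ']; omega)))
        fun π hπ hfπ hπ' => (Runs.setVar hS hπ (v := lg + 1) (by norm_num)
          (by subst hπ'; simp [NExp.eval, h13, setInt_ints_ne]) (hS.le_word' (by omega))).mono
          le_rfl fun ξ _ _ hξ => ⟨lg + 1, ?_, ?_, by omega, by rw [pow_succ']; omega, ?_⟩).le
        (by omega)
      · subst hξ hπ'; simp [setInt_ints_ne]
      · subst hξ hπ'; simp [setInt_ints_ne]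
      · rcases hor with h | h
        · omega
        · exact Or.inr (by omega)
    · have hb' : ¬ 2 ^ lg + 1 ≤ m := by simpa [BExp.eval, NExp.eval, h11, hmE] using hb
      exact ⟨lg, by rw [setInt_ints_ne _ _ _ (by norm_num), h11],
        by rw [setInt_ints_ne _ _ _ (by norm_num), h13], by omega, hpow, Or.inl (by omega)⟩
  -- If every one of the `m` rounds doubled, then `lg = m`, and `m ≤ 2 ^ m` anyway.
  · have hsize : m ≤ 2 ^ lg := by
      rcases hor with h | h
      · exact h
      · rw [h]; exact Nat.lt_two_pow_self.le
    have hRπ : Ready P T Δ π := by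
      refine (((hR.frame hf ?_ (by simp [writesR])).frame hf' ?_ (by simp [writesR])).frame hf2 ?_
        (by simp [writesR, writesR_forP])).frame hf3 ?_ (by simp [writesR]) <;>
      · rintro a (rfl | rfl | rfl | rfl) <;> simp [writesI, writesI_forP]
    have h20' : π.ints 20 0 = 0 := by
      rw [hf3.ints 20 (by simp [writesI]), hf2.ints 20 (by simp [writesI, writesI_forP]),
        hf'.ints 20 (by simp [writesI]), hf.ints 20 (by simp [writesI]), h20]
    refine (startP_guess hS hπ hRπ (exists_nums hm hk hlg hsize hpow)
      (by rw [hf3.ints 11 (by simp [writesI]), h11]) (by subst h3; simp)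
      (by rw [hf3.ints 13 (by simp [writesI]), h13]) h20').mono ?_
      fun ξ _ _ h => ⟨lg, hpow, h⟩
    have := Nat.mul_le_mul_left m hpow.le
    omega
  · nlinarith

theorem prepareP_runs (hS : Ample S d n m) (hσ : S.Safe σ) (hΔ : 0 ≤ Δ) (hin : HasInput P T Δ σ)
    (h0 : ∀ a i, 5 ≤ a → σ.ints a i = 0) (hk : 1 ≤ k) :
    Runs S (prepareP d) σ (300 * (m ^ 2 * n)) fun τ => ∃ lg, 2 ^ lg < 2 * m ∧
      Guess P T Δ k (lg - (Nat.clog 2 k + 1)) (2 ^ lg) lg lg (3 * (m / 2 ^ lg + 1)) 0 τ ∧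
      τ.ints 19 0 = 1 := by
  have hm := hS.two_le
  have hn := P.two_le
  refine (Runs.seq (T' := 1 + (((8 * n + 14) * m + 8) * m + 3) + (1 + ((8 * m + 6) * m + 3) +
    (14 * m ^ 2 + 30))) (edgeP_runs hS hσ hin) fun τ hτ hf he => ?_).le ?_
  · have hinτ : HasInput P T Δ τ := hin.frame hf (by simp [edgeP, writesI, writesI_forP])
      (by simp [edgeP, writesR, writesR_forP])
    refine Runs.seq (reachP_runs hS hτ hinτ hΔ he) fun ρ hρ hf' hD => ?_
    have hinρ : HasInput P T Δ ρ := hinτ.frame hf' (by simp [writesI_reachP])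
      fun a ha h => by rw [writesR_reachP] at h; omega
    have hzero : ∀ a, 7 ≤ a → a ≠ 24 → ∀ i, ρ.ints a i = 0 := fun a ha ha' i => by
      rw [hf'.ints a (by simp only [writesI_reachP]; omega),
        hf.ints a (by simp [edgeP, writesI, writesI_forP]; omega), h0 a i (by omega)]
    refine Runs.seq (tableP_runs hS hρ hinρ hΔ (fun x hx => ?_) hD (hzero 7 (by omega) (by omega))
      (hzero 8 (by omega) (by omega))) fun π hπ hf2 hR => initP_runs hS hπ hR hk ?_
    · rw [EdgeAt, hf'.ints 5 (by simp [writesI_reachP])]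
      exact he x hx
    · rw [hf2.ints 20 (by simp [writesI_tableP]), hzero 20 (by omega) (by omega)]
  · have h1 : 3 * m ≤ m ^ 2 := by nlinarith
    have h2 : m ^ 2 * 2 ≤ m ^ 2 * n := Nat.mul_le_mul_left _ hn
    have h3 : m * n ≤ m ^ 2 * n := Nat.mul_le_mul_right _ (by omega)
    have h4 : (n - 1) * m ≤ n * m := Nat.mul_le_mul_right _ (Nat.sub_le _ _)
    nlinarith

/-- The exponents run from `lg` down to no less than `lg - clog k - 1`. Hence at most `clog k + 2`
guesses are made, at cost `Gc` each. -/
theorem ert_clusterP_le (hS : Ample S d n m) (hσ : S.Safe σ) (hΔ : 0 ≤ Δ) (hin : HasInput P T Δ σ)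
    (h0 : ∀ a i, 5 ≤ a → σ.ints a i = 0) (hk : 1 ≤ k) (hkm : k < m) {Copt : Finset (Center d 2)}
    (hcard : Copt.card ≤ k) (hcost : clusterCost P T Copt ≤ ENNReal.ofReal Δ) {Gc E₀ : ℝ}
    (hE : ∀ e₀, Enough d m k e₀ Gc E₀) {Φ : Mem → ℝ≥0∞}
    (hΦ : ∀ τ, S.Safe τ → Good P T Δ k τ → Φ τ = 0) :
    ert S (clusterP d) Φ σ ≤
      ENNReal.ofReal (Gc * (Nat.clog 2 k + 2) + E₀ + 301 * (m ^ 2 * n : ℕ)) := by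
  have hm := hS.two_le
  have hn := P.two_le
  have hE0 : (0 : ℝ) ≤ E₀ := le_trans (Nat.cast_nonneg _) (hE 0).final
  have hpos : 0 ≤ Gc * (Nat.clog 2 k + 2) + E₀ :=
    add_nonneg (mul_nonneg (hE 0).pos (by positivity)) hE0
  have hloop : ∀ τ, S.Safe τ → (∃ lg, 2 ^ lg < 2 * m ∧
      Guess P T Δ k (lg - (Nat.clog 2 k + 1)) (2 ^ lg) lg lg (3 * (m / 2 ^ lg + 1)) 0 τ ∧
      τ.ints 19 0 = 1) → ert S (loopP d) Φ τ ≤ ENNReal.ofReal (Gc * (Nat.clog 2 k + 2) + E₀) := by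
    rintro τ hτ ⟨lg, hpow, hG, h19⟩
    have hN := hG.nums
    have hell := hN.one_le_ell
    refine (ert_loopP_le hS (hE _) (le_div_two_pow_sub hkm hpow)
      (fun z hz => covered_consecutive hΔ hcost hz) (fun L hL => ?_) hΦ hτ
      (Or.inl ⟨_, _, _, _, _, hG, ?_, h19, rfl⟩)).trans (ENNReal.ofReal_le_ofReal ?_)
    · obtain ⟨H, h1, h2, h3⟩ := exists_hitting_set hΔ hcost hL
      exact ⟨H, h1, by omega, h3⟩
    · positivity
    · have h1 := (hE (lg - (Nat.clog 2 k + 1))).guess hN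
      have h2 : (0 : ℝ) ≤ 4 * (m * 2 ^ lg : ℕ) + 20 := by positivity
      have h3 : (lg : ℝ) - (lg - (Nat.clog 2 k + 1) : ℕ) ≤ Nat.clog 2 k + 1 := by
        have : lg ≤ (lg - (Nat.clog 2 k + 1)) + (Nat.clog 2 k + 1) := by omega
        have : (lg : ℝ) ≤ ((lg - (Nat.clog 2 k + 1) : ℕ) : ℝ) + (Nat.clog 2 k + 1) := by
          exact_mod_cast this
        linarith
      have h4 := mul_le_mul_of_nonneg_left h3 (hE 0).pos
      rw [guessCost]
      linarith
  rw [clusterP, ert]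
  refine one_add_le_ofReal ((prepareP_runs hS hσ hΔ hin h0 hk).ert_le hpos
    (fun τ hτ _ h => hloop τ hτ h) le_rfl) (by positivity) ?_
  have : (1 : ℝ) ≤ (m ^ 2 * n : ℕ) := by
    exact_mod_cast Nat.one_le_iff_ne_zero.2 (mul_ne_zero (pow_ne_zero 2 (by omega)) (by omega))
  rw [Nat.cast_mul 300, Nat.cast_ofNat]
  linarith

end Subtraj

namespace Subtraj

open RealRAM

/-! ## The resource bounds -/

/-- `log 3 = 1 + log (3 / e) ≥ 2 - e / 3`. -/
theorem log_three_ge : (1.09 : ℝ) ≤ Real.log 3 := by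
  have h1 : Real.log 3 = 1 + Real.log (3 / Real.exp 1) := by
    rw [Real.log_div (by norm_num) (Real.exp_ne_zero _), Real.log_exp]; ring
  have h2 := Real.one_sub_inv_le_log_of_pos (x := 3 / Real.exp 1) (by positivity)
  rw [inv_div] at h2
  have h3 := Real.exp_one_lt_d9
  rw [h1]
  linarith

variable {d n m k : ℕ}

theorem log_size_ge (hm : 3 ≤ m) : (1.09 : ℝ) ≤ Real.log m :=
  log_three_ge.trans (Real.log_le_log (by norm_num) (by exact_mod_cast hm))

/-- Since `m ≥ 3` gives `log m > 1`, the iterated logarithm is bounded away from 0 even for `k = 1`,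
so additive constants can be absorbed. The value comes from `log 1.09 ≥ 1 - 1 / 1.09`. -/
theorem log_mul_log_ge (hm : 3 ≤ m) (hk : 1 ≤ k) : (0.08 : ℝ) ≤ Real.log (k * Real.log m) := by
  have h1 := log_size_ge hm
  have h2 : (1 : ℝ) ≤ k := by exact_mod_cast hk
  have h3 : (1.09 : ℝ) ≤ k * Real.log m := by nlinarith
  have h4 := Real.one_sub_inv_le_log_of_pos (x := 1.09) (by norm_num)
  have h5 := Real.log_le_log (by norm_num) h3
  norm_num at h4 h5 ⊢
  linarith

theorem log_le_log_mul_log (hm : 3 ≤ m) (hk : 1 ≤ k) :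
    Real.log k ≤ Real.log (k * Real.log m) := by
  have h1 := log_size_ge hm
  have h2 : (1 : ℝ) ≤ k := by exact_mod_cast hk
  exact Real.log_le_log (by linarith) (by nlinarith)

/-- Taking logarithms leaves the factor `1 / log 2`, which is less than `1.5`. -/
theorem cast_le_log_of_two_pow_lt {c x : ℕ} (hx : 1 ≤ x) (h : 2 ^ c < 2 * x) :
    (c : ℝ) ≤ 1 + 1.5 * Real.log x := by
  have h0 : (0 : ℝ) < x := by exact_mod_cast hx
  have h1 : ((2 : ℝ) ^ c) ≤ 2 * x := by exact_mod_cast h.le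
  have h2 := Real.log_le_log (by positivity) h1
  rw [Real.log_pow, Real.log_mul (by norm_num) h0.ne'] at h2
  have h3 := Real.log_two_gt_d9
  have h4 : 0 ≤ Real.log x := Real.log_nonneg (by exact_mod_cast hx)
  nlinarith

theorem clog_le_log (hk : 1 ≤ k) : (Nat.clog 2 k : ℝ) ≤ 1 + 1.5 * Real.log k := by
  refine cast_le_log_of_two_pow_lt hk ?_
  rcases Nat.eq_zero_or_pos (Nat.clog 2 k) with h | h
  · rw [h]; omega
  · have hk2 : 1 < k := by
      by_contra hle
      rw [show k = 1 by omega, Nat.clog_one_right] at h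
      omega
    have := Nat.pow_pred_clog_lt_self (b := 2) (by norm_num) hk2
    obtain ⟨c, hc⟩ := Nat.exists_eq_succ_of_ne_zero h.ne'
    rw [hc] at this ⊢
    rw [Nat.pred_succ] at this
    rw [pow_succ']
    omega

/-- The bound on the output size. -/
theorem card_le_sizeBound (hm : 3 ≤ m) (hk : 1 ≤ k) {lg N : ℕ} (hlg : 2 ^ lg < 2 * m)
    (hN : N ≤ 192 * k * (lg + 2)) : (N : ℝ) ≤ 12000 * sizeBound m k := by
  have h1 := cast_le_log_of_two_pow_lt (by omega) hlg
  have h2 := log_size_ge hm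
  have h3 := log_mul_log_ge hm hk
  have hk0 : (0 : ℝ) < k := by exact_mod_cast hk
  have h4 : (N : ℝ) ≤ 192 * k * (lg + 2) := by exact_mod_cast hN
  have h5 : (lg + 2 : ℝ) ≤ 5 * Real.log m := by linarith
  have h6 : 0 ≤ k * Real.log m := by positivity
  -- The constant is `192 * 5 / 0.08`, with `0.08` the lower bound for the iterated logarithm.
  calc (N : ℝ) ≤ 192 * k * (lg + 2) := h4
    _ ≤ 192 * k * (5 * Real.log m) := by gcongr
    _ = 12000 * (k * Real.log m * 0.08) := by ring
    _ ≤ 12000 * (k * Real.log m * Real.log (k * Real.log m)) := by gcongr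

theorem sizeBound_nonneg (hm : 3 ≤ m) (hk : 1 ≤ k) : 0 ≤ sizeBound m k := by
  have h3 := log_mul_log_ge hm hk
  have h2 := log_size_ge hm
  rw [sizeBound]
  positivity

/-- If `k² ≤ m`, then `log (m / k) ≥ log m / 2` and `1 + log k ≤ k`, so the summand `m` of the
second factor suffices. Otherwise `log (m / k) ≥ 1 - k / m` gives `m k² log (m / k) ≥ k² (m - k) ≥
m² / 4`, also for `k` close to `m` as `m - k ≥ 1`, and the summand `sizeBound` supplies the
logarithms. -/
theorem sq_mul_log_le (hm : 3 ≤ m) (hk : 1 ≤ k) (hkm : k < m) :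
    (m : ℝ) ^ 2 * Real.log m * (1 + Real.log k) ≤
      10 * (m * k * Real.log (m / k) * (sizeBound m k + m)) := by
  have hlm := log_size_ge hm
  have hk1 : (1 : ℝ) ≤ k := by exact_mod_cast hk
  have hm3 : (3 : ℝ) ≤ m := by exact_mod_cast hm
  have hkmR : (k : ℝ) + 1 ≤ m := by exact_mod_cast hkm
  have hlk : 0 ≤ Real.log k := Real.log_nonneg hk1
  have hratio : Real.log (m / k) = Real.log m - Real.log k :=
    Real.log_div (by positivity) (by positivity)
  have hr0 : 0 ≤ Real.log (m / k) := Real.log_nonneg (by rw [le_div_iff₀ (by positivity)]; linarith)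
  have hs := sizeBound_nonneg hm hk
  have hpre : 0 ≤ m * k * Real.log (m / k) := by positivity
  rcases le_or_gt (k ^ 2) m with hsq | hsq
  · have h1 : 2 * Real.log k ≤ Real.log m := by
      have := Real.log_le_log (by positivity) (show ((k : ℝ) ^ 2) ≤ m by exact_mod_cast hsq)
      rwa [Real.log_pow, Nat.cast_ofNat] at this
    have h2 : Real.log m / 2 ≤ Real.log (m / k) := by linarith
    have h3 : 1 + Real.log k ≤ k := by
      have := Real.log_le_sub_one_of_pos (show (0 : ℝ) < k by positivity)
      linarith
    calc (m : ℝ) ^ 2 * Real.log m * (1 + Real.log k) ≤ m ^ 2 * Real.log m * k := by gcongr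
      _ = 2 * (m * k * (Real.log m / 2) * m) := by ring
      _ ≤ 2 * (m * k * Real.log (m / k) * m) := by gcongr
      _ ≤ 2 * (m * k * Real.log (m / k) * (sizeBound m k + m)) := by gcongr; linarith
      _ ≤ _ := by
        refine mul_le_mul_of_nonneg_right (by norm_num) (mul_nonneg hpre ?_)
        linarith
  · have hk2 : (2 : ℝ) ≤ k := by
      have : 2 ≤ k := by
        by_contra h
        rw [show k = 1 by omega] at hsq
        omega
      exact_mod_cast this
    have hsqR : (m : ℝ) ≤ k ^ 2 := by exact_mod_cast hsq.le
    have h1 : 1 - k / m ≤ Real.log (m / k) := by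
      have := Real.one_sub_inv_le_log_of_pos (x := (m / k : ℝ)) (by positivity)
      rwa [inv_div] at this
    have h2 : (m : ℝ) ^ 2 / 4 ≤ m * k * Real.log (m / k) * k := by
      have h3 : m * k * (1 - k / m) * k ≤ m * k * Real.log (m / k) * k := by gcongr
      refine le_trans ?_ h3
      have h4 : (m : ℝ) * k * (1 - k / m) * k = k ^ 2 * (m - k) := by
        field_simp
      rw [h4]
      rcases le_or_gt (2 * (k : ℝ)) m with hh | hh
      · nlinarith [mul_le_mul_of_nonneg_left (show (m : ℝ) / 2 ≤ m - k by linarith)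
          (sq_nonneg (k : ℝ))]
      · nlinarith [mul_le_mul_of_nonneg_left (show (1 : ℝ) ≤ m - k by linarith)
          (sq_nonneg (k : ℝ))]
    have h3 : 0.69 ≤ Real.log k := by
      have := Real.log_le_log (by norm_num) hk2
      have := Real.log_two_gt_d9
      linarith
    have h4 := log_le_log_mul_log hm hk
    have h5 : 1 + Real.log k ≤ 2.5 * Real.log (k * Real.log m) := by linarith
    calc (m : ℝ) ^ 2 * Real.log m * (1 + Real.log k)
        ≤ m ^ 2 * Real.log m * (2.5 * Real.log (k * Real.log m)) := by gcongr
      _ = 10 * (m ^ 2 / 4 * (Real.log m * Real.log (k * Real.log m))) := by ring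
      _ ≤ 10 * (m * k * Real.log (m / k) * k * (Real.log m * Real.log (k * Real.log m))) := by
        have : 0 ≤ Real.log m * Real.log (k * Real.log m) :=
          mul_nonneg (by linarith) (by linarith)
        gcongr
      _ = 10 * (m * k * Real.log (m / k) * sizeBound m k) := by rw [sizeBound]; ring
      _ ≤ _ := by gcongr; linarith

/-- The scans of `K` doublings take time proportional to `K * m * L`, thus `O(m²)` independently of
`L`. So all guesses have the same bound. -/
theorem Nums.opt_mul_len_le {e₀ L ell lg K : ℕ} (h : Nums m k e₀ L ell lg K) : K * L ≤ 9 * m := by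
  have h1 : m / L * L ≤ m := Nat.div_mul_le_self m L
  have h2 := h.len_le
  rw [h.opt]
  calc 3 * (m / L + 1) * L = 3 * (m / L * L) + 3 * L := by ring
    _ ≤ 9 * m := by omega

theorem epochCost_le {e₀ L ell lg K : ℕ} (h : Nums m k e₀ L ell lg K) :
    epochCost d m L lg K ≤ 2600 * (d + 3) * m ^ 2 := by
  have h1 : ((m * L : ℕ) : ℝ) ≤ 2 * m ^ 2 := by exact_mod_cast h.card_le
  have h2 : ((8 * (4 * K * (lg + 2)) : ℕ) : ℝ) ≤ 384 * m := by exact_mod_cast h.lim_le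
  have h3 : (3 : ℝ) ≤ m := by exact_mod_cast h.three_le
  have hd : (0 : ℝ) ≤ d := Nat.cast_nonneg d
  calc epochCost d m L lg K
      ≤ 2 * (200 * (2 * m ^ 2) + 384 * m * (4 * d + 5 * m + 10)) := by rw [epochCost]; gcongr
    _ ≤ 2600 * (d + 3) * m ^ 2 := by
      nlinarith [mul_nonneg (mul_nonneg hd (show (0 : ℝ) ≤ m by linarith))
        (show (0 : ℝ) ≤ m - 3 by linarith)]

/-- A guess pays for at most `4 * ell` rounds of `K` doublings, each round with its scans and an
epoch costing `O((d + 3) m²)`, and `ell ≤ 2.5 log m`. -/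
theorem enough (hm : 3 ≤ m) (e₀ : ℕ) : Enough d m k e₀ (60000 * (d + 3) * m ^ 2 * Real.log m)
    ((4 * d + 8) * m + 20 : ℕ) := by
  have hlm := log_size_ge hm
  refine ⟨by positivity, fun {L ell lg K} h => ?_, le_rfl⟩
  have h1 : ((m * L : ℕ) : ℝ) ≤ 2 * m ^ 2 := by exact_mod_cast h.card_le
  have h3 : (3 : ℝ) ≤ m := by exact_mod_cast h.three_le
  have hX := epochCost_le (d := d) h
  have hX0 := epochCost_nonneg d m L lg K
  have hK : (0 : ℝ) < K := by exact_mod_cast h.opt_pos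
  have hlg : (ell : ℝ) ≤ 2.5 * Real.log m := by
    have h4 := cast_le_log_of_two_pow_lt (by omega) h.pow_lt
    have h5 : (ell : ℝ) ≤ lg := by exact_mod_cast h.ell_le
    linarith
  have hKL : (K * L : ℝ) ≤ 9 * m := by exact_mod_cast h.opt_mul_len_le
  have h6 : doublingCost d m L ell lg K 0 =
      4 * ell * (100 * m * (K * L) + epochCost d m L lg K) := by
    rw [doublingCost]; push_cast; field_simp; ring
  have hd : (0 : ℝ) ≤ d := Nat.cast_nonneg d
  have h7 : 100 * m * (K * L) + epochCost d m L lg K ≤ 2900 * (d + 3) * (m : ℝ) ^ 2 := by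
    have : 100 * m * (K * L : ℝ) ≤ 100 * m * (9 * m) := by gcongr
    nlinarith [mul_nonneg hd (sq_nonneg (m : ℝ))]
  have hQ : 0 ≤ (d + 3) * (m : ℝ) ^ 2 := by positivity
  have h8 : doublingCost d m L ell lg K 0 ≤
      4 * (2.5 * Real.log m) * (2900 * (d + 3) * (m : ℝ) ^ 2) := by rw [h6]; gcongr
  have h9 : (d + 3) * (m : ℝ) ^ 2 ≤ (d + 3) * (m : ℝ) ^ 2 * Real.log m := by nlinarith
  nlinarith [mul_nonneg hd (sq_nonneg (m : ℝ))]

/-- The bound on the running time. -/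
theorem cost_le_timeBound (hm : 3 ≤ m) (hk : 1 ≤ k) (hkm : k < m) (hn : 2 ≤ n) :
    60000 * (d + 3) * (m : ℝ) ^ 2 * Real.log m * (Nat.clog 2 k + 2) +
      ((4 * d + 8) * m + 20 : ℕ) + 301 * (m ^ 2 * n : ℕ) ≤
      1800000 * (d + 3) * timeBound n m k := by
  have hlm := log_size_ge hm
  have hk1 : (1 : ℝ) ≤ k := by exact_mod_cast hk
  have hm3 : (3 : ℝ) ≤ m := by exact_mod_cast hm
  have hn2 : (2 : ℝ) ≤ n := by exact_mod_cast hn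
  have hd : (0 : ℝ) ≤ d := Nat.cast_nonneg d
  have hlk : 0 ≤ Real.log k := Real.log_nonneg hk1
  have h1 : (Nat.clog 2 k + 2 : ℝ) ≤ 3 * (1 + Real.log k) := by
    have := clog_le_log hk
    linarith
  have h2 := sq_mul_log_le hm hk hkm
  set Y := m * k * Real.log (m / k) * (sizeBound m k + m) with hY
  have hT : timeBound n m k = Y + m ^ 2 * n := by rw [hY, timeBound, sizeBound]
  have h3 : 60000 * (d + 3) * (m : ℝ) ^ 2 * Real.log m * (Nat.clog 2 k + 2) ≤
      1800000 * (d + 3) * Y := by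
    calc 60000 * (d + 3) * (m : ℝ) ^ 2 * Real.log m * (Nat.clog 2 k + 2)
        ≤ 60000 * (d + 3) * (m : ℝ) ^ 2 * Real.log m * (3 * (1 + Real.log k)) := by gcongr
      _ = 180000 * (d + 3) * (m ^ 2 * Real.log m * (1 + Real.log k)) := by ring
      _ ≤ 180000 * (d + 3) * (10 * Y) := by gcongr
      _ = _ := by ring
  have h4 : (m : ℝ) ≤ m ^ 2 * n := by nlinarith
  have h5 : (1 : ℝ) ≤ m ^ 2 * n := by linarith
  rw [hT]
  push_cast
  nlinarith [mul_nonneg hd (show (0 : ℝ) ≤ m ^ 2 * n by linarith), mul_le_mul_of_nonneg_left h4 hd]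

/-! ## The limits for the given input -/

variable (d n m) in
/-- The storage that the program uses. -/
def limits : Limits where
  arrays := 25
  len := 3000 * (d + 1) * (n + m ^ 2)
  word := (n + m) ^ 9

theorem ample_limits (hm : 3 ≤ m) (hn : 2 ≤ n) : Ample (limits d n m) d n m := by
  refine ⟨le_rfl, ?_, ?_, ?_, hm⟩
  · exact Nat.mul_le_mul_left _ (by omega)
  · exact (Nat.le_add_right n m).trans (Nat.le_self_pow (by norm_num) _)
  -- The base `n + m` is at least 5, and `5 ^ 5 = 3125` exceeds 1000.
  · calc 1000 * m ^ 4 ≤ 5 ^ 5 * m ^ 4 := by gcongr; norm_num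
      _ ≤ (n + m) ^ 5 * (n + m) ^ 4 := by gcongr <;> omega
      _ = (n + m) ^ 9 := by ring

variable (P : PolygonalCurve d n) (T : Breakpoints m) (Δ : ℝ)

theorem inputMem_ints_zero {a i : ℕ} (h : a ≠ 0) : (inputMem P T Δ).ints a i = 0 := by
  simp only [inputMem]
  split <;> simp_all

theorem safe_inputMem (hm : 3 ≤ m) (hn : 2 ≤ n) : (limits d n m).Safe (inputMem P T Δ) := by
  have hword : n + m ≤ (n + m) ^ 9 := Nat.le_self_pow (by norm_num) _
  have hlen : 3000 * (n + m ^ 2) + 3000 * (n * d) ≤ (limits d n m).len := by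
    rw [limits]; nlinarith [Nat.zero_le (d * m ^ 2)]
  have hm2 : m ≤ m ^ 2 := Nat.le_self_pow (by norm_num) _
  constructor
  · intro p hp
    simp only [inputMem, Finset.mem_union, mem_cells] at hp
    refine ⟨show p.2.1 < 25 by omega, by omega⟩
  · intro a i
    simp only [inputMem, limits]
    split <;> omega

end Subtraj

end

theorem mainTheorem2 :
    ∃ A : ℝ, ∀ d : ℕ, ∃ (prog : RealRAM.Prog) (B : ℝ) (w : ℕ),
      ∀ (n m k : ℕ) (P : Subtraj.PolygonalCurve d n) (T : Subtraj.Breakpoints m) (Δ : ℝ≥0),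
        3 ≤ m → k < m →
        (∃ Copt : Finset (Subtraj.Center d 2),
          Copt.card = k ∧ Subtraj.clusterCost P T Copt ≤ (Δ : ℝ≥0∞)) →
        -- every halting run outputs few centers of cost at most `6Δ`
        (∀ c : RealRAM.Config,
          RealRAM.Reachable prog (Subtraj.inputMem P T (Δ : ℝ)) c → c.1 = [] →
            ((Subtraj.outputCenters d c.2).card : ℝ) ≤ A * Subtraj.sizeBound m k ∧
            Subtraj.clusterCost P T (Subtraj.outputCenters d c.2) ≤ 6 * (Δ : ℝ≥0∞)) ∧
        -- expected running time
        RealRAM.expectedTime prog (Subtraj.inputMem P T (Δ : ℝ)) ≤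
          ENNReal.ofReal (B * Subtraj.timeBound n m k) ∧
        -- space, and the word length `O(log (n + m))` of the integers
        (∀ c : RealRAM.Config,
          RealRAM.Reachable prog (Subtraj.inputMem P T (Δ : ℝ)) c →
            (c.2.used.card : ℝ) ≤ B * ((n : ℝ) + (m : ℝ) ^ 2) ∧
            ∀ a i : ℕ, c.2.ints a i ≤ (n + m) ^ w) := by
  refine ⟨12000, fun d => ⟨Subtraj.clusterP d, 1800000 * (d + 3), 9, ?_⟩⟩
  rintro n m k P T Δ hm hkm ⟨Copt, hcard, hcost⟩
  have hn := P.two_le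
  have hΔ : (0 : ℝ) ≤ Δ := Δ.2
  rw [← ENNReal.ofReal_coe_nnreal] at hcost
  -- A finite cost needs at least one center, since the first element has to be covered.
  have hk : 1 ≤ k := by
    obtain ⟨-, -, -, -, -, q, hq, -⟩ :=
      Subtraj.exists_intervals_of_clusterCost_le hΔ hcost 0 (by omega)
    exact hcard ▸ Finset.card_pos.2 ⟨q, hq⟩
  -- The postcondition is `Good`. From it alone both the size and the cost of the output follow for
  -- every halting run.
  obtain ⟨hreach, htime⟩ := RealRAM.run_bounds (Subtraj.safe_inputMem P T Δ hm hn)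
    ENNReal.ofReal_ne_top fun Φ hΦ => Subtraj.ert_clusterP_le (Subtraj.ample_limits hm hn)
      (Subtraj.safe_inputMem P T Δ hm hn) hΔ ⟨rfl, fun _ _ => rfl⟩
      (fun a i ha => Subtraj.inputMem_ints_zero P T Δ (by omega)) hk hkm hcard.le hcost
      (Subtraj.enough hm) hΦ
  refine ⟨fun c hc hhalt => ?_, htime.trans (ENNReal.ofReal_le_ofReal
    (Subtraj.cost_le_timeBound hm hk hkm hn)), fun c hc => ⟨?_, (hreach c hc).1.word⟩⟩
  · obtain ⟨⟨lg, hlg, hN⟩, hcov⟩ := (hreach c hc).2 hhalt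
    constructor
    · refine le_trans (Nat.cast_le.2 ?_) (Subtraj.card_le_sizeBound hm hk hlg hN)
      exact Finset.card_image_le.trans_eq (Finset.card_range _)
    · refine (Subtraj.clusterCost_le hΔ fun z hz => ?_).trans_eq ?_
      · obtain ⟨r, hr, i, j, hrij, hz⟩ := hcov z hz
        exact ⟨_, Finset.mem_image_of_mem _ (Finset.mem_range.2 hr), i, j,
          PiLp.ext fun c => hrij.1 c c.2, PiLp.ext fun c => hrij.2 c c.2, hz⟩
      · rw [ENNReal.ofReal_mul (by norm_num), ENNReal.ofReal_coe_nnreal]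
        norm_num
  · have h1 : (c.2.used.card : ℝ) ≤ 2 * (25 * (3000 * (d + 1) * (n + m ^ 2))) := by
      exact_mod_cast (hreach c hc).1.card_used_le
    have h2 : (0 : ℝ) ≤ n + m ^ 2 := by positivity
    have h3 : (0 : ℝ) ≤ d := Nat.cast_nonneg d
    nlinarith [mul_nonneg h3 h2]
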